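/- Let $f(z,w)\in\mathbb C[z,w]$ be squarefree, not divisible by $z$, with $f(0,0)=0$, and let $n$ be the multiplicity of $w=0$ as a root of $f(0,w)$. Let $E_n=\mathbb C^n/S_n$ be the space of unordered $n$-tuples of complex numbers, $\Delta\subset E_n$ the set of tuples with a repeated entry, and $B_n=\pi_1(E_n\setminus\Delta,\{1,\dots,n\})$ the braid group, with standard generators $\sigma_1,\dots,\sigma_{n-1}$ ($\sigma_i$ is the counterclockwise half turn that exchanges $i$ and $i+1$). A braid is positive if it is a product of standard generators without inverses, and strictly positive if it has such an expression in which each of $\sigma_1,\dots,\sigma_{n-1}$ occurs. The closed braid given by a loop $\ell$ in $E_n\setminus\Delta$ is the closure of $\beta\in B_n$ if $c\,\ell\,c^{-1}$ represents $\beta$ for some path $c$ in $E_n\setminus\Delta$ from $\{1,\dots,n\}$ to the base point of $\ell$. Then $n\ge 1$ and, for all sufficiently small $\delta>0$ and all $\varepsilon>0$ sufficiently small with respect to $\delta$, the following hold. 1. For $|z|\le\varepsilon$ the equation $f(z,w)=0$ has exactly $n$ roots with $|w|<\delta$, counted with multiplicity. They define a continuous $n$-valued function $F:\{|z|\le\varepsilon\}\to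 E_n$, analytic for $|z|<\varepsilon$, with $F(0)=\{0,\dots,0\}$ and $F(z)\notin\Delta$ for $z\ne0$. 2. The link of the singularity of $\{f=0\}$ at the origin, that is, the intersection of $\{f=0\}$ with the boundary of the bidisk $\{|z|\le\varepsilon,\ |w|\le\delta\}$, is the graph of $F$ over the circle $|z|=\varepsilon$. 3. For $0<r\le\varepsilon$ the roots over the circle $z=re^{i\theta}$ can be written as $F(re^{i\theta})=\{w_1(\theta),\dots,w_n(\theta)\}$ with continuous $w_i:\mathbb R\to\mathbb C$, and for $i\neq j$ the difference $w_i-w_j$ has no zero and has a differentiable argument with $$\frac{d\arg(w_i-w_j)}{d\theta}>0\quad\text{for all }\theta .$$ 4. The closed braid given by the loop $\theta\mapsto F(\varepsilon e^{i\theta})$, $0\le\theta\le2\pi$, in $E_n\setminus\Delta$ is the closure of a strictly positive (in particular positive) braid in $B_n$. 5. Each component of the link is the knot $\{(t^p,\alpha(t)):|t|^p=\varepsilon\}$ of a branch of $\{f=0\}$ at the origin, where $t\mapsto(t^p,\alpha(t))$, $p\ge1$, $\alpha(0)=0$, is a one-to-one analytic parametrization of the branch on $|t|^p\le\varepsilon$.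 For any two branches parametrized in this way whose knots are distinct, the linking number of the knots (the total winding number, over the circle $|z|=\varepsilon$, of the differences $a-b$ of points $a$ of the first and $b$ of the second knot over the same $z$) equals the intersection number of the branches at the origin (the order at $t=0$ of the equation $\prod_{s^q=z}(w-\beta(s))$ of the second branch $s\mapsto(s^q,\beta(s))$ along the first one), and it is positive. -/

import Mathlib

open Polynomial
open scoped Polynomial.Bivariate

noncomputable section

namespace BraidLink

/-! ### Unordered tuples, the discriminant locus and the configuration space -/

/-- The space `E_n` of unordered `n`-tuples of complex numbers, duplications allowed. -/
def UnorderedTuples (n : ℕ) : Type := Sym ℂ n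

/-- The underlying multiset of an unordered tuple. -/
def UnorderedTuples.toMultiset {n : ℕ} (s : UnorderedTuples n) : Multiset ℂ := s.1

/-- The quotient map `ℂⁿ → E_n = ℂⁿ / S_n`. -/
def ofTuple {n : ℕ} (v : Fin n → ℂ) : UnorderedTuples n :=
  ⟨(Finset.univ : Finset (Fin n)).val.map v, by simp⟩

/-- `E_n` carries the quotient topology of `ℂⁿ / S_n`. -/
instance (n : ℕ) : TopologicalSpace (UnorderedTuples n) :=
  TopologicalSpace.coinduced (ofTuple (n := n)) inferInstance

/-- The discriminant locus `Δ ⊆ E_n`: the unordered tuples with at least one duplication. -/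
def discriminantLocus (n : ℕ) : Set (UnorderedTuples n) := {s | ¬ s.toMultiset.Nodup}

/-- The configuration space `E_n \ Δ` of `n` distinct points in `ℂ`. -/
abbrev Conf (n : ℕ) : Type := {s : UnorderedTuples n // s ∉ discriminantLocus n}

/-- An `n`-valued function is analytic on `U` if the coefficients `c_k` of
`(w - r_1) ⋯ (w - r_n) = w ^ n + c_1 w ^ (n - 1) + ⋯ + c_n`, where `F z = {r_1, …, r_n}`,
are analytic functions of `z` on `U`. -/
def IsAnalyticMultivaluedOn {n : ℕ} (F : ℂ → UnorderedTuples n) (U : Set ℂ) : Prop :=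
  ∀ k : ℕ, AnalyticOnNhd ℂ
    (fun z => (((F z).toMultiset.map (fun r => (X - C r : ℂ[X]))).prod).coeff k) U

theorem continuous_ofTuple {n : ℕ} : Continuous (ofTuple (n := n)) :=
  continuous_coinduced_rng

theorem ofTuple_comp_perm {n : ℕ} (v : Fin n → ℂ) (e : Equiv.Perm (Fin n)) :
    ofTuple (v ∘ e) = ofTuple v := by
  apply Subtype.ext
  change Multiset.map (v ∘ e) Finset.univ.val = Multiset.map v Finset.univ.val
  rw [← Multiset.map_map, Multiset.map_univ_val_equiv e]

theorem ofTuple_notMem_discriminantLocus {n : ℕ} {v : Fin n → ℂ}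
    (hv : Function.Injective v) : ofTuple v ∉ discriminantLocus n := by
  intro h
  exact h (Finset.univ.nodup.map hv)

/-- The base point `* = {1, …, n}` of the configuration space. -/
def basePoint (n : ℕ) : Conf n :=
  ⟨ofTuple fun k => (k : ℂ) + 1, ofTuple_notMem_discriminantLocus fun a b h => by
    simpa [Fin.ext_iff] using h⟩

/-! ### The braid group, its standard generators and positivity -/

/-- The braid group on `n` strings, `B_n = π₁(E_n \ Δ, *)`. (Mathlib's product of loops `a * b`
runs through `b` first; the positivity notions below do not depend on this convention.) -/
abbrev BraidGroup (n : ℕ) : Type := FundamentalGroup (Conf n) (basePoint n)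

/-- The strings of the standard generator, at time `t`: the points `i + 1` and `i + 2` make
a counterclockwise half turn about their midpoint `i + 3 / 2`, all other points
of `{1, …, n}` stay fixed. (Indices `k`, `i` start at `0`.) -/
def halfTwist (n : ℕ) (i : Fin (n - 1)) (t : ℝ) (k : Fin n) : ℂ :=
  if (k : ℕ) = i then (i : ℂ) + 3 / 2 - Complex.exp (Real.pi * t * Complex.I) / 2
  else if (k : ℕ) = i + 1 then (i : ℂ) + 3 / 2 + Complex.exp (Real.pi * t * Complex.I) / 2
  else (k : ℂ) + 1

theorem continuous_halfTwist (n : ℕ) (i : Fin (n - 1)) : Continuous (halfTwist n i) := by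
  refine continuous_pi fun k => ?_
  unfold halfTwist
  split_ifs <;> fun_prop

theorem halfTwist_injective (n : ℕ) (i : Fin (n - 1)) (t : ℝ) :
    Function.Injective (halfTwist n i t) := by
  have key : ∀ (m : ℕ) (c : ℂ), ‖c‖ = 1 → (i : ℂ) + 3 / 2 + c / 2 = (m : ℂ) + 1 →
      m = i ∨ m = i + 1 := by
    intro m c hc h
    have h1 : c = (((2 * m - 2 * i - 1 : ℤ) : ℝ) : ℂ) := by
      push_cast
      linear_combination 2 * h
    rw [h1, Complex.norm_real, Real.norm_eq_abs, ← Int.cast_abs] at hc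
    have h2 : |(2 * m - 2 * i - 1 : ℤ)| = 1 := by exact_mod_cast hc
    rcases abs_eq (zero_le_one' ℤ) |>.1 h2 with h3 | h3 <;> omega
  have he : ‖Complex.exp (Real.pi * t * Complex.I)‖ = 1 := by
    have := Complex.norm_exp_ofReal_mul_I (Real.pi * t)
    push_cast at this
    exact this
  have he' : ‖-Complex.exp (Real.pi * t * Complex.I)‖ = 1 := by rwa [norm_neg]
  have hne : Complex.exp (Real.pi * t * Complex.I) ≠ 0 := Complex.exp_ne_zero _
  intro a b hab
  unfold halfTwist at hab
  generalize Complex.exp (Real.pi * t * Complex.I) = c at *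
  apply Fin.ext
  split_ifs at hab with h1 h2 h3 h4 h5 h6 h7 h8
  · omega
  · exact absurd (by linear_combination -hab) hne
  · rcases key b (-c) he' (by linear_combination hab) with h | h <;> omega
  · exact absurd (by linear_combination hab) hne
  · omega
  · rcases key b c he hab with h | h <;> omega
  · rcases key a (-c) he' (by linear_combination -hab) with h | h <;> omega
  · rcases key a c he hab.symm with h | h <;> omega
  · have h : (a : ℂ) = b := by linear_combination hab
    exact_mod_cast h

theorem ofTuple_halfTwist_zero (n : ℕ) (i : Fin (n - 1)) :
    ofTuple (halfTwist n i 0) = (basePoint n).1 := by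
  change ofTuple _ = ofTuple _
  congr 1
  funext k
  unfold halfTwist
  split_ifs with h1 h2
  · simp [h1]; ring
  · simp [h2]; ring
  · rfl

theorem ofTuple_halfTwist_one (n : ℕ) (i : Fin (n - 1)) :
    ofTuple (halfTwist n i 1) = (basePoint n).1 := by
  have hi := i.2
  change ofTuple _ = ofTuple _
  rw [← ofTuple_comp_perm (fun k : Fin n => (k : ℂ) + 1)
    (Equiv.swap ⟨i, by omega⟩ ⟨i + 1, by omega⟩)]
  congr 1
  funext k
  unfold halfTwist
  simp only [Function.comp_apply, Equiv.swap_apply_def, Fin.ext_iff, Complex.ofReal_one, mul_one,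
    Complex.exp_pi_mul_I]
  split_ifs with h1 h2
  · push_cast; ring
  · ring
  · rfl

/-- The loop in the configuration space that represents the standard generator. With
`z = exp (2 π I t)` it is the unordered tuple of the roots of
`(w ^ 2 - (2 j + 1) w + (j ^ 2 + j + (1 - z) / 4)) * ∏ (w - m)`, `m ≠ j, j + 1`, `j = i + 1`,
where `z` runs counterclockwise through the unit circle. -/
def generatorLoop (n : ℕ) (i : Fin (n - 1)) : Path (basePoint n) (basePoint n) where
  toFun t := ⟨ofTuple (halfTwist n i t), ofTuple_notMem_discriminantLocus
    (halfTwist_injective n i t)⟩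
  continuous_toFun := Continuous.subtype_mk
    (continuous_ofTuple.comp ((continuous_halfTwist n i).comp continuous_subtype_val)) _
  source' := Subtype.ext (ofTuple_halfTwist_zero n i)
  target' := Subtype.ext (ofTuple_halfTwist_one n i)

/-- The braid represented by a loop at the base point. -/
def braidOfLoop {n : ℕ} (l : Path (basePoint n) (basePoint n)) : BraidGroup n :=
  FundamentalGroup.fromPath (Path.Homotopic.Quotient.mk l)

/-- The standard generators `σ_1, …, σ_{n-1}` of `B_n` (indexed from `0`). -/
def sigma (n : ℕ) (i : Fin (n - 1)) : BraidGroup n := braidOfLoop (generatorLoop n i)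

/-- A braid is positive if it is a word in the standard generators without inverses. -/
def IsPositive {n : ℕ} (β : BraidGroup n) : Prop :=
  ∃ l : List (Fin (n - 1)), β = (l.map (sigma n)).prod

/-- A braid is strictly positive if it is a word in the standard generators without inverses
in which each standard generator occurs. -/
def IsStrictlyPositive {n : ℕ} (β : BraidGroup n) : Prop :=
  ∃ l : List (Fin (n - 1)), (∀ i, i ∈ l) ∧ β = (l.map (sigma n)).prod

/-- The closed braid of the loop `l` in the configuration space is the closure of the braid `β`:
for some path `c` from the standard base point to the base point of `l`, the loop
`c · l · c⁻¹` represents `β`. -/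
def IsClosureOf {n : ℕ} {p : Conf n} (l : Path p p) (β : BraidGroup n) : Prop :=
  ∃ c : Path (basePoint n) p, braidOfLoop (c.trans (l.trans c.symm)) = β

/-! ### Local curve, link of the singularity and branches -/

/-- The roots `w` of `f(z, w) = 0` with `|w| < δ`, with multiplicity. The outer variable of
`f : ℂ[X][Y]` is `w`, the inner one is `z`. -/
def localRoots (f : ℂ[X][Y]) (δ : ℝ) (z : ℂ) : Multiset ℂ :=
  open Classical in (f.map (evalRingHom z)).roots.filter (fun w => ‖w‖ < δ)

/-- The link of the singularity of `{f = 0}` at the origin, in the boundary of the bidisk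
`{|z| ≤ ε, |w| ≤ δ}`. -/
def singularityLink (f : ℂ[X][Y]) (ε δ : ℝ) : Set (ℂ × ℂ) :=
  {x | f.evalEval x.1 x.2 = 0} ∩
    frontier (Metric.closedBall (0 : ℂ) ε ×ˢ Metric.closedBall (0 : ℂ) δ)

/-- `t ↦ (t ^ p, α t)`, `|t| ^ p ≤ ε`, is a one-to-one analytic parametrization of a branch at the
origin of the curve `{f = 0}`. -/
structure IsBranch (f : ℂ[X][Y]) (ε : ℝ) (p : ℕ) (α : ℂ → ℂ) : Prop where
  pos : 0 < p
  analytic : AnalyticOnNhd ℂ α {t | ‖t‖ ^ p ≤ ε}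
  origin : α 0 = 0
  injective : Set.InjOn (fun t : ℂ => (t ^ p, α t)) {t | ‖t‖ ^ p ≤ ε}
  onCurve : ∀ t : ℂ, ‖t‖ ^ p ≤ ε → f.evalEval (t ^ p) (α t) = 0

/-- The knot which the branch contributes to the link, lying over the circle `|z| = ε`. -/
def branchKnot (ε : ℝ) (p : ℕ) (α : ℂ → ℂ) : Set (ℂ × ℂ) :=
  (fun t : ℂ => (t ^ p, α t)) '' {t | ‖t‖ ^ p = ε}

/-- The values over `z` of the branch parametrized by `t ↦ (t ^ p, α t)`, as a
`p`-valued function of `z`: all `α t` with `t ^ p = z`. -/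
def sheets (p : ℕ) (α : ℂ → ℂ) (z : ℂ) : Multiset ℂ := (nthRoots p z).map α

/-- The intersection number at the origin of the branches parametrized by `t ↦ (t ^ p, α t)` and
`t ↦ (t ^ q, β t)`: the order at `t = 0` of the (Weierstrass) equation
`g(z, w) = ∏_{s ^ q = z} (w - β s)` of the second branch along the first one. -/
def intersectionNumber (p : ℕ) (α : ℂ → ℂ) (q : ℕ) (β : ℂ → ℂ) : ℕ∞ :=
  analyticOrderAt (fun t : ℂ => ((sheets q β (t ^ p)).map (fun b => α t - b)).prod) 0

/-- The function `g`, on the circle `ℝ / 2πℤ`, is nonvanishing with winding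
number `m` about `0`. -/
def HasWindingNumber (g : ℝ → ℂ) (m : ℤ) : Prop :=
  ∃ φ : ℝ → ℝ, Continuous φ ∧
    (∀ θ, g θ ≠ 0 ∧ g θ = ‖g θ‖ * Complex.exp (φ θ * Complex.I)) ∧
    φ (2 * Real.pi) - φ 0 = 2 * Real.pi * m

/-- The disjoint closed braids over the circle `|z| = ε` which are the graphs of the multivalued
functions `A` and `B` have linking number `m`: the total winding number
of the differences `a - b` of their points, i.e. half the signed number of the crossings
between the two in a braid diagram. -/
def HasLinkingNumber (ε : ℝ) (A B : ℂ → Multiset ℂ) (m : ℤ) : Prop :=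
  HasWindingNumber (fun θ =>
    ((A (ε * Complex.exp (θ * Complex.I))).map (fun a =>
      ((B (ε * Complex.exp (θ * Complex.I))).map (fun b => a - b)).prod)).prod) m

end BraidLink

end

/-!
The substitution `z = exp (I τ)` uniformizes the curve: over a half plane `c < Im τ` its roots
`w₁, …, w_n` are single-valued holomorphic functions, which tend to `0` as `Im τ → ∞` and which
the monodromy `τ ↦ τ + 2π` permutes by some `π`.

A difference `w_i - w_j` has no zero, has a period `2πM` and tends to `0`, so in the coordinate
`t = exp (I τ / M)` it is `t ^ m * exp (L t)` with `m ≥ 1` and `L` holomorphic at `0`. On a small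
circle its argument thus has derivative close to `m / M`, which is positive.

So any two strands turn counterclockwise about each other. After generic times are chosen,
the order of the real parts of the strands is changed only by counterclockwise half turns, that is,
by generators `σ_k`, and since any two strands eventually exchange their order, each `σ_k` occurs.

The branches are the cycles of `π`. The product of the differences between the strands of
two cycles again has the form `t ^ m * exp (L t)`: the exponent `m` is the order of one equation
along the other branch, and it is also the total winding number of the differences.
-/

noncomputable section

namespace BraidLink

/-! ### Paths of unordered tuples and their lifts -/

section Lifts

theorem homotopic_of_factorization {S T : Type*} [TopologicalSpace S] [TopologicalSpace T]
    [SimplyConnectedSpace S] (H : C(S, T)) {s₀ s₁ : S} (δ δ' : Path s₀ s₁) {a b : T}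
    {γ γ' : Path a b} (h : ∀ t, γ t = H (δ t)) (h' : ∀ t, γ' t = H (δ' t)) :
    γ.Homotopic γ' := by
  obtain rfl : H s₀ = a := by simpa using (h 0).symm
  obtain rfl : H s₁ = b := by simpa using (h 1).symm
  obtain rfl : γ = δ.map H.continuous := by ext t; simp [h]
  obtain rfl : γ' = δ'.map H.continuous := by ext t; simp [h']
  exact (SimplyConnectedSpace.paths_homotopic δ δ').map H

variable {n : ℕ}

/-- The path `δ` of ordered tuples lifts the path `γ` in the configuration space. -/
def IsLift {p q : Conf n} (γ : Path p q) {u v : Fin n → ℂ} (δ : Path u v) : Prop :=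
  ∀ t, (γ t).1 = ofTuple (δ t)

namespace IsLift

variable {p q r : Conf n} {u v x : Fin n → ℂ}

theorem trans {γ₁ : Path p q} {γ₂ : Path q r} {δ₁ : Path u v} {δ₂ : Path v x}
    (h₁ : IsLift γ₁ δ₁) (h₂ : IsLift γ₂ δ₂) : IsLift (γ₁.trans γ₂) (δ₁.trans δ₂) := by
  intro t
  rw [Path.trans_apply, Path.trans_apply]
  split_ifs
  exacts [h₁ _, h₂ _]

theorem symm {γ : Path p q} {δ : Path u v} (h : IsLift γ δ) : IsLift γ.symm δ.symm :=
  fun t => h (unitInterval.symm t)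

theorem source {γ : Path p q} {δ : Path u v} (h : IsLift γ δ) : p.1 = ofTuple u := by
  simpa using h 0

theorem target {γ : Path p q} {δ : Path u v} (h : IsLift γ δ) : q.1 = ofTuple v := by
  simpa using h 1

theorem comp_perm {γ : Path p q} {δ : Path u v} (h : IsLift γ δ) (e : Equiv.Perm (Fin n)) :
    IsLift γ (δ.map (f := (· ∘ e)) (by fun_prop)) :=
  fun t => (h t).trans (ofTuple_comp_perm _ e).symm

theorem homotopic {K : Set (Fin n → ℂ)} [SimplyConnectedSpace K]
    (hinj : ∀ v ∈ K, Function.Injective v) {γ γ' : Path p q} {δ δ' : Path u v}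
    (hδ : Set.range δ ⊆ K) (hδ' : Set.range δ' ⊆ K) (h : IsLift γ δ) (h' : IsLift γ' δ') :
    γ.Homotopic γ' := by
  rw [Set.range_subset_iff] at hδ hδ'
  let H : C(K, Conf n) :=
    ⟨fun x => ⟨ofTuple x.1, ofTuple_notMem_discriminantLocus (hinj _ x.2)⟩,
      (continuous_ofTuple.comp continuous_subtype_val).subtype_mk _⟩
  let restrict (ε : Path u v) (hε : ∀ t, ε t ∈ K) :
      Path (⟨u, by simpa using hδ 0⟩ : K) ⟨v, by simpa using hδ 1⟩ :=
    { toFun := fun t => ⟨ε t, hε t⟩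
      continuous_toFun := ε.continuous.subtype_mk _
      source' := Subtype.ext ε.source
      target' := Subtype.ext ε.target }
  exact homotopic_of_factorization H (restrict δ hδ) (restrict δ' hδ')
    (fun t => Subtype.ext (h t)) (fun t => Subtype.ext (h' t))

end IsLift

theorem exists_isLift {u v : Fin n → ℂ} (δ : Path u v) (hδ : ∀ t, Function.Injective (δ t))
    {p q : Conf n} (hp : p.1 = ofTuple u) (hq : q.1 = ofTuple v) :
    ∃ γ : Path p q, IsLift γ δ :=
  ⟨{ toFun := fun t => ⟨ofTuple (δ t), ofTuple_notMem_discriminantLocus (hδ t)⟩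
     continuous_toFun := (continuous_ofTuple.comp δ.continuous).subtype_mk _
     source' := Subtype.ext (by simp [hp])
     target' := Subtype.ext (by simp [hq]) }, fun _ => rfl⟩

/-! ### Sorted tuples -/

theorem convex_setOf_re_lt (i j : Fin n) : Convex ℝ {x : Fin n → ℂ | (x i).re < (x j).re} := by
  have h := convex_halfSpace_lt (Complex.reLm ∘ₗ
    ((.proj i : (Fin n → ℂ) →ₗ[ℝ] ℂ) - .proj j)).isLinear 0
  simpa using h

theorem convex_setOf_im_lt (i j : Fin n) : Convex ℝ {x : Fin n → ℂ | (x i).im < (x j).im} := by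
  have h := convex_halfSpace_lt (Complex.imLm ∘ₗ
    ((.proj i : (Fin n → ℂ) →ₗ[ℝ] ℂ) - .proj j)).isLinear 0
  simpa using h

theorem convex_setOf_im_le (i j : Fin n) : Convex ℝ {x : Fin n → ℂ | (x i).im ≤ (x j).im} := by
  have h := convex_halfSpace_le (Complex.imLm ∘ₗ
    ((.proj i : (Fin n → ℂ) →ₗ[ℝ] ℂ) - .proj j)).isLinear 0
  simpa using h

/-- Sorted tuples, that is, those whose entries have increasing real parts, are the tuples in
which braid diagrams are read. -/
def IsSorted (v : Fin n → ℂ) : Prop := StrictMono fun i => (v i).re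

theorem IsSorted.injective {v : Fin n → ℂ} (h : IsSorted v) : Function.Injective v :=
  fun _ _ hij => StrictMono.injective h (congrArg Complex.re hij)

theorem convex_setOf_isSorted : Convex ℝ {v : Fin n → ℂ | IsSorted v} := by
  simp only [IsSorted, StrictMono, Set.ofPred_forall]
  exact convex_iInter₂ fun i j => convex_iInter fun _ => convex_setOf_re_lt i j

theorem mem_toMultiset_ofTuple {v : Fin n → ℂ} {x : ℂ} :
    x ∈ (ofTuple v).toMultiset ↔ x ∈ Set.range v := by
  simp [ofTuple, UnorderedTuples.toMultiset]

theorem range_eq_of_ofTuple_eq {u v : Fin n → ℂ} (h : ofTuple u = ofTuple v) :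
    Set.range u = Set.range v := by
  ext x
  rw [← mem_toMultiset_ofTuple, h, mem_toMultiset_ofTuple]

theorem IsSorted.eq_of_ofTuple_eq {u v : Fin n → ℂ} (hu : IsSorted u) (hv : IsSorted v)
    (h : ofTuple u = ofTuple v) : u = v := by
  have hrange := range_eq_of_ofTuple_eq h
  have hre : (fun i => (u i).re) = fun i => (v i).re := by
    rw [← StrictMono.range_inj hu hv]
    simpa only [← Set.range_comp'] using congrArg (Complex.re '' ·) hrange
  funext i
  obtain ⟨j, hj⟩ : u i ∈ Set.range v := hrange ▸ Set.mem_range_self i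
  have hji : j = i := StrictMono.injective hv ((congrArg Complex.re hj).trans (congrFun hre i))
  rw [← hj, hji]

/-- The sorted tuple `(1, …, n)` over the base point of the configuration space. -/
def baseTuple (n : ℕ) : Fin n → ℂ := fun k => (k : ℂ) + 1

theorem isSorted_baseTuple : IsSorted (baseTuple n) := fun i j hij => by
  simpa [baseTuple] using hij

/-- A path from the base point with a lift through sorted tuples. -/
def IsSortedPath {p : Conf n} (c : Path (basePoint n) p) : Prop :=
  ∃ (x : Fin n → ℂ) (δ : Path (baseTuple n) x), Set.range δ ⊆ {v | IsSorted v} ∧ IsLift c δ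

theorem segment_subset_setOf_isSorted {u v : Fin n → ℂ} (hu : IsSorted u) (hv : IsSorted v) :
    Set.range (Path.segment u v) ⊆ {v | IsSorted v} := by
  rw [Path.range_segment]
  exact convex_setOf_isSorted.segment_subset hu hv

theorem exists_isLift_segment {K : Set (Fin n → ℂ)} (hK : Convex ℝ K)
    (hinj : ∀ v ∈ K, Function.Injective v) {u v : Fin n → ℂ} (hu : u ∈ K) (hv : v ∈ K)
    {p q : Conf n} (hp : p.1 = ofTuple u) (hq : q.1 = ofTuple v) :
    ∃ γ : Path p q, IsLift γ (Path.segment u v) :=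
  exists_isLift _ (fun t => hinj _ (hK.segment_subset hu hv
    (Path.range_segment u v ▸ Set.mem_range_self t))) hp hq

theorem exists_isSortedPath {p : Conf n} {x : Fin n → ℂ} (hx : IsSorted x)
    (hp : p.1 = ofTuple x) : ∃ c : Path (basePoint n) p, IsSortedPath c := by
  obtain ⟨c, hc⟩ := exists_isLift_segment convex_setOf_isSorted (fun _ => IsSorted.injective)
    isSorted_baseTuple hx (p := basePoint n) rfl hp
  exact ⟨c, x, _, segment_subset_setOf_isSorted isSorted_baseTuple hx, hc⟩

theorem IsSortedPath.homotopic {p : Conf n} {c d : Path (basePoint n) p} (hc : IsSortedPath c)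
    (hd : IsSortedPath d) : c.Homotopic d := by
  obtain ⟨x, δ, hδ, hcδ⟩ := hc
  obtain ⟨y, δ', hδ', hdδ⟩ := hd
  obtain rfl : x = y := IsSorted.eq_of_ofTuple_eq (hδ ⟨1, δ.target⟩) (hδ' ⟨1, δ'.target⟩)
    (hcδ.target.symm.trans hdδ.target)
  have : ContractibleSpace {v : Fin n → ℂ | IsSorted v} :=
    convex_setOf_isSorted.contractibleSpace ⟨_, isSorted_baseTuple⟩
  exact hcδ.homotopic (K := {v | IsSorted v}) (fun _ => IsSorted.injective) hδ hδ' hdδ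

/-! ### Braid words of paths -/

/-- The path `γ` represents the word `l` in the standard generators: closing it up to a loop at the
base point by sorted paths yields the product of the word. Only paths between tuples with distinct
real parts represent a word; the order of the factors in the braid group reverses the order in
which the letters are passed. -/
def HasWord (l : List (Fin (n - 1))) {p q : Conf n} (γ : Path p q) : Prop :=
  ∃ (c : Path (basePoint n) p) (d : Path (basePoint n) q), IsSortedPath c ∧ IsSortedPath d ∧
    braidOfLoop (c.trans (γ.trans d.symm)) = (l.map (sigma n)).prod

theorem braidOfLoop_eq_of_homotopic {l l' : Path (basePoint n) (basePoint n)}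
    (h : l.Homotopic l') : braidOfLoop l = braidOfLoop l' :=
  congrArg FundamentalGroup.fromPath (Path.Homotopic.Quotient.eq.2 h)

theorem HasWord.congr {l : List (Fin (n - 1))} {p q : Conf n} {γ γ' : Path p q}
    (h : HasWord l γ) (hγ : γ.Homotopic γ') : HasWord l γ' := by
  obtain ⟨c, d, hc, hd, hw⟩ := h
  exact ⟨c, d, hc, hd, hw ▸ braidOfLoop_eq_of_homotopic
    ((Path.Homotopic.refl c).hcomp (hγ.symm.hcomp (Path.Homotopic.refl _)))⟩

theorem HasWord.cast {l : List (Fin (n - 1))} {p q p' q' : Conf n} {γ : Path p q}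
    (h : HasWord l γ) (hp : p' = p) (hq : q' = q) : HasWord l (γ.cast hp hq) := by
  subst hp hq
  exact h

theorem HasWord.trans {l₁ l₂ : List (Fin (n - 1))} {p q r : Conf n} {γ₁ : Path p q}
    {γ₂ : Path q r} (h₁ : HasWord l₁ γ₁) (h₂ : HasWord l₂ γ₂) :
    HasWord (l₂ ++ l₁) (γ₁.trans γ₂) := by
  obtain ⟨c₁, d₁, hc₁, hd₁, hw₁⟩ := h₁
  obtain ⟨c₂, d₂, hc₂, hd₂, hw₂⟩ := h₂
  refine ⟨c₁, d₂, hc₁, hd₂, ?_⟩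
  have hcd := Path.Homotopic.Quotient.eq.2 (hd₁.homotopic hc₂)
  rw [List.map_append, List.prod_append, ← hw₁, ← hw₂, FundamentalGroup.mul_def]
  simp only [braidOfLoop, Path.Homotopic.Quotient.mk_trans, Path.Homotopic.Quotient.mk_symm, hcd,
    FundamentalGroup.fromPath, FundamentalGroup.fromArrow, Path.Homotopic.Quotient.trans_assoc]
  congr 2
  rw [← Path.Homotopic.Quotient.trans_assoc (Path.Homotopic.Quotient.symm _),
    Path.Homotopic.Quotient.symm_trans, Path.Homotopic.Quotient.refl_trans]

theorem hasWord_nil {p q : Conf n} {γ : Path p q} {u v : Fin n → ℂ} {δ : Path u v}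
    (hδ : Set.range δ ⊆ {v | IsSorted v}) (h : IsLift γ δ) : HasWord [] γ := by
  have hu : IsSorted u := hδ ⟨0, δ.source⟩
  obtain ⟨c, hc⟩ := exists_isSortedPath hu h.source
  have hcγ : IsSortedPath (c.trans γ) := by
    obtain ⟨x, ε, hε, hcε⟩ := hc
    obtain rfl : x = u := IsSorted.eq_of_ofTuple_eq (hε ⟨1, ε.target⟩) hu
      (hcε.target.symm.trans h.source)
    exact ⟨v, ε.trans δ, Path.trans_range ε δ ▸ Set.union_subset hε hδ, hcε.trans h⟩
  refine ⟨c, c.trans γ, hc, hcγ, ?_⟩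
  simp only [braidOfLoop, Path.Homotopic.Quotient.mk_trans, Path.Homotopic.Quotient.mk_symm]
  rw [← Path.Homotopic.Quotient.trans_assoc, ← Path.Homotopic.Quotient.mk_trans,
    Path.Homotopic.Quotient.trans_symm]
  rfl

/-! ### The word of a half twist -/

/-- The index of the left one of the two points that the generator `k` exchanges. -/
def leftIndex (k : Fin (n - 1)) : Fin n := ⟨k, by omega⟩

/-- The index of the right one of the two points that the generator `k` exchanges. -/
def rightIndex (k : Fin (n - 1)) : Fin n := ⟨k + 1, by omega⟩

theorem leftIndex_lt_rightIndex (k : Fin (n - 1)) : leftIndex k < rightIndex k := by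
  simp [leftIndex, rightIndex, Fin.lt_def]

/-- The transposition of indices which underlies the generator `k`. -/
def adjSwap (k : Fin (n - 1)) : Equiv.Perm (Fin n) := Equiv.swap (leftIndex k) (rightIndex k)

theorem adjSwap_adjSwap (k : Fin (n - 1)) (i : Fin n) : adjSwap k (adjSwap k i) = i :=
  Equiv.swap_apply_self _ _ _

theorem adjSwap_leftIndex (k : Fin (n - 1)) : adjSwap k (leftIndex k) = rightIndex k :=
  Equiv.swap_apply_left _ _

theorem adjSwap_rightIndex (k : Fin (n - 1)) : adjSwap k (rightIndex k) = leftIndex k :=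
  Equiv.swap_apply_right _ _

theorem adjSwap_lt (k : Fin (n - 1)) {i j : Fin n} (hij : i < j)
    (h : ¬ (i = leftIndex k ∧ j = rightIndex k)) : adjSwap k i < adjSwap k j := by
  simp only [adjSwap, Equiv.swap_apply_def]
  simp only [leftIndex, rightIndex, Fin.ext_iff, Fin.lt_def] at *
  split_ifs <;> simp_all <;> omega

theorem adjSwap_le_iff {k m : Fin (n - 1)} (hkm : m ≠ k) (i : Fin n) :
    (adjSwap k i : ℕ) ≤ m ↔ (i : ℕ) ≤ m := by
  simp only [adjSwap, Equiv.swap_apply_def, leftIndex, rightIndex, Fin.ext_iff, ne_eq] at *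
  split_ifs <;> simp_all <;> omega

theorem halfTwist_zero (k : Fin (n - 1)) : halfTwist n k 0 = baseTuple n := by
  funext i
  simp only [halfTwist, baseTuple]
  split_ifs <;> simp_all <;> ring

theorem halfTwist_one (k : Fin (n - 1)) : halfTwist n k 1 = baseTuple n ∘ adjSwap k := by
  funext i
  simp only [Function.comp_apply, halfTwist, adjSwap, Equiv.swap_apply_def, baseTuple, leftIndex,
    rightIndex, Complex.ofReal_one, mul_one, Complex.exp_pi_mul_I, Fin.ext_iff]
  split_ifs <;> simp_all <;> ring

theorem re_halfTwist (k : Fin (n - 1)) (t : ℝ) (i : Fin n) :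
    (halfTwist n k t i).re =
      if (i : ℕ) = k then k + 3 / 2 - Real.cos (Real.pi * t) / 2
      else if (i : ℕ) = k + 1 then k + 3 / 2 + Real.cos (Real.pi * t) / 2
      else (i : ℝ) + 1 := by
  simp only [halfTwist, ← Complex.ofReal_mul]
  split_ifs <;> simp [Complex.exp_ofReal_mul_I_re, -Complex.ofReal_mul]

theorem im_halfTwist_rightIndex_sub_leftIndex (k : Fin (n - 1)) (t : ℝ) :
    (halfTwist n k t (rightIndex k)).im - (halfTwist n k t (leftIndex k)).im =
      Real.sin (Real.pi * t) := by
  rw [← Complex.exp_ofReal_mul_I_im]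
  simp [halfTwist, leftIndex, rightIndex]

theorem re_halfTwist_lt (k : Fin (n - 1)) (t : ℝ) {i j : Fin n} (hij : i < j)
    (h : ¬ (i = leftIndex k ∧ j = rightIndex k)) :
    (halfTwist n k t i).re < (halfTwist n k t j).re := by
  have hlb := Real.neg_one_le_cos (Real.pi * t)
  have hub := Real.cos_le_one (Real.pi * t)
  have hcast {a b : ℕ} (hab : a < b) : (a : ℝ) + 1 ≤ b := by exact_mod_cast hab
  rw [re_halfTwist, re_halfTwist]
  simp only [leftIndex, rightIndex, Fin.ext_iff, Fin.lt_def] at *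
  split_ifs
  all_goals first
    | omega
    | linarith [hcast hij]
    | have := hcast (show (i : ℕ) < k by omega)
      linarith
    | have := hcast (show (k : ℕ) + 1 < j by omega)
      push_cast at this
      linarith

/-- The tuples in which all pairs of points are in increasing order, except for the two points that
the generator `k` exchanges: there, the right one is above, or at the height of, the left one. All
diagrams of a single positive crossing live in this region, which is contractible. -/
def halfTwistRegion (k : Fin (n - 1)) : Set (Fin n → ℂ) :=
  {x | (∀ i j, i < j → ¬ (i = leftIndex k ∧ j = rightIndex k) → (x i).re < (x j).re) ∧
    x (leftIndex k) ≠ x (rightIndex k) ∧ (x (leftIndex k)).im ≤ (x (rightIndex k)).im}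

theorem injective_of_mem_halfTwistRegion {k : Fin (n - 1)} {x : Fin n → ℂ}
    (hx : x ∈ halfTwistRegion k) : Function.Injective x := by
  refine .of_lt_imp_ne fun i j hij => ?_
  by_cases h : i = leftIndex k ∧ j = rightIndex k
  · rw [h.1, h.2]
    exact hx.2.1
  · exact fun heq => (hx.1 i j hij h).ne (congrArg Complex.re heq)

theorem starConvex_halfTwistRegion {k : Fin (n - 1)} {u : Fin n → ℂ} (hu : u ∈ halfTwistRegion k)
    (him : (u (leftIndex k)).im < (u (rightIndex k)).im) :
    StarConvex ℝ u (halfTwistRegion k) := by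
  rw [starConvex_iff_forall_pos hu]
  intro x hx a b ha hb hab
  have hlt : ((a • u + b • x) (leftIndex k)).im < ((a • u + b • x) (rightIndex k)).im := by
    simpa using add_lt_add_of_lt_of_le (mul_lt_mul_of_pos_left him ha)
      (mul_le_mul_of_nonneg_left hx.2.2 hb.le)
  exact ⟨fun i j hij h => convex_setOf_re_lt i j (hu.1 i j hij h) (hx.1 i j hij h) ha.le hb.le hab,
    fun heq => hlt.ne (congrArg Complex.im heq), hlt.le⟩

theorem halfTwist_mem_halfTwistRegion (k : Fin (n - 1)) {t : ℝ} (ht : t ∈ unitInterval) :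
    halfTwist n k t ∈ halfTwistRegion k := by
  have hsin : 0 ≤ Real.sin (Real.pi * t) := Real.sin_nonneg_of_nonneg_of_le_pi
    (mul_nonneg Real.pi_pos.le ht.1) (mul_le_of_le_one_right Real.pi_pos.le ht.2)
  exact ⟨fun i j hij h => re_halfTwist_lt k t hij h,
    (halfTwist_injective n k t).ne (leftIndex_lt_rightIndex k).ne,
    by linarith [im_halfTwist_rightIndex_sub_leftIndex k t]⟩

instance simplyConnectedSpace_halfTwistRegion (k : Fin (n - 1)) :
    SimplyConnectedSpace (halfTwistRegion k) := by
  have hmem : halfTwist n k (1 / 2) ∈ halfTwistRegion k :=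
    halfTwist_mem_halfTwistRegion k ⟨by norm_num, by norm_num⟩
  have him := im_halfTwist_rightIndex_sub_leftIndex k (1 / 2)
  rw [mul_one_div, Real.sin_pi_div_two] at him
  have := (starConvex_halfTwistRegion hmem (by linarith)).contractibleSpace ⟨_, hmem⟩
  infer_instance

theorem IsSorted.mem_halfTwistRegion {k : Fin (n - 1)} {x : Fin n → ℂ} (hx : IsSorted x)
    (him : (x (leftIndex k)).im ≤ (x (rightIndex k)).im) : x ∈ halfTwistRegion k :=
  ⟨fun _ _ hij _ => hx hij, hx.injective.ne (leftIndex_lt_rightIndex k).ne, him⟩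

theorem IsSorted.comp_adjSwap_mem_halfTwistRegion {k : Fin (n - 1)} {x : Fin n → ℂ}
    (hx : IsSorted x) (him : (x (rightIndex k)).im ≤ (x (leftIndex k)).im) :
    x ∘ adjSwap k ∈ halfTwistRegion k :=
  ⟨fun _ _ hij h => hx (adjSwap_lt k hij h),
    (hx.injective.comp (adjSwap k).injective).ne (leftIndex_lt_rightIndex k).ne,
    by simpa only [Function.comp_apply, adjSwap_leftIndex, adjSwap_rightIndex] using him⟩

/-- The lift of the generator `k` given by the half twist. -/
def halfTwistPath (k : Fin (n - 1)) : Path (baseTuple n) (baseTuple n ∘ adjSwap k) where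
  toFun t := halfTwist n k t
  continuous_toFun := (continuous_halfTwist n k).comp continuous_subtype_val
  source' := halfTwist_zero k
  target' := halfTwist_one k

theorem range_halfTwistPath_subset (k : Fin (n - 1)) :
    Set.range (halfTwistPath k) ⊆ halfTwistRegion k :=
  Set.range_subset_iff.2 fun t => halfTwist_mem_halfTwistRegion k t.2

theorem range_segment_baseTuple_subset {k : Fin (n - 1)} {x : Fin n → ℂ} (hx : IsSorted x)
    (him : (x (leftIndex k)).im ≤ (x (rightIndex k)).im) :
    Set.range (Path.segment (baseTuple n) x) ⊆ halfTwistRegion k := by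
  rw [Path.range_segment]
  exact ((convex_setOf_isSorted.inter (convex_setOf_im_le _ _)).segment_subset
    ⟨isSorted_baseTuple, by simp [baseTuple]⟩ ⟨hx, him⟩).trans
    fun _ h => h.1.mem_halfTwistRegion h.2

theorem range_segment_baseTuple_comp_adjSwap_subset {k : Fin (n - 1)} {x : Fin n → ℂ}
    (hx : IsSorted x) (him : (x (rightIndex k)).im ≤ (x (leftIndex k)).im) :
    Set.range ((Path.segment (baseTuple n) x).map (f := (· ∘ adjSwap k)) (by fun_prop)) ⊆
      halfTwistRegion k := by
  rw [Path.map_coe, Set.range_comp, Path.range_segment, Set.image_subset_iff]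
  exact ((convex_setOf_isSorted.inter (convex_setOf_im_le _ _)).segment_subset
    ⟨isSorted_baseTuple, by simp [baseTuple]⟩ ⟨hx, him⟩).trans
    fun _ h => h.1.comp_adjSwap_mem_halfTwistRegion h.2

theorem hasWord_singleton {k : Fin (n - 1)} {x y : Fin n → ℂ} (hx : IsSorted x) (hy : IsSorted y)
    {δ : Path x (y ∘ adjSwap k)} (hδ : Set.range δ ⊆ halfTwistRegion k) {p q : Conf n}
    {γ : Path p q} (h : IsLift γ δ) : HasWord [k] γ := by
  obtain ⟨c, hc⟩ := exists_isLift_segment convex_setOf_isSorted (fun _ => IsSorted.injective)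
    isSorted_baseTuple hx (p := basePoint n) rfl h.source
  obtain ⟨d, hd⟩ := exists_isLift_segment convex_setOf_isSorted (fun _ => IsSorted.injective)
    isSorted_baseTuple hy (p := basePoint n) rfl (h.target.trans (ofTuple_comp_perm _ _))
  have hgen : IsLift (generatorLoop n k) (halfTwistPath k) := fun _ => rfl
  have hximle : (x (leftIndex k)).im ≤ (x (rightIndex k)).im := (hδ ⟨0, δ.source⟩).2.2
  have hyimle : (y (rightIndex k)).im ≤ (y (leftIndex k)).im := by
    simpa only [Function.comp_apply, adjSwap_leftIndex, adjSwap_rightIndex] using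
      (hδ ⟨1, δ.target⟩).2.2
  refine ⟨c, d, ⟨_, _, segment_subset_setOf_isSorted isSorted_baseTuple hx, hc⟩,
    ⟨_, _, segment_subset_setOf_isSorted isSorted_baseTuple hy, hd⟩, ?_⟩
  rw [List.map_singleton, List.prod_singleton, sigma]
  refine braidOfLoop_eq_of_homotopic ((hc.trans (h.trans (hd.comp_perm (adjSwap k)).symm)).homotopic
    (K := halfTwistRegion k) (fun _ => injective_of_mem_halfTwistRegion) ?_
    (range_halfTwistPath_subset k) hgen)
  rw [Path.trans_range, Path.trans_range, Path.symm_range]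
  exact Set.union_subset (range_segment_baseTuple_subset hx hximle)
    (Set.union_subset hδ (range_segment_baseTuple_comp_adjSwap_subset hy hyimle))

end Lifts

/-! ### Simultaneous positive crossings -/

section Crossings

variable {n : ℕ}

/-- The tuples which the positive crossings between the pairs of points in decreasing order in `v`
lead through: the pairs of points that are in increasing order in `v` are in increasing order, and
in the other pairs the second point is above the first. -/
def crossingCone (v : Fin n → ℂ) : Set (Fin n → ℂ) :=
  {x | ∀ i j, i < j → ((v i).re < (v j).re → (x i).re < (x j).re) ∧
    (¬ (v i).re < (v j).re → (x i).im < (x j).im)}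

theorem convex_crossingCone (v : Fin n → ℂ) : Convex ℝ (crossingCone v) := by
  intro x hx y hy a b ha hb hab i j hij
  exact ⟨fun h => convex_setOf_re_lt i j ((hx i j hij).1 h) ((hy i j hij).1 h) ha hb hab,
    fun h => convex_setOf_im_lt i j ((hx i j hij).2 h) ((hy i j hij).2 h) ha hb hab⟩

theorem injective_of_mem_crossingCone {v x : Fin n → ℂ} (hx : x ∈ crossingCone v) :
    Function.Injective x := by
  refine .of_lt_imp_ne fun i j hij heq => ?_
  by_cases h : (v i).re < (v j).re
  · exact ((hx i j hij).1 h).ne (congrArg Complex.re heq)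
  · exact ((hx i j hij).2 h).ne (congrArg Complex.im heq)

theorem comp_adjSwap_mem_crossingCone {x v : Fin n → ℂ} (hx : x ∈ crossingCone v)
    {k : Fin (n - 1)} (hk : (v (rightIndex k)).re < (v (leftIndex k)).re)
    (hxk : (x (rightIndex k)).re < (x (leftIndex k)).re) :
    x ∘ adjSwap k ∈ crossingCone (v ∘ adjSwap k) := by
  intro i j hij
  by_cases h : i = leftIndex k ∧ j = rightIndex k
  · obtain ⟨rfl, rfl⟩ := h
    simp only [Function.comp_apply, adjSwap_leftIndex, adjSwap_rightIndex]
    exact ⟨fun _ => hxk, fun h => absurd hk h⟩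
  · exact hx _ _ (adjSwap_lt k hij h)

/-- Exchange the imaginary parts of the two points that the generator `k` exchanges. The tuple
`swapIm k u ∘ adjSwap k` is obtained from `u` by crossing these two points horizontally. -/
def swapIm (k : Fin (n - 1)) (u : Fin n → ℂ) : Fin n → ℂ :=
  fun i => ⟨(u i).re, (u (adjSwap k i)).im⟩

theorem swapIm_comp_adjSwap_apply (k : Fin (n - 1)) (u : Fin n → ℂ) (i : Fin n) :
    (swapIm k u ∘ adjSwap k) i = ⟨(u (adjSwap k i)).re, (u i).im⟩ := by
  simp only [Function.comp_apply, swapIm, adjSwap_adjSwap]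

theorem IsSorted.swapIm {u : Fin n → ℂ} (hu : IsSorted u) (k : Fin (n - 1)) :
    IsSorted (swapIm k u) := hu

theorem swapIm_comp_adjSwap_mem_crossingCone {u v : Fin n → ℂ} (hu : IsSorted u)
    (huv : u ∈ crossingCone v) {k : Fin (n - 1)}
    (hk : (v (rightIndex k)).re < (v (leftIndex k)).re) :
    swapIm k u ∘ adjSwap k ∈ crossingCone v := by
  intro i j hij
  rw [swapIm_comp_adjSwap_apply, swapIm_comp_adjSwap_apply]
  refine ⟨fun h => hu (adjSwap_lt k hij ?_), (huv i j hij).2⟩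
  rintro ⟨rfl, rfl⟩
  exact hk.not_gt h

theorem swapIm_mem_crossingCone_comp_adjSwap {u v : Fin n → ℂ} (hu : IsSorted u)
    {k : Fin (n - 1)} (hmid : swapIm k u ∘ adjSwap k ∈ crossingCone v)
    (hk : (v (rightIndex k)).re < (v (leftIndex k)).re) :
    swapIm k u ∈ crossingCone (v ∘ adjSwap k) := by
  have := comp_adjSwap_mem_crossingCone hmid hk
    (by simpa only [swapIm_comp_adjSwap_apply, adjSwap_leftIndex, adjSwap_rightIndex] using
      hu (leftIndex_lt_rightIndex k))
  simpa only [Function.comp_def, adjSwap_adjSwap] using this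

theorem isLift_segment_comp_adjSwap {k : Fin (n - 1)} {u v : Fin n → ℂ} {p q : Conf n}
    {γ : Path p q} (h : IsLift γ (Path.segment (u ∘ adjSwap k) v)) :
    IsLift γ (Path.segment u (v ∘ adjSwap k)) := by
  intro t
  rw [h t, ← ofTuple_comp_perm _ (adjSwap k)]
  congr 1
  funext i
  simp [AffineMap.lineMap_apply, adjSwap_adjSwap]

theorem IsLift.trans_segment_homotopic {K : Set (Fin n → ℂ)} (hK : Convex ℝ K)
    (hinj : ∀ v ∈ K, Function.Injective v) {u x v : Fin n → ℂ} (hu : u ∈ K) (hx : x ∈ K)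
    (hv : v ∈ K) {p q r : Conf n} {γ₁ : Path p q} {γ₂ : Path q r} {γ : Path p r}
    (h₁ : IsLift γ₁ (Path.segment u x)) (h₂ : IsLift γ₂ (Path.segment x v))
    (h : IsLift γ (Path.segment u v)) : (γ₁.trans γ₂).Homotopic γ := by
  have := hK.contractibleSpace ⟨u, hu⟩
  refine (h₁.trans h₂).homotopic (K := K) hinj ?_ ?_ h
  · rw [Path.trans_range, Path.range_segment, Path.range_segment]
    exact Set.union_subset (hK.segment_subset hu hx) (hK.segment_subset hx hv)
  · rw [Path.range_segment]
    exact hK.segment_subset hu hv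

theorem hasWord_singleton_of_isLift_segment {k : Fin (n - 1)} {u : Fin n → ℂ} (hu : IsSorted u)
    (him : (u (leftIndex k)).im < (u (rightIndex k)).im) {p q : Conf n} {γ : Path p q}
    (h : IsLift γ (Path.segment u (swapIm k u ∘ adjSwap k))) : HasWord [k] γ := by
  refine hasWord_singleton hu (hu.swapIm k) ?_ h
  rw [Path.range_segment]
  refine (starConvex_halfTwistRegion (hu.mem_halfTwistRegion him.le) him).segment_subset
    ((hu.swapIm k).comp_adjSwap_mem_halfTwistRegion ?_)
  simpa only [swapIm, adjSwap_leftIndex, adjSwap_rightIndex] using him.le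

/-- The pairs of indices whose points are in decreasing order. -/
def inversions (v : Fin n → ℂ) : Finset (Fin n × Fin n) :=
  open Classical in {p | p.1 < p.2 ∧ (v p.2).re < (v p.1).re}

theorem mem_inversions {v : Fin n → ℂ} {p : Fin n × Fin n} :
    p ∈ inversions v ↔ p.1 < p.2 ∧ (v p.2).re < (v p.1).re := by
  simp [inversions]

theorem card_inversions_comp_adjSwap_lt {v : Fin n → ℂ} {k : Fin (n - 1)}
    (hk : (v (rightIndex k)).re < (v (leftIndex k)).re) :
    (inversions (v ∘ adjSwap k)).card < (inversions v).card := by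
  let e : Fin n × Fin n ≃ Fin n × Fin n := (adjSwap k).prodCongr (adjSwap k)
  have hpair : (leftIndex k, rightIndex k) ∈ inversions v :=
    mem_inversions.2 ⟨leftIndex_lt_rightIndex k, hk⟩
  have hsub : (inversions (v ∘ adjSwap k)).map e.toEmbedding ⊆
      (inversions v).erase (leftIndex k, rightIndex k) := by
    intro p hp
    obtain ⟨⟨i, j⟩, hij, rfl⟩ := Finset.mem_map.1 hp
    obtain ⟨hlt : i < j, hre : (v (adjSwap k j)).re < (v (adjSwap k i)).re⟩ := mem_inversions.1 hij
    have hne : ¬ (i = leftIndex k ∧ j = rightIndex k) := by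
      rintro ⟨rfl, rfl⟩
      rw [adjSwap_leftIndex, adjSwap_rightIndex] at hre
      exact lt_asymm hk hre
    have hlt' : adjSwap k i < adjSwap k j := adjSwap_lt k hlt hne
    refine Finset.mem_erase.2 ⟨fun heq => ?_, mem_inversions.2 ⟨hlt', hre⟩⟩
    obtain ⟨hi : adjSwap k i = leftIndex k, hj : adjSwap k j = rightIndex k⟩ := Prod.mk.inj heq
    rw [← adjSwap_adjSwap k i, ← adjSwap_adjSwap k j, hi, hj, adjSwap_leftIndex,
      adjSwap_rightIndex] at hlt
    exact lt_asymm hlt (leftIndex_lt_rightIndex k)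
  calc (inversions (v ∘ adjSwap k)).card
      = ((inversions (v ∘ adjSwap k)).map e.toEmbedding).card := (Finset.card_map _).symm
    _ ≤ ((inversions v).erase (leftIndex k, rightIndex k)).card := Finset.card_le_card hsub
    _ < (inversions v).card := Finset.card_erase_lt_of_mem hpair

theorem isSorted_iff_adjacent {v : Fin n → ℂ} :
    IsSorted v ↔ ∀ k : Fin (n - 1), (v (leftIndex k)).re < (v (rightIndex k)).re := by
  refine ⟨fun h k => h (leftIndex_lt_rightIndex k), fun h => ?_⟩
  cases n with
  | zero => exact fun i => i.elim0
  | succ n => exact Fin.strictMono_iff_lt_succ.2 fun i => h i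

theorem exists_hasWord_of_mem_crossingCone {u v : Fin n → ℂ} (hu : IsSorted u)
    (hv : Function.Injective fun i => (v i).re) (huv : u ∈ crossingCone v)
    (hvv : v ∈ crossingCone v) {p q : Conf n} {γ : Path p q} (h : IsLift γ (Path.segment u v)) :
    ∃ l, HasWord l γ ∧
      ∀ m ∉ l, ∀ i j : Fin n, (i : ℕ) ≤ m → (m : ℕ) < j → (v i).re < (v j).re := by
  induction hN : (inversions v).card using Nat.strong_induction_on generalizing u v p q with
  | _ N ih =>
  by_cases hs : IsSorted v
  · exact ⟨[], hasWord_nil (segment_subset_setOf_isSorted hu hs) h,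
      fun m _ i j hi hj => hs (Fin.lt_def.2 (hi.trans_lt hj))⟩
  obtain ⟨k, hk⟩ := not_forall.1 (mt isSorted_iff_adjacent.2 hs)
  replace hk : (v (rightIndex k)).re < (v (leftIndex k)).re :=
    (not_lt.1 hk).lt_of_ne (hv.ne (leftIndex_lt_rightIndex k).ne')
  have hmid := swapIm_comp_adjSwap_mem_crossingCone hu huv hk
  let r : Conf n := ⟨ofTuple (swapIm k u ∘ adjSwap k),
    ofTuple_notMem_discriminantLocus (injective_of_mem_crossingCone hmid)⟩
  obtain ⟨γ₁, h₁⟩ := exists_isLift_segment (convex_crossingCone v)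
    (fun _ => injective_of_mem_crossingCone) huv hmid (q := r) h.source rfl
  obtain ⟨γ₂, h₂⟩ := exists_isLift_segment (convex_crossingCone v)
    (fun _ => injective_of_mem_crossingCone) hmid hvv (p := r) rfl h.target
  have hγ : (γ₁.trans γ₂).Homotopic γ := IsLift.trans_segment_homotopic (convex_crossingCone v)
    (fun _ => injective_of_mem_crossingCone) huv hmid hvv h₁ h₂ h
  have hw₁ : HasWord [k] γ₁ := hasWord_singleton_of_isLift_segment hu
    ((huv _ _ (leftIndex_lt_rightIndex k)).2 hk.not_gt) h₁
  obtain ⟨l, hl, hl'⟩ := ih _ (hN ▸ card_inversions_comp_adjSwap_lt hk) (hu.swapIm k)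
    (hv.comp (adjSwap k).injective) (swapIm_mem_crossingCone_comp_adjSwap hu hmid hk)
    (comp_adjSwap_mem_crossingCone hvv hk hk) (isLift_segment_comp_adjSwap h₂) rfl
  refine ⟨l ++ [k], (hw₁.trans hl).congr hγ, fun m hm i j hi hj => ?_⟩
  simp only [List.mem_append, List.mem_singleton, not_or] at hm
  have := hl' m hm.1 (adjSwap k i) (adjSwap k j) ((adjSwap_le_iff hm.2 i).2 hi)
    (not_le.1 fun h' => hj.not_ge ((adjSwap_le_iff hm.2 j).1 h'))
  simpa only [Function.comp_apply, adjSwap_adjSwap] using this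

end Crossings

/-! ### Strands that turn counterclockwise about each other -/

section TurningStrands

/-- A turning angle of `d`: a continuous, increasing argument which is unbounded above. -/
structure IsTurningAngle (φ : ℝ → ℝ) (d : ℝ → ℂ) : Prop where
  continuous : Continuous φ
  strictMono : StrictMono φ
  unbounded : ∀ B, ∃ θ, B < φ θ
  ne_zero : ∀ θ, d θ ≠ 0
  eq : ∀ θ, d θ = ‖d θ‖ * Complex.exp (φ θ * Complex.I)

namespace IsTurningAngle

variable {φ : ℝ → ℝ} {d : ℝ → ℂ}

theorem re_eq (h : IsTurningAngle φ d) (θ : ℝ) : (d θ).re = ‖d θ‖ * Real.cos (φ θ) := by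
  conv_lhs => rw [h.eq θ, Complex.re_ofReal_mul, Complex.exp_ofReal_mul_I_re]

theorem im_eq (h : IsTurningAngle φ d) (θ : ℝ) : (d θ).im = ‖d θ‖ * Real.sin (φ θ) := by
  conv_lhs => rw [h.eq θ, Complex.im_ofReal_mul, Complex.exp_ofReal_mul_I_im]

theorem re_pos_iff (h : IsTurningAngle φ d) (θ : ℝ) : 0 < (d θ).re ↔ 0 < Real.cos (φ θ) := by
  rw [h.re_eq, mul_pos_iff_of_pos_left (norm_pos_iff.2 (h.ne_zero θ))]

theorem im_pos_iff (h : IsTurningAngle φ d) (θ : ℝ) : 0 < (d θ).im ↔ 0 < Real.sin (φ θ) := by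
  rw [h.im_eq, mul_pos_iff_of_pos_left (norm_pos_iff.2 (h.ne_zero θ))]

theorem countable_setOf_re_eq_zero (h : IsTurningAngle φ d) : {θ | (d θ).re = 0}.Countable := by
  have hcos : {x : ℝ | Real.cos x = 0}.Countable :=
    (Set.countable_range fun k : ℤ => (2 * k + 1) * Real.pi / 2).mono fun x hx =>
      (Real.cos_eq_zero_iff.1 hx).imp fun _ hk => hk.symm
  refine (hcos.preimage h.strictMono.injective).mono fun θ hθ => ?_
  have hθ : ‖d θ‖ * Real.cos (φ θ) = 0 := (h.re_eq θ).symm.trans hθ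
  exact (mul_eq_zero.1 hθ).resolve_left (norm_ne_zero_iff.2 (h.ne_zero θ))

theorem exists_re_pos (h : IsTurningAngle φ d) : ∃ θ, 0 < (d θ).re := by
  obtain ⟨K, hK⟩ := exists_nat_gt (φ 0 / (2 * Real.pi))
  obtain ⟨b, hb⟩ := h.unbounded (K * (2 * Real.pi))
  obtain ⟨θ, hθ⟩ := mem_range_of_exists_le_of_exists_ge h.continuous
    ⟨0, ((div_lt_iff₀ Real.two_pi_pos).1 hK).le⟩ ⟨b, hb.le⟩
  exact ⟨θ, (h.re_pos_iff θ).2 (by rw [hθ, Real.cos_nat_mul_two_pi]; exact one_pos)⟩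

end IsTurningAngle

theorem cos_mul_sin_add (x u v : ℝ) : Real.cos (x + u) * Real.sin (u + v) =
    Real.sin v * Real.cos x + Real.sin u * Real.cos (x + u + v) := by
  simp only [Real.cos_add, Real.sin_add]
  linear_combination (Real.cos x * Real.sin v) * Real.sin_sq_add_cos_sq u

theorem sin_mul_sin_add (x u v : ℝ) : Real.sin (x + u) * Real.sin (u + v) =
    Real.cos v * Real.cos x - Real.cos u * Real.cos (x + u + v) := by
  simp only [Real.cos_add, Real.sin_add]
  linear_combination (Real.cos x * Real.cos v) * Real.sin_sq_add_cos_sq u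

theorem cos_pos_of_mem_Icc {x y z : ℝ} (hy : y ∈ Set.Icc x z) (hxz : z - x < Real.pi / 2)
    (hx : 0 < Real.cos x) (hz : 0 < Real.cos z) : 0 < Real.cos y := by
  rcases hy.1.eq_or_lt with rfl | hxy
  · exact hx
  have hpi := Real.pi_pos
  have hsin : 0 < Real.sin (y - x + (z - y)) :=
    Real.sin_pos_of_pos_of_lt_pi (by linarith [hy.2]) (by linarith)
  have hu : 0 < Real.sin (y - x) :=
    Real.sin_pos_of_pos_of_lt_pi (by linarith) (by linarith [hy.2])
  have hv : 0 ≤ Real.sin (z - y) :=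
    Real.sin_nonneg_of_nonneg_of_le_pi (by linarith [hy.2]) (by linarith)
  refine pos_of_mul_pos_left ?_ hsin.le
  have key := cos_mul_sin_add x (y - x) (z - y)
  rw [show x + (y - x) = y by ring, show y + (z - y) = z by ring] at key
  rw [key]
  positivity

theorem sin_pos_of_mem_Icc {x y z : ℝ} (hy : y ∈ Set.Icc x z) (hxz : z - x < Real.pi / 2)
    (hx : 0 < Real.cos x) (hz : Real.cos z ≤ 0) : 0 < Real.sin y := by
  have hpi := Real.pi_pos
  have hsin : 0 ≤ Real.sin (y - x + (z - y)) :=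
    Real.sin_nonneg_of_nonneg_of_le_pi (by linarith [hy.1, hy.2]) (by linarith)
  have hu : 0 < Real.cos (y - x) :=
    Real.cos_pos_of_mem_Ioo ⟨by linarith [hy.1], by linarith [hy.2]⟩
  have hv : 0 < Real.cos (z - y) :=
    Real.cos_pos_of_mem_Ioo ⟨by linarith [hy.2], by linarith [hy.1]⟩
  refine pos_of_mul_pos_left ?_ hsin
  have key := sin_mul_sin_add x (y - x) (z - y)
  rw [show x + (y - x) = y by ring, show y + (z - y) = z by ring] at key
  rw [key]
  linarith [mul_pos hv hx, mul_nonpos_of_nonneg_of_nonpos hu.le hz]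

/-- Strands whose differences turn counterclockwise infinitely often. -/
structure IsTurning {ι : Type*} (w : ι → ℝ → ℂ) : Prop where
  continuous : ∀ i, Continuous (w i)
  turning : ∀ i j, i ≠ j → ∃ φ, IsTurningAngle φ fun θ => w i θ - w j θ

theorem IsTurning.injective {ι : Type*} {w : ι → ℝ → ℂ} (hw : IsTurning w) (θ : ℝ) :
    Function.Injective fun i => w i θ := by
  intro i j hij
  by_contra hne
  obtain ⟨φ, hφ⟩ := hw.turning i j hne
  exact hφ.ne_zero θ (sub_eq_zero.2 hij)

/-- At a regular time the strands have distinct real parts, so that no crossing occurs in the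
braid diagram. -/
def IsRegularTime {ι : Type*} (w : ι → ℝ → ℂ) (θ : ℝ) : Prop :=
  Function.Injective fun i => (w i θ).re

theorem IsTurning.dense_setOf_isRegularTime {ι : Type*} [Countable ι] {w : ι → ℝ → ℂ}
    (hw : IsTurning w) : Dense {θ | IsRegularTime w θ} := by
  have hcount : (⋃ (i) (j) (_ : i ≠ j), {θ | (w i θ - w j θ).re = 0}).Countable := by
    refine Set.countable_iUnion fun i => Set.countable_iUnion fun j =>
      Set.countable_iUnion fun h => ?_
    obtain ⟨φ, hφ⟩ := hw.turning i j h
    exact hφ.countable_setOf_re_eq_zero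
  refine (hcount.dense_compl ℝ).mono fun θ hθ i j hij => ?_
  simp only [Set.mem_compl_iff, Set.mem_iUnion, not_exists] at hθ
  by_contra hne
  exact hθ i j hne (sub_eq_zero.2 hij)

theorem IsRegularTime.add_period {ι : Type*} {w : ι → ℝ → ℂ} {π : Equiv.Perm ι} {T a : ℝ}
    (hper : ∀ i θ, w i (θ + T) = w (π i) θ) (ha : IsRegularTime w a) :
    IsRegularTime w (a + T) := by
  simpa only [IsRegularTime, hper, Function.comp_def] using
    Function.Injective.comp ha π.injective

/-- The elements of `A` come first in the order given by `f`. -/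
def IsInitialSegment {ι α : Type*} [LE α] (f : ι → α) (A : Finset ι) : Prop :=
  ∀ i ∈ A, ∀ j ∉ A, f i ≤ f j

theorem IsInitialSegment.eq_of_card_eq {ι α : Type*} [PartialOrder α] {f : ι → α}
    (hf : Function.Injective f) {A B : Finset ι} (hA : IsInitialSegment f A)
    (hB : IsInitialSegment f B) (hcard : A.card = B.card) : A = B := by
  by_contra hne
  obtain ⟨i, hiA, hiB⟩ := Finset.not_subset.1
    fun h => hne (Finset.eq_of_subset_of_card_le h hcard.ge)
  obtain ⟨j, hjB, hjA⟩ := Finset.not_subset.1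
    fun h => hne (Finset.eq_of_subset_of_card_le h hcard.le).symm
  have hij : i = j := hf (le_antisymm (hA i hiA j hjA) (hB j hjB i hiB))
  exact hiB (hij ▸ hjB)

theorem isInitialSegment_comp_equiv {ι α : Type*} [LE α] {f : ι → α} (e : Equiv.Perm ι)
    {A : Finset ι} : IsInitialSegment (f ∘ e) A ↔ IsInitialSegment f (A.map e.toEmbedding) := by
  simp only [IsInitialSegment, Finset.mem_map_equiv, Function.comp_apply]
  exact ⟨fun h i hi j hj => by simpa using h _ hi _ hj,
    fun h i hi j hj => h _ (by simpa using hi) _ (by simpa using hj)⟩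

/-! ### Words of turning strands -/

theorem rel_of_locally_of_trans {D : Set ℝ} (hD : Dense D) {R : ℝ → ℝ → Prop}
    (hloc : ∀ x, ∃ U ∈ nhds x, ∀ a ∈ U ∩ D, ∀ b ∈ U ∩ D, a ≤ b → R a b)
    (htrans : ∀ a b c, a ≤ b → b ≤ c → b ∈ D → R a b → R b c → R a c) {a b : ℝ} (ha : a ∈ D)
    (hb : b ∈ D) (hab : a ≤ b) : R a b := by
  let S : Set ℝ := {x | ∀ y ∈ D, a ≤ y → y < x → R a y}
  have hS : IsClosed S := isClosed_of_closure_subset fun x hx y hy hay hyx =>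
    let ⟨_, hyz, hz⟩ := mem_closure_iff.1 hx _ isOpen_Ioi hyx
    hz y hy hay hyz
  have hextend : ∀ x ∈ S, a ≤ x → ∃ U ∈ nhds x, ∀ y ∈ U ∩ D, x ≤ y → R a y := by
    intro x hx hax
    obtain ⟨U, hU, hR⟩ := hloc x
    refine ⟨U, hU, fun y hy hxy => ?_⟩
    rcases hax.eq_or_lt with rfl | hax
    · exact hR _ ⟨mem_of_mem_nhds hU, ha⟩ y hy hxy
    obtain ⟨l, hl, hlU⟩ := exists_Ioc_subset_of_mem_nhds hU ⟨a, hax⟩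
    obtain ⟨c, hcD, hc⟩ := hD.exists_between (max_lt hax hl)
    have hac : a ≤ c := (le_max_left _ _).trans hc.1.le
    have hcU : c ∈ U := hlU ⟨(le_max_right _ _).trans_lt hc.1, hc.2.le⟩
    have hcy : c ≤ y := hc.2.le.trans hxy
    exact htrans a c y hac hcy hcD (hx c hcD hac hc.2) (hR c ⟨hcU, hcD⟩ y hy hcy)
  have hsub : Set.Icc a b ⊆ S := by
    refine (hS.inter isClosed_Icc).Icc_subset_of_forall_exists_gt
      (fun y _ hay hya => absurd hay hya.not_ge) fun x hx z hxz => ?_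
    obtain ⟨U, hU, hR⟩ := hextend x hx.1 hx.2.1
    obtain ⟨u, hu, huU⟩ := exists_Ico_subset_of_mem_nhds hU ⟨z, hxz⟩
    refine ⟨min u z, fun y hy hay hyu => ?_, lt_min hu hxz, min_le_right _ _⟩
    rcases lt_or_ge y x with hyx | hxy
    · exact hx.1 y hy hay hyx
    · exact hR y ⟨huU ⟨hxy, hyu.trans_le (min_le_left _ _)⟩, hy⟩ hxy
  obtain ⟨U, hU, hR⟩ := hextend b (hsub (Set.right_mem_Icc.2 hab)) hab
  exact hR b ⟨mem_of_mem_nhds hU, hb⟩ le_rfl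

variable {n : ℕ} {w : Fin n → ℝ → ℂ}

/-- The strands as a map into the configuration space. -/
def strandMap (hw : IsTurning w) : C(ℝ, Conf n) :=
  ⟨fun θ => ⟨ofTuple fun i => w i θ, ofTuple_notMem_discriminantLocus (hw.injective θ)⟩,
    (continuous_ofTuple.comp (continuous_pi hw.continuous)).subtype_mk _⟩

/-- The path of the strands between two times. -/
def strandPath (hw : IsTurning w) (a b : ℝ) : Path (strandMap hw a) (strandMap hw b) :=
  (Path.segment a b).map (strandMap hw).continuous

theorem isLift_strandPath_comp (hw : IsTurning w) (e : Equiv.Perm (Fin n)) (a b : ℝ) :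
    IsLift (strandPath hw a b) ((Path.segment a b).map (f := fun θ i => w (e i) θ)
      (continuous_pi fun i => hw.continuous (e i))) :=
  fun _ => (ofTuple_comp_perm (fun i => w i _) e).symm

/-- The word `l` represents the strands between the times `a` and `b`, and the letter `m` can be
missing only if the `m + 1` leftmost strands stay to the left of the others all the time. -/
def IsTimeWord (hw : IsTurning w) (a b : ℝ) (l : List (Fin (n - 1))) : Prop :=
  HasWord l (strandPath hw a b) ∧ ∀ m ∉ l, ∃ A : Finset (Fin n), A.card = m + 1 ∧
    ∀ θ ∈ Set.Icc a b, IsInitialSegment (fun i => (w i θ).re) A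

theorem IsTimeWord.trans {hw : IsTurning w} {a b c : ℝ} {l₁ l₂ : List (Fin (n - 1))}
    (hab : a ≤ b) (hbc : b ≤ c) (hb : IsRegularTime w b) (h₁ : IsTimeWord hw a b l₁)
    (h₂ : IsTimeWord hw b c l₂) : IsTimeWord hw a c (l₂ ++ l₁) := by
  refine ⟨(h₁.1.trans h₂.1).congr ?_, fun m hm => ?_⟩
  · rw [strandPath, strandPath, ← Path.map_trans]
    exact (SimplyConnectedSpace.paths_homotopic _ _).map (strandMap hw)
  · simp only [List.mem_append, not_or] at hm
    obtain ⟨A, hA, hA'⟩ := h₁.2 m hm.2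
    obtain ⟨B, hB, hB'⟩ := h₂.2 m hm.1
    obtain rfl : A = B := (hA' b (Set.right_mem_Icc.2 hab)).eq_of_card_eq hb
      (hB' b (Set.left_mem_Icc.2 hbc)) (hA.trans hB.symm)
    exact ⟨A, hA, fun θ hθ => (le_total θ b).elim (fun h => hA' θ ⟨hθ.1, h⟩)
      fun h => hB' θ ⟨h, hθ.2⟩⟩

theorem IsRegularTime.exists_perm_isSorted {a : ℝ} (ha : IsRegularTime w a) :
    ∃ e : Equiv.Perm (Fin n), IsSorted fun i => w (e i) a :=
  ⟨Tuple.sort fun i => (w i a).re, (Tuple.monotone_sort _).strictMono_of_injective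
    (ha.comp (Equiv.injective _))⟩

theorem IsTurningAngle.re_pos_and_im_pos {φ : ℝ → ℝ} {d : ℝ → ℂ} (h : IsTurningAngle φ d)
    {a b θ : ℝ} (hθ : θ ∈ Set.Icc a b) (hφ : φ b - φ a < Real.pi / 2) (ha : 0 < (d a).re) :
    (0 < (d b).re → 0 < (d θ).re) ∧ (¬ 0 < (d b).re → 0 < (d θ).im) := by
  have hmem : φ θ ∈ Set.Icc (φ a) (φ b) :=
    ⟨h.strictMono.monotone hθ.1, h.strictMono.monotone hθ.2⟩
  simp only [h.re_pos_iff, h.im_pos_iff, not_lt] at ha ⊢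
  exact ⟨cos_pos_of_mem_Icc hmem hφ ha, sin_pos_of_mem_Icc hmem hφ ha⟩

theorem mem_crossingCone_of_isTurningAngle {a b θ : ℝ} (hθ : θ ∈ Set.Icc a b)
    (hclose : ∀ i j, i ≠ j → ∃ φ, IsTurningAngle φ (fun θ => w i θ - w j θ) ∧
      φ b - φ a < Real.pi / 2) {e : Equiv.Perm (Fin n)} (he : IsSorted fun i => w (e i) a) :
    (fun i => w (e i) θ) ∈ crossingCone fun i => w (e i) b := by
  intro i j hij
  obtain ⟨φ, hφ, hlt⟩ := hclose (e j) (e i) (e.injective.ne hij.ne')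
  simpa only [Complex.sub_re, Complex.sub_im, sub_pos] using
    hφ.re_pos_and_im_pos hθ hlt (by simpa only [Complex.sub_re, sub_pos] using he hij)

theorem IsTurning.exists_isTimeWord_of_close (hw : IsTurning w) {a b : ℝ} (hab : a ≤ b)
    (ha : IsRegularTime w a) (hb : IsRegularTime w b)
    (hclose : ∀ i j, i ≠ j → ∃ φ, IsTurningAngle φ (fun θ => w i θ - w j θ) ∧
      φ b - φ a < Real.pi / 2) : ∃ l, IsTimeWord hw a b l := by
  obtain ⟨e, he⟩ := ha.exists_perm_isSorted
  have hcone {θ : ℝ} (hθ : θ ∈ Set.Icc a b) := mem_crossingCone_of_isTurningAngle hθ hclose he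
  have ha' := hcone (Set.left_mem_Icc.2 hab)
  have hb' := hcone (Set.right_mem_Icc.2 hab)
  have hlift := isLift_strandPath_comp hw e a b
  obtain ⟨γ, hγ⟩ := exists_isLift_segment (convex_crossingCone _)
    (fun _ => injective_of_mem_crossingCone) ha' hb' hlift.source hlift.target
  obtain ⟨l, hl, hmiss⟩ := exists_hasWord_of_mem_crossingCone he (hb.comp e.injective) ha' hb' hγ
  have : ContractibleSpace (crossingCone fun i => w (e i) b) :=
    (convex_crossingCone _).contractibleSpace ⟨_, hb'⟩
  refine ⟨l, hl.congr (hγ.homotopic (K := crossingCone fun i => w (e i) b)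
      (fun _ => injective_of_mem_crossingCone) ?_ ?_ hlift),
    fun m hm => ⟨(Finset.Iic (leftIndex m)).map e.toEmbedding, ?_, ?_⟩⟩
  · rw [Path.range_segment]
    exact (convex_crossingCone _).segment_subset ha' hb'
  · rintro _ ⟨t, rfl⟩
    refine hcone ?_
    rw [← segment_eq_Icc hab, ← Path.range_segment]
    exact Set.mem_range_self t
  · rw [Finset.card_map, Fin.card_Iic]
    rfl
  · refine fun θ hθ => isInitialSegment_comp_equiv e |>.1 fun i hi j hj => ?_
    rw [Finset.mem_Iic] at hi hj
    exact ((hcone hθ i j (hi.trans_lt (not_le.1 hj))).1 (hmiss m hm i j hi (not_le.1 hj))).le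

theorem IsTurning.exists_isTimeWord (hw : IsTurning w) {a b : ℝ} (hab : a ≤ b)
    (ha : IsRegularTime w a) (hb : IsRegularTime w b) : ∃ l, IsTimeWord hw a b l := by
  choose! φ hφ using hw.turning
  refine rel_of_locally_of_trans (D := {θ | IsRegularTime w θ})
    (R := fun a b => ∃ l, IsTimeWord hw a b l) hw.dense_setOf_isRegularTime (fun x => ?_)
    (fun a b c hab hbc hb ⟨l₁, h₁⟩ ⟨l₂, h₂⟩ => ⟨_, h₁.trans hab hbc hb h₂⟩) ha hb hab
  have hnear : ∀ᶠ θ in nhds x, ∀ i j, i ≠ j → dist (φ i j θ) (φ i j x) < Real.pi / 4 :=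
    Filter.eventually_all.2 fun i => Filter.eventually_all.2 fun j => by
      by_cases hij : i = j
      · exact .of_forall fun _ h => absurd hij h
      · exact ((hφ i j hij).continuous.continuousAt.eventually
          (Metric.ball_mem_nhds _ (by positivity))).mono fun _ h _ => h
  refine ⟨_, hnear, fun a ha b hb hab => hw.exists_isTimeWord_of_close hab ha.2 hb.2
    fun i j hij => ⟨φ i j, hφ i j hij, ?_⟩⟩
  have hda := abs_lt.1 (ha.1 i j hij)
  have hdb := abs_lt.1 (hb.1 i j hij)
  linarith [hda.1, hdb.2]

theorem IsTimeWord.mem_of_period {hw : IsTurning w} {π : Equiv.Perm (Fin n)} {T : ℝ} (hT : 0 < T)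
    (hper : ∀ i θ, w i (θ + T) = w (π i) θ) {a : ℝ} (ha : IsRegularTime w a)
    {l : List (Fin (n - 1))} (hl : IsTimeWord hw a (a + T) l) (m : Fin (n - 1)) : m ∈ l := by
  by_contra hm
  obtain ⟨A, hA, hinit⟩ := hl.2 m hm
  have hinit_add (θ : ℝ) : IsInitialSegment (fun i => (w i (θ + T)).re) A ↔
      IsInitialSegment (fun i => (w i θ).re) (A.map π.toEmbedding) := by
    rw [← isInitialSegment_comp_equiv]
    simp only [hper, Function.comp_def]
  have hπ : A.map π.toEmbedding = A :=
    ((hinit_add a).1 (hinit _ (Set.right_mem_Icc.2 (by linarith)))).eq_of_card_eq ha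
      (hinit _ (Set.left_mem_Icc.2 (by linarith))) (Finset.card_map _)
  have hperiodic : Function.Periodic (fun θ => IsInitialSegment (fun i => (w i θ).re) A) T :=
    fun θ => propext ((hinit_add θ).trans (by rw [hπ]))
  obtain ⟨i, hi⟩ : A.Nonempty := by rw [← Finset.card_pos]; omega
  obtain ⟨j, hj⟩ : ∃ j, j ∉ A := by
    by_contra! h
    rw [Finset.eq_univ_of_forall h, Finset.card_univ, Fintype.card_fin] at hA
    omega
  obtain ⟨φ, hφ⟩ := hw.turning i j (ne_of_mem_of_not_mem hi hj)
  obtain ⟨θ, hθ⟩ := hφ.exists_re_pos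
  obtain ⟨θ', hθ', hθθ'⟩ := hperiodic.exists_mem_Ico hT θ a
  have hle : (w i θ).re ≤ (w j θ).re := hθθ'.mpr (hinit θ' (Set.Ico_subset_Icc_self hθ')) i hi j hj
  rw [Complex.sub_re] at hθ
  linarith

/-! ### Strictly positive closed braids -/

theorem HasWord.isClosureOf {l : List (Fin (n - 1))} {q : Conf n} {γ : Path q q}
    (h : HasWord l γ) : IsClosureOf γ (l.map (sigma n)).prod := by
  obtain ⟨c, d, hc, hd, hw⟩ := h
  exact ⟨c, hw ▸ braidOfLoop_eq_of_homotopic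
    ((Path.Homotopic.refl c).hcomp ((Path.Homotopic.refl γ).hcomp (hc.homotopic hd).symm₂))⟩

theorem IsClosureOf.of_homotopic_conj {p q : Conf n} {γ : Path q q} {β : BraidGroup n}
    (h : IsClosureOf γ β) {l : Path p p} {η : Path q p}
    (hη : (η.trans (l.trans η.symm)).Homotopic γ) : IsClosureOf l β := by
  obtain ⟨c, hc⟩ := h
  refine ⟨c.trans η, ?_⟩
  have hη := Path.Homotopic.Quotient.eq.2 hη
  simp only [braidOfLoop, Path.trans_symm, Path.Homotopic.Quotient.mk_trans] at hη hc ⊢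
  rw [← hc, ← hη]
  simp only [Path.Homotopic.Quotient.trans_assoc]

theorem exists_conj_homotopic_of_periodic {S : Type*} [TopologicalSpace S] {P : C(ℝ, S)} {T : ℝ}
    (hP : Function.Periodic P T) (a : ℝ) {l : Path (P 0) (P 0)} (hl : ∀ t, l t = P (T * t)) :
    ∃ η : Path (P a) (P 0), (η.trans (l.trans η.symm)).Homotopic
      (((Path.segment a (a + T)).map P.continuous).cast rfl (hP a).symm) := by
  refine ⟨(Path.segment a 0).map P.continuous, homotopic_of_factorization P
    ((Path.segment a 0).trans ((Path.segment 0 T).trans (Path.segment T (a + T))))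
    (Path.segment a (a + T)) (fun t => ?_) fun t => rfl⟩
  simp only [Path.trans_apply, Path.symm_apply, Path.map_coe, Function.comp_apply, hl,
    Path.segment_apply, AffineMap.lineMap_apply_ring', unitInterval.coe_symm_eq]
  split_ifs
  · rfl
  · congr 1
    ring
  · rw [← hP]
    congr 1
    ring

theorem IsTurning.periodic_strandMap (hw : IsTurning w) {π : Equiv.Perm (Fin n)} {T : ℝ}
    (hper : ∀ i θ, w i (θ + T) = w (π i) θ) : Function.Periodic (strandMap hw) T := fun θ =>
  Subtype.ext ((congrArg ofTuple (funext fun i => hper i θ)).trans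
    (ofTuple_comp_perm (fun i => w i θ) π))

theorem IsTurning.exists_isStrictlyPositive (hw : IsTurning w) {π : Equiv.Perm (Fin n)} {T : ℝ}
    (hT : 0 < T) (hper : ∀ i θ, w i (θ + T) = w (π i) θ) {p : Conf n} {l : Path p p}
    (hl : ∀ t : unitInterval, (l t).1 = ofTuple fun i => w i (T * t)) :
    ∃ β : BraidGroup n, IsPositive β ∧ IsStrictlyPositive β ∧ IsClosureOf l β := by
  obtain rfl : strandMap hw 0 = p := by
    rw [← l.source]
    exact Subtype.ext (by simpa [strandMap] using (hl 0).symm)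
  obtain ⟨a, ha⟩ := hw.dense_setOf_isRegularTime.nonempty
  obtain ⟨L, hL⟩ := hw.exists_isTimeWord (by linarith) ha (ha.add_period hper)
  obtain ⟨η, hη⟩ := exists_conj_homotopic_of_periodic (hw.periodic_strandMap hper) a
    (l := l) fun t => Subtype.ext (hl t)
  exact ⟨(L.map (sigma n)).prod, ⟨L, rfl⟩, ⟨L, hL.mem_of_period hT hper ha, rfl⟩,
    (hL.1.cast rfl _).isClosureOf.of_homotopic_conj hη⟩

end TurningStrands

/-! ### Squarefree bivariate polynomials -/

theorem squarefree_map_fractionRing {R : Type*} [CommRing R] [IsDomain R]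
    [NormalizedGCDMonoid R] {f : R[X]} (hf : Squarefree f) :
    Squarefree (f.map (algebraMap R (FractionRing R))) := by
  intro x hx
  have hx₀ : x ≠ 0 := by
    rintro rfl
    have hinj := IsFractionRing.injective R (FractionRing R)
    exact (Polynomial.map_ne_zero_iff hinj).2 hf.ne_zero (by simpa using hx)
  set g := IsLocalization.integerNormalization (nonZeroDivisors R) x
  have hprim : g.primPart.map (algebraMap R (FractionRing R)) ∣ x := by
    obtain ⟨b, hb, hbx⟩ := IsLocalization.integerNormalization_spec (nonZeroDivisors R) x
    have hb₀ := IsFractionRing.to_map_ne_zero_of_mem_nonZeroDivisors (K := FractionRing R) hb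
    refine (isUnit_C.2 hb₀.isUnit).dvd_mul_left.1 ?_
    rw [← smul_eq_C_mul, algebraMap_smul, ← hbx]
    exact Polynomial.map_dvd _ g.primPart_dvd
  refine isUnit_or_eq_zero_of_isUnit_integerNormalization_primPart hx₀ (hf _ ?_)
  refine (g.isPrimitive_primPart.mul g.isPrimitive_primPart).dvd_of_fraction_map_dvd_fraction_map
    (K := FractionRing R) ?_
  rw [Polynomial.map_mul]
  exact (mul_dvd_mul hprim hprim).trans hx

theorem exists_mul_add_derivative_mul_eq_C {R : Type*} [CommRing R] [IsDomain R] [CharZero R]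
    [NormalizedGCDMonoid R] {f : R[X]} (hf : Squarefree f) :
    ∃ (A B : R[X]) (D : R), D ≠ 0 ∧ f * A + derivative f * B = C D := by
  rcases eq_or_ne f.natDegree 0 with hdeg | hdeg
  · obtain ⟨D, rfl⟩ := natDegree_eq_zero.1 hdeg
    exact ⟨1, 0, D, C_ne_zero.1 hf.ne_zero, by simp⟩
  obtain ⟨A, B, -, -, hAB⟩ :=
    exists_mul_add_mul_eq_C_resultant f (derivative f) le_rfl le_rfl (.inl hdeg)
  refine ⟨A, B, _, fun hres => ?_, hAB⟩
  have hinj := IsFractionRing.injective R (FractionRing R)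
  have : CharZero (FractionRing R) := charZero_of_injective_algebraMap hinj
  have hsep : (f.map (algebraMap R (FractionRing R))).Separable :=
    PerfectField.separable_iff_squarefree.2 (squarefree_map_fractionRing hf)
  refine resultant_ne_zero _ _ hsep ?_
  rw [derivative_map, natDegree_map_eq_of_injective hinj, natDegree_map_eq_of_injective hinj,
    resultant_map_map, hres, map_zero]

/-! ### Bivariate polynomials as functions -/

theorem contDiff_evalEval {𝕜 : Type*} [NontriviallyNormedField 𝕜] {k : WithTop ℕ∞} (f : 𝕜[X][Y]) :
    ContDiff 𝕜 k fun x : 𝕜 × 𝕜 => f.evalEval x.1 x.2 := by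
  induction f using Polynomial.induction_on' with
  | add p q hp hq => simpa [evalEval_add] using! hp.add hq
  | monomial m a =>
    have ha : ContDiff 𝕜 k fun z => a.eval z := by simpa using a.contDiff_aeval (𝕜 := 𝕜) k
    simpa [evalEval, eval_monomial] using! (ha.comp contDiff_fst).mul (contDiff_snd.pow m)

theorem continuous_evalEval {𝕜 : Type*} [NontriviallyNormedField 𝕜] (f : 𝕜[X][Y]) :
    Continuous fun x : 𝕜 × 𝕜 => f.evalEval x.1 x.2 :=
  (contDiff_evalEval (k := 0) f).continuous

theorem hasDerivAt_evalEval {𝕜 : Type*} [NontriviallyNormedField 𝕜] (f : 𝕜[X][Y]) (z w : 𝕜) :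
    HasDerivAt (fun w => f.evalEval z w) ((derivative f).evalEval z w) w := by
  simpa only [derivative_map, map_evalRingHom_eval] using (f.map (evalRingHom z)).hasDerivAt w

theorem exists_implicit_root {𝕜 : Type*} [RCLike 𝕜] (f : 𝕜[X][Y]) {z₀ w₀ : 𝕜}
    (hroot : f.evalEval z₀ w₀ = 0) (hsimple : (derivative f).evalEval z₀ w₀ ≠ 0) :
    ∃ s : 𝕜 → 𝕜, s z₀ = w₀ ∧ (∀ᶠ z in nhds z₀, DifferentiableAt 𝕜 s z) ∧
      ∀ᶠ z in nhds z₀, f.evalEval z (s z) = 0 := by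
  let g : 𝕜 × 𝕜 → 𝕜 := fun x => f.evalEval x.1 x.2
  have hg : ContDiffAt 𝕜 1 g (z₀, w₀) := (contDiff_evalEval f).contDiffAt
  have hpartial : fderiv 𝕜 g (z₀, w₀) ∘L .inr 𝕜 𝕜 𝕜 =
      ContinuousLinearMap.toSpanSingleton 𝕜 ((derivative f).evalEval z₀ w₀) :=
    (HasFDerivAt.comp (g := g) (f := fun w => (z₀, w)) w₀
      (hg.differentiableAt one_ne_zero).hasFDerivAt (hasFDerivAt_prodMk_right z₀ w₀)).unique
      (hasDerivAt_evalEval f z₀ w₀).hasFDerivAt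
  have hinv : (fderiv 𝕜 g (z₀, w₀) ∘L .inr 𝕜 𝕜 𝕜).IsInvertible := by
    refine ⟨ContinuousLinearEquiv.unitsEquivAut 𝕜 (Units.mk0 _ hsimple), ?_⟩
    rw [hpartial]
    ext
    simp
  refine ⟨hg.implicitFunction one_ne_zero hinv, hg.implicitFunction_apply_self one_ne_zero hinv,
    ?_, ?_⟩
  · filter_upwards [(hg.contDiffAt_implicitFunction one_ne_zero hinv).eventually (by simp)]
      with z hz using hz.differentiableAt one_ne_zero
  · filter_upwards [hg.eventually_apply_implicitFunction one_ne_zero hinv] with z hz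
    exact hz.trans hroot

theorem eventually_nhdsNE_eval_ne_zero {p : ℂ[X]} (hp : p ≠ 0) (a : ℂ) :
    ∀ᶠ z in nhdsWithin a {a}ᶜ, p.eval z ≠ 0 :=
  nhdsNE_le_cofinite a (finite_setOfPred_isRoot hp).compl_mem_cofinite

/-! ### The number of roots in a disk -/

theorem mem_localRoots {f : ℂ[X][Y]} {δ : ℝ} {z w : ℂ} :
    w ∈ localRoots f δ z ↔ f.map (evalRingHom z) ≠ 0 ∧ f.evalEval z w = 0 ∧ ‖w‖ < δ := by
  rw [localRoots, Multiset.mem_filter, mem_roots', IsRoot, map_evalRingHom_eval, and_assoc]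

theorem nodup_localRoots {f : ℂ[X][Y]} {δ : ℝ} {z : ℂ}
    (h : ∀ w, f.evalEval z w = 0 → (derivative f).evalEval z w ≠ 0) : (localRoots f δ z).Nodup := by
  classical
  refine Multiset.Nodup.filter _ ?_
  rcases eq_or_ne (f.map (evalRingHom z)) 0 with hf | hf
  · simp [hf]
  refine Multiset.nodup_iff_count_le_one.2 fun w => ?_
  rw [count_roots]
  by_contra! hw
  rw [one_lt_rootMultiplicity_iff_isRoot hf, IsRoot, IsRoot, derivative_map,
    map_evalRingHom_eval, map_evalRingHom_eval] at hw
  exact h w hw.1 hw.2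

theorem circleIntegral_sub_inv_of_lt_norm {δ : ℝ} (hδ : 0 ≤ δ) {r : ℂ} (hr : δ < ‖r‖) :
    (∮ w in C(0, δ), (w - r)⁻¹) = 0 := by
  have hne : ∀ w ∈ Metric.closedBall (0 : ℂ) δ, w - r ≠ 0 := fun w hw h => by
    rw [sub_eq_zero.1 h, mem_closedBall_zero_iff] at hw
    exact hr.not_ge hw
  refine (DifferentiableOn.diffContOnCl fun w hw => ?_).circleIntegral_eq_zero hδ
  exact ((differentiableAt_id.sub_const r).inv
    (hne w (Metric.closure_ball_subset_closedBall hw))).differentiableWithinAt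

theorem continuousOn_sum_sub_inv {δ : ℝ} {s : Multiset ℂ} (hs : ∀ r ∈ s, ‖r‖ ≠ δ) :
    ContinuousOn (fun w => (s.map fun r => (w - r)⁻¹).sum) (Metric.sphere 0 δ) := by
  refine continuousOn_multiset_sum _ fun r hr => ContinuousOn.inv₀ (by fun_prop) fun w hw h => ?_
  rw [sub_eq_zero.1 h, mem_sphere_zero_iff_norm] at hw
  exact hs r hr hw

theorem circleIntegral_sum_sub_inv {δ : ℝ} (hδ : 0 < δ) (s : Multiset ℂ)
    (hs : ∀ r ∈ s, ‖r‖ ≠ δ) :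
    (∮ w in C(0, δ), (s.map fun r => (w - r)⁻¹).sum) =
      2 * Real.pi * Complex.I * (s.filter fun r => ‖r‖ < δ).card := by
  induction s using Multiset.induction_on with
  | empty => simp [circleIntegral]
  | cons r s ih =>
    have hs' := fun r hr => hs r (Multiset.mem_cons_of_mem hr)
    have hr := hs r (Multiset.mem_cons_self r s)
    have hc : ContinuousOn (fun w => (w - r)⁻¹) (Metric.sphere 0 δ) := by
      simpa using continuousOn_sum_sub_inv (s := {r}) (by simpa using hr)
    simp only [Multiset.map_cons, Multiset.sum_cons]
    rw [circleIntegral.integral_add (hc.circleIntegrable hδ.le)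
      ((continuousOn_sum_sub_inv hs').circleIntegrable hδ.le), ih hs']
    rcases lt_or_gt_of_ne hr with h | h
    · rw [circleIntegral.integral_sub_inv_of_mem_ball (by simpa using h),
        Multiset.filter_cons_of_pos (p := fun r : ℂ => ‖r‖ < δ) _ h, Multiset.card_cons]
      push_cast
      ring
    · rw [circleIntegral_sub_inv_of_lt_norm hδ.le h,
        Multiset.filter_cons_of_neg (p := fun r : ℂ => ‖r‖ < δ) _ h.not_gt, zero_add]

theorem circleIntegral_derivative_div_evalEval (f : ℂ[X][Y]) {δ : ℝ} (hδ : 0 < δ) {z : ℂ}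
    (h : ∀ w, ‖w‖ = δ → f.evalEval z w ≠ 0) :
    (∮ w in C(0, δ), (derivative f).evalEval z w / f.evalEval z w) =
      2 * Real.pi * Complex.I * (localRoots f δ z).card := by
  have hroots : ∀ r ∈ (f.map (evalRingHom z)).roots, ‖r‖ ≠ δ := fun r hr hrδ =>
    h r hrδ (map_evalRingHom_eval z r f ▸ (mem_roots'.1 hr).2)
  rw [localRoots]
  convert! circleIntegral_sum_sub_inv hδ _ hroots using 1
  refine circleIntegral.integral_congr hδ.le fun w hw => ?_
  have hw := map_evalRingHom_eval z w f ▸ h w (by simpa using hw)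
  have hlog := (IsAlgClosed.splits (f.map (evalRingHom z))).eval_derivative_div_eval_of_ne_zero hw
  rw [derivative_map, map_evalRingHom_eval, map_evalRingHom_eval] at hlog
  simpa only [one_div] using! hlog

theorem eventually_evalEval_ne_zero_of_norm_eq (f : ℂ[X][Y]) {δ : ℝ} {z₀ : ℂ}
    (h : ∀ w, ‖w‖ = δ → f.evalEval z₀ w ≠ 0) :
    ∀ᶠ z in nhds z₀, ∀ w, ‖w‖ = δ → f.evalEval z w ≠ 0 := by
  simp only [← mem_sphere_zero_iff_norm] at h ⊢
  exact (isCompact_sphere 0 δ).eventually_forall_of_forall_eventually fun w hw =>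
    (continuous_evalEval f).continuousAt.eventually_ne (h w hw)

theorem tendsto_circleIntegral_derivative_div_evalEval (f : ℂ[X][Y]) {δ : ℝ} (hδ : 0 < δ) {z₀ : ℂ}
    (h : ∀ w, ‖w‖ = δ → f.evalEval z₀ w ≠ 0) :
    Filter.Tendsto (fun z => ∮ w in C(0, δ), (derivative f).evalEval z w / f.evalEval z w)
      (nhds z₀) (nhds (∮ w in C(0, δ), (derivative f).evalEval z₀ w / f.evalEval z₀ w)) := by
  have hcont : ∀ (g : ℂ[X][Y]) z, Continuous fun w => g.evalEval z w := fun g z =>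
    (continuous_evalEval g).comp (by fun_prop : Continuous fun w : ℂ => (z, w))
  refine TendstoUniformlyOn.tendsto_circleIntegral_of_continuousOn hδ.le ?_
    (Metric.tendstoUniformlyOn_iff.2 fun η hη => ?_)
  · filter_upwards [eventually_evalEval_ne_zero_of_norm_eq f h] with z hz
    exact (hcont _ z).continuousOn.div (hcont f z).continuousOn fun w hw => hz w (by simpa using hw)
  refine (isCompact_sphere 0 δ).eventually_forall_of_forall_eventually fun w hw => ?_
  have hw := h w (by simpa using hw)
  have hquot : ContinuousAt (fun x : ℂ × ℂ =>
      (derivative f).evalEval x.1 x.2 / f.evalEval x.1 x.2) (z₀, w) :=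
    (continuous_evalEval _).continuousAt.div (continuous_evalEval f).continuousAt hw
  have hquot₀ : ContinuousAt (fun x : ℂ × ℂ =>
      (derivative f).evalEval z₀ x.2 / f.evalEval z₀ x.2) (z₀, w) :=
    ContinuousAt.comp (f := fun x : ℂ × ℂ => (z₀, x.2)) (x := (z₀, w)) hquot (by fun_prop)
  have hdist := Filter.Tendsto.dist hquot₀ hquot
  simp only [dist_self] at hdist
  exact hdist.eventually_lt_const hη

theorem eventually_card_localRoots_eq (f : ℂ[X][Y]) {δ : ℝ} (hδ : 0 < δ) {z₀ : ℂ}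
    (h : ∀ w, ‖w‖ = δ → f.evalEval z₀ w ≠ 0) :
    ∀ᶠ z in nhds z₀, (localRoots f δ z).card = (localRoots f δ z₀).card := by
  have hlim : Filter.Tendsto (fun z => ((localRoots f δ z).card : ℂ)) (nhds z₀)
      (nhds ((localRoots f δ z₀).card : ℂ)) := by
    have hint := (tendsto_circleIntegral_derivative_div_evalEval f hδ h).const_mul
      (2 * Real.pi * Complex.I)⁻¹
    rw [circleIntegral_derivative_div_evalEval f hδ h,
      inv_mul_cancel_left₀ Complex.two_pi_I_ne_zero] at hint
    refine hint.congr' ?_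
    filter_upwards [eventually_evalEval_ne_zero_of_norm_eq f h] with z hz
    rw [circleIntegral_derivative_div_evalEval f hδ hz,
      inv_mul_cancel_left₀ Complex.two_pi_I_ne_zero]
  have hlim := hlim.norm
  simp only [Complex.norm_natCast] at hlim
  rw [← Function.comp_def, ← Nat.isClosedEmbedding_coe_real.isEmbedding.tendsto_nhds_iff,
    nhds_discrete ℕ, Filter.tendsto_pure] at hlim
  exact hlim

/-! ### Sections of multivalued functions -/

section Sections

variable {A S ι : Type*} [TopologicalSpace A] [TopologicalSpace S] {R : A → Set S} {U : Set A}
  {s : ι → A → S}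

/-- Over `U`, the multivalued function `R` is the disjoint union of the graphs of the continuous
functions `s j`. -/
structure IsSections (R : A → Set S) (U : Set A) (s : ι → A → S) : Prop where
  continuousOn : ∀ j, ContinuousOn (s j) U
  injective : ∀ a ∈ U, Function.Injective fun j => s j a
  range_eq : ∀ a ∈ U, R a = Set.range fun j => s j a

namespace IsSections

theorem mem_iff (hs : IsSections R U s) {a : A} (ha : a ∈ U) {y : S} :
    y ∈ R a ↔ ∃ j, s j a = y := by
  rw [hs.range_eq a ha, Set.mem_range]

theorem apply_mem (hs : IsSections R U s) {a : A} (ha : a ∈ U) (j : ι) : s j a ∈ R a :=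
  (hs.mem_iff ha).2 ⟨j, rfl⟩

theorem comp {B : Type*} [TopologicalSpace B] (hs : IsSections R U s) {g : B → A} {V : Set B}
    (hg : ContinuousOn g V) (hV : Set.MapsTo g V U) :
    IsSections (R ∘ g) V fun j => s j ∘ g where
  continuousOn j := (hs.continuousOn j).comp hg hV
  injective _ hb := hs.injective _ (hV hb)
  range_eq _ hb := hs.range_eq _ (hV hb)

theorem continuous_index [T2Space S] [Finite ι] [TopologicalSpace ι] [DiscreteTopology ι]
    (hs : IsSections R U s) {X : Type*} [TopologicalSpace X] {g : X → A} (hg : Continuous g)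
    (hgU : ∀ x, g x ∈ U) {u : X → S} (hu : Continuous u) {idx : X → ι}
    (hidx : ∀ x, s (idx x) (g x) = u x) : Continuous idx := by
  have hfiber : ∀ j, idx ⁻¹' {j} = {x | s j (g x) = u x} := fun j => Set.ext fun x =>
    ⟨fun h => h ▸ hidx x, fun h => hs.injective _ (hgU x) ((hidx x).trans h.symm)⟩
  refine continuous_iff_isClosed.2 fun t _ => ?_
  rw [← Set.biUnion_preimage_singleton]
  refine t.toFinite.isClosed_biUnion fun j _ => ?_
  rw [hfiber j]
  exact isClosed_eq ((hs.continuousOn j).comp_continuous hg hgU) hu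

theorem exists_eqOn [T2Space S] [Finite ι] (hs : IsSections R U s) {K : Set A}
    (hK : IsPreconnected K) (hne : K.Nonempty) (hKU : K ⊆ U) {u : A → S} (hu : ContinuousOn u K)
    (huR : ∀ a ∈ K, u a ∈ R a) : ∃ j, Set.EqOn u (s j) K := by
  let : TopologicalSpace ι := ⊥
  have : DiscreteTopology ι := ⟨rfl⟩
  have : PreconnectedSpace K := isPreconnected_iff_preconnectedSpace.1 hK
  obtain ⟨a₀⟩ := hne.to_subtype
  choose idx hidx using fun a : K => (hs.mem_iff (hKU a.2)).1 (huR a a.2)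
  have hcont := hs.continuous_index continuous_subtype_val (fun a => hKU a.2) hu.domRestrict hidx
  refine ⟨idx a₀, fun a ha => ?_⟩
  rw [← PreconnectedSpace.constant inferInstance hcont (x := ⟨a, ha⟩)]
  exact (hidx ⟨a, ha⟩).symm

theorem exists_eventuallyEq [LocallyConnectedSpace A] [T2Space S] [Finite ι]
    (hs : IsSections R U s) {a : A} (hU : U ∈ nhds a) {ι' : Type*} {V : Set A} {w : ι' → A → S}
    (hw : IsSections R V w) (hV : V ∈ nhds a) (i : ι') : ∃ j, w i =ᶠ[nhds a] s j := by
  have hsub := connectedComponentIn_subset (U ∩ V) a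
  have hmem := connectedComponentIn_mem_nhds (Filter.inter_mem hU hV)
  obtain ⟨j, hj⟩ := hs.exists_eqOn isPreconnected_connectedComponentIn
    ⟨a, mem_of_mem_nhds hmem⟩ (fun b hb => (hsub hb).1)
    ((hw.continuousOn i).mono fun b hb => (hsub hb).2) fun b hb => hw.apply_mem (hsub hb).2 i
  exact ⟨j, hj.eventuallyEq_of_mem hmem⟩

theorem exists_perm [T2Space S] [Finite ι] (hs : IsSections R U s) (hU : IsPreconnected U)
    (hne : U.Nonempty) {g : A → A} (hg : ContinuousOn g U) (hgU : Set.MapsTo g U U)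
    (hR : ∀ a ∈ U, R (g a) = R a) :
    ∃ π : Equiv.Perm ι, ∀ i, Set.EqOn (s i ∘ g) (s (π i)) U := by
  have hgs := hs.comp hg hgU
  choose ρ hρ using fun i => hs.exists_eqOn hU hne subset_rfl (hgs.continuousOn i)
    fun a ha => hR a ha ▸ hgs.apply_mem ha i
  obtain ⟨a, ha⟩ := hne
  have hinj : Function.Injective ρ := fun i j hij =>
    hgs.injective a ha ((hρ i ha).trans (hij ▸ (hρ j ha).symm))
  exact ⟨Equiv.ofBijective ρ (Finite.injective_iff_bijective.1 hinj), hρ⟩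

theorem isEvenlyCovered [T2Space S] [Finite ι] [TopologicalSpace ι] [DiscreteTopology ι]
    (hs : IsSections R U s) (hU : IsOpen U) {a : A} (ha : a ∈ U) :
    IsEvenlyCovered (fun x : {x : A × S // x.2 ∈ R x.1} => x.1.1) a ι := by
  let p : {x : A × S // x.2 ∈ R x.1} → A := fun x => x.1.1
  have hp : Continuous p := by fun_prop
  choose idx hidx using fun x : p ⁻¹' U => (hs.mem_iff x.2).1 x.1.2
  have hcont : Continuous idx :=
    hs.continuous_index (hp.comp continuous_subtype_val) (fun x => x.2) (by fun_prop) hidx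
  have hsection : Continuous fun y : U × ι => s y.2 y.1 :=
    continuous_prod_of_discrete_right.2 fun j => (hs.continuousOn j).domRestrict
  exact ⟨inferInstance, U, ha, hU, hU.preimage hp,
    { toFun := fun x => (⟨p x, x.2⟩, idx x)
      invFun := fun y => ⟨⟨(y.1.1, s y.2 y.1.1), hs.apply_mem y.1.2 y.2⟩, y.1.2⟩
      left_inv := fun x => Subtype.ext (Subtype.ext (Prod.ext rfl (hidx x)))
      right_inv := fun y => Prod.ext rfl (hs.injective _ y.1.2 (hidx _))
      continuous_toFun := by fun_prop
      continuous_invFun :=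
        ((by fun_prop : Continuous fun y : U × ι => y.1.1).prodMk hsection).subtype_mk _
          |>.subtype_mk _ }, fun _ => rfl⟩

end IsSections

theorem exists_isSections_univ [SimplyConnectedSpace A] [LocallyPathConnectedSpace A] [T2Space S]
    [Finite ι] (hloc : ∀ a, ∃ U ∈ nhds a, ∃ s : ι → A → S, IsSections R U s) :
    ∃ w : ι → A → S, IsSections R Set.univ w := by
  let : TopologicalSpace ι := ⊥
  have : DiscreteTopology ι := ⟨rfl⟩
  have hcov : IsCoveringMap fun x : {x : A × S // x.2 ∈ R x.1} => x.1.1 := by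
    intro a
    obtain ⟨V, hV, s, hs⟩ := hloc a
    obtain ⟨U, hUV, hU, ha⟩ := mem_nhds_iff.1 hV
    exact ((hs.comp continuousOn_id hUV).isEvenlyCovered hU ha).to_isEvenlyCovered_preimage
  have hlift (x : {x : A × S // x.2 ∈ R x.1}) :=
    (hcov.existsUnique_continuousMap_lifts (.id A) x.1.1 x rfl).exists
  have hunique {F G : C(A, {x : A × S // x.2 ∈ R x.1})} (hF : ∀ a, (F a).1.1 = a)
      (hG : ∀ a, (G a).1.1 = a) {a : A} (h : (F a).1.2 = (G a).1.2) : F = G :=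
    DFunLike.coe_injective <| hcov.eq_of_comp_eq F.continuous G.continuous
      (funext fun b => (hF b).trans (hG b).symm) a
      (Subtype.ext (Prod.ext ((hF a).trans (hG a).symm) h))
  obtain ⟨a₀⟩ : Nonempty A := inferInstance
  obtain ⟨U, hU, s, hs⟩ := hloc a₀
  have ha₀ := mem_of_mem_nhds hU
  choose F hF₀ hF using fun j => hlift ⟨(a₀, s j a₀), hs.apply_mem ha₀ j⟩
  have hF (j : ι) (a : A) : (F j a).1.1 = a := congrFun (hF j) a
  refine ⟨fun j a => (F j a).1.2, fun j => by fun_prop, fun a _ i j hij => ?_, fun a _ => ?_⟩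
  · have h := hunique (hF i) (hF j) hij
    refine hs.injective a₀ ha₀ ?_
    simpa [hF₀] using congrArg (fun G => (G a₀).1.2) h
  · refine Set.Subset.antisymm (fun y hy => ?_) ?_
    · obtain ⟨G, hGa, hG⟩ := hlift ⟨(a, y), hy⟩
      have hG (b : A) : (G b).1.1 = b := congrFun hG b
      have hGR : (G a₀).1.2 ∈ R a₀ := by simpa only [hG] using (G a₀).2
      obtain ⟨j, hj⟩ := (hs.mem_iff ha₀).1 hGR
      have hFG : F j = G := hunique (a := a₀) (hF j) hG (by rw [hF₀]; exact hj)
      exact ⟨j, by simp only [hFG, hGa]⟩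
    · rintro _ ⟨j, rfl⟩
      simpa only [hF] using (F j a).2

theorem exists_isSections [Zero S] [T2Space S] [Finite ι] {H : Set A} [SimplyConnectedSpace H]
    [LocallyPathConnectedSpace H]
    (hloc : ∀ a ∈ H, ∃ U ∈ nhds a, ∃ s : ι → A → S, IsSections R U s) :
    ∃ w : ι → A → S, IsSections R H w ∧ ∀ i, ∀ a ∉ H, w i a = 0 := by
  have hval : Continuous ((↑) : H → A) := continuous_subtype_val
  obtain ⟨v, hv⟩ := exists_isSections_univ (A := H) (R := fun a => R a) (ι := ι) fun a => by
    obtain ⟨U, hU, s, hs⟩ := hloc a a.2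
    exact ⟨_, hval.continuousAt hU, _, hs.comp hval.continuousOn fun _ h => h⟩
  let w (i : ι) : A → S := Function.extend (↑) (v i) 0
  have hw (i : ι) (a : H) : w i a = v i a := Subtype.val_injective.extend_apply _ _ a
  refine ⟨w, ⟨fun i => ?_, fun a ha => ?_, fun a ha => ?_⟩, fun i a ha => ?_⟩
  · rw [continuousOn_iff_continuous_domRestrict]
    exact (continuousOn_univ.1 (hv.continuousOn i)).congr fun a => (hw i a).symm
  · simpa only [← hw] using hv.injective ⟨a, ha⟩ trivial
  · simpa only [← hw] using hv.range_eq ⟨a, ha⟩ trivial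
  · exact Function.extend_apply' _ _ _ fun ⟨b, hb⟩ => ha (hb ▸ b.2)

end Sections

/-! ### Uniformization of the roots -/

section Uniformization

variable {n : ℕ}

theorem exists_map_univ_eq {α : Type*} {m : Multiset α} (hm : m.card = n) :
    ∃ r : Fin n → α, (Finset.univ : Finset (Fin n)).val.map r = m := by
  subst hm
  induction m using Quotient.inductionOn with
  | h l => exact ⟨l.get, (Fin.univ_val_map l.get).trans (congrArg _ l.ofFn_get)⟩

theorem eventually_injective {A S ι : Type*} [TopologicalSpace A] [TopologicalSpace S] [T2Space S]
    [Finite ι] {s : ι → A → S} {a : A} (hs : ∀ j, ContinuousAt (s j) a)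
    (hinj : Function.Injective fun j => s j a) :
    ∀ᶠ b in nhds a, Function.Injective fun j => s j b := by
  have hne : ∀ᶠ b in nhds a, ∀ i j, i ≠ j → s i b ≠ s j b := by
    simp only [Filter.eventually_all]
    exact fun i j hij => ((hs i).prodMk (hs j)).eventually
      (isClosed_diagonal.isOpen_compl.eventually_mem (hinj.ne hij))
  filter_upwards [hne] with b hb i j hij using not_imp_not.1 (hb i j) hij

theorem localRoots_eq_map {f : ℂ[X][Y]} {δ : ℝ} {z : ℂ} (hcard : (localRoots f δ z).card = n)
    {r : Fin n → ℂ} (hr : Function.Injective r) (hroot : ∀ j, f.evalEval z (r j) = 0)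
    (hlt : ∀ j, ‖r j‖ < δ) : localRoots f δ z = (Finset.univ : Finset (Fin n)).val.map r := by
  symm
  refine Multiset.eq_of_le_of_card_le ?_ (by simp [hcard])
  rw [Multiset.le_iff_subset (Fintype.nodup_map_univ_iff_injective.2 hr)]
  intro w hw
  obtain ⟨j, -, rfl⟩ := Multiset.mem_map.1 hw
  refine mem_localRoots.2 ⟨fun h₀ => j.pos.ne ?_, hroot j, hlt j⟩
  simpa [localRoots, h₀] using hcard

theorem exists_isSections_localRoots {f : ℂ[X][Y]} {δ : ℝ} {z₀ : ℂ}
    (hcard : ∀ᶠ z in nhds z₀, (localRoots f δ z).card = n)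
    (hsimple : ∀ w, f.evalEval z₀ w = 0 → (derivative f).evalEval z₀ w ≠ 0) :
    ∃ s : Fin n → ℂ → ℂ, (∀ j, DifferentiableAt ℂ (s j) z₀) ∧ ∃ U ∈ nhds z₀,
      IsSections (fun z => {w | w ∈ localRoots f δ z}) U s := by
  obtain ⟨r, hr⟩ := exists_map_univ_eq hcard.self_of_nhds
  have hrinj : Function.Injective r :=
    Fintype.nodup_map_univ_iff_injective.1 (hr ▸ nodup_localRoots hsimple)
  have hrmem (j : Fin n) : f.evalEval z₀ (r j) = 0 ∧ ‖r j‖ < δ :=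
    (mem_localRoots.1 (hr ▸ Multiset.mem_map_of_mem r (Finset.mem_univ j))).2
  choose s hs₀ hsd hroot using fun j =>
    exists_implicit_root f (hrmem j).1 (hsimple _ (hrmem j).1)
  have hdiff (j : Fin n) : DifferentiableAt ℂ (s j) z₀ := (hsd j).self_of_nhds
  have hlt (j : Fin n) : ∀ᶠ z in nhds z₀, ‖s j z‖ < δ :=
    (hdiff j).continuousAt.norm.eventually_lt_const (by simpa only [hs₀] using (hrmem j).2)
  have hinj : ∀ᶠ z in nhds z₀, Function.Injective fun j => s j z :=
    eventually_injective (fun j => (hdiff j).continuousAt) (by simpa only [hs₀] using hrinj)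
  have hall := ((Filter.eventually_all.2 hsd).and (Filter.eventually_all.2 hroot)).and
    ((Filter.eventually_all.2 hlt).and (hinj.and hcard))
  refine ⟨s, hdiff, _, hall, fun j z hz => (hz.1.1 j).continuousAt.continuousWithinAt,
    fun z hz => hz.2.2.1, fun z ⟨⟨_, hroot⟩, hlt, hinj, hcard⟩ => ?_⟩
  ext w
  simp [localRoots_eq_map hcard hinj hroot hlt]

/-- The coordinate `τ`, `z = exp (I τ)`, uniformizes the roots near the origin: over the half plane
`c < Im τ` they are the `n` functions `w i`, and `π` is their monodromy. -/
structure IsUniformization (f : ℂ[X][Y]) (δ c : ℝ) (w : Fin n → ℂ → ℂ)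
    (π : Equiv.Perm (Fin n)) : Prop where
  differentiableAt : ∀ i τ, c < τ.im → DifferentiableAt ℂ (w i) τ
  injective : ∀ τ, c < τ.im → Function.Injective fun i => w i τ
  roots : ∀ τ, c < τ.im → localRoots f δ (Complex.exp (Complex.I * τ)) =
    (Finset.univ : Finset (Fin n)).val.map fun i => w i τ
  period : ∀ i τ, w i (τ + 2 * Real.pi) = w (π i) τ
  tendsto_zero : ∀ i, Filter.Tendsto (w i) (Filter.comap Complex.im Filter.atTop) (nhds 0)
  boundary : ∀ z w, ‖z‖ < Real.exp (-c) → ‖w‖ = δ → f.evalEval z w ≠ 0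
  center : localRoots f δ 0 = Multiset.replicate n 0

theorem norm_exp_I_mul (τ : ℂ) : ‖Complex.exp (Complex.I * τ)‖ = Real.exp (-τ.im) := by
  simp [Complex.norm_exp]

theorem exp_I_mul_add_two_pi (τ : ℂ) :
    Complex.exp (Complex.I * (τ + 2 * Real.pi)) = Complex.exp (Complex.I * τ) := by
  rw [mul_add, mul_comm Complex.I (2 * Real.pi), Complex.exp_periodic]

theorem tendsto_exp_I_mul :
    Filter.Tendsto (fun τ => Complex.exp (Complex.I * τ))
      (Filter.comap Complex.im Filter.atTop) (nhds 0) := by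
  rw [tendsto_zero_iff_norm_tendsto_zero]
  simp only [norm_exp_I_mul]
  exact Real.tendsto_exp_neg_atTop_nhds_zero.comp Filter.tendsto_comap

/-- The half plane is simply connected, so the sections have no monodromy over it. -/
theorem exists_isSections_exp {R : ℂ → Set ℂ} {ι : Type*} [Finite ι] {c : ℝ}
    (hloc : ∀ z, z ≠ 0 → ‖z‖ < Real.exp (-c) → ∃ s : ι → ℂ → ℂ,
      (∀ j, DifferentiableAt ℂ (s j) z) ∧ ∃ U ∈ nhds z, IsSections R U s) :
    ∃ w : ι → ℂ → ℂ, IsSections (fun τ => R (Complex.exp (Complex.I * τ))) {τ | c < τ.im} w ∧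
      (∀ i τ, c < τ.im → DifferentiableAt ℂ (w i) τ) ∧ ∀ i τ, ¬ c < τ.im → w i τ = 0 := by
  have hexp : Differentiable ℂ fun τ => Complex.exp (Complex.I * τ) := by fun_prop
  have hH : IsOpen {τ : ℂ | c < τ.im} := isOpen_lt continuous_const Complex.continuous_im
  have hne : {τ : ℂ | c < τ.im}.Nonempty := ⟨(c + 1 : ℝ) * Complex.I, by simp⟩
  have : ContractibleSpace {τ : ℂ | c < τ.im} := (convex_halfSpace_im_gt c).contractibleSpace hne
  have : LocallyPathConnectedSpace {τ : ℂ | c < τ.im} := hH.locallyPathConnectedSpace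
  have hlocH (τ : ℂ) (hτ : c < τ.im) : ∃ s : ι → ℂ → ℂ, (∀ j, DifferentiableAt ℂ (s j) τ) ∧
      ∃ U ∈ nhds τ, IsSections (fun τ => R (Complex.exp (Complex.I * τ))) U s := by
    obtain ⟨s, hsd, U, hU, hs⟩ := hloc (Complex.exp (Complex.I * τ)) (Complex.exp_ne_zero _)
      (by rw [norm_exp_I_mul]; gcongr)
    exact ⟨_, fun j => (hsd j).fun_comp' τ (hexp τ), _, hexp.continuous.continuousAt hU,
      hs.comp hexp.continuous.continuousOn fun _ h => h⟩
  obtain ⟨w, hw, hw₀⟩ := exists_isSections (H := {τ : ℂ | c < τ.im}) fun τ hτ =>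
    let ⟨s, _, U, hU, hs⟩ := hlocH τ hτ
    ⟨U, hU, s, hs⟩
  refine ⟨w, hw, fun i τ hτ => ?_, hw₀⟩
  obtain ⟨s, hsd, U, hU, hs⟩ := hlocH τ hτ
  obtain ⟨j, hj⟩ := hs.exists_eventuallyEq hU hw (hH.mem_nhds hτ) i
  exact (hsd j).congr_of_eventuallyEq hj

theorem exists_isUniformization_of_card {f : ℂ[X][Y]} {δ c : ℝ}
    (hcard : ∀ z, ‖z‖ < Real.exp (-c) → (localRoots f δ z).card = n)
    (hsimple : ∀ z w, z ≠ 0 → ‖z‖ < Real.exp (-c) → f.evalEval z w = 0 →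
      (derivative f).evalEval z w ≠ 0)
    (hboundary : ∀ z w, ‖z‖ < Real.exp (-c) → ‖w‖ = δ → f.evalEval z w ≠ 0)
    (hcenter : localRoots f δ 0 = Multiset.replicate n 0)
    (hsmall : ∀ η > 0, ∀ᶠ z in nhds (0 : ℂ), ∀ w ∈ localRoots f δ z, ‖w‖ < η) :
    ∃ (w : Fin n → ℂ → ℂ) (π : Equiv.Perm (Fin n)), IsUniformization f δ c w π := by
  obtain ⟨w, hw, hwd, hw₀⟩ := exists_isSections_exp (c := c) (ι := Fin n)
    (R := fun z => {x | x ∈ localRoots f δ z}) fun z hz hzc => exists_isSections_localRoots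
      (by filter_upwards [continuous_norm.continuousAt.eventually_lt_const hzc] using hcard)
      fun x => hsimple z x hz hzc
  have hne : {τ : ℂ | c < τ.im}.Nonempty := ⟨(c + 1 : ℝ) * Complex.I, by simp⟩
  have hshift (τ : ℂ) : c < (τ + 2 * Real.pi).im ↔ c < τ.im := by simp
  obtain ⟨π, hπ⟩ := hw.exists_perm (convex_halfSpace_im_gt c).isPreconnected hne
    (g := fun τ => τ + 2 * Real.pi) (by fun_prop) (fun τ => (hshift τ).2)
    fun τ _ => by simp only [exp_I_mul_add_two_pi]
  refine ⟨w, π, hwd, hw.injective, fun τ hτ => ?_, fun i τ => ?_, fun i => ?_, hboundary, hcenter⟩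
  · have hlt : ‖Complex.exp (Complex.I * τ)‖ < Real.exp (-c) := by rw [norm_exp_I_mul]; gcongr
    have hmem i := mem_localRoots.1 (hw.apply_mem hτ i)
    exact localRoots_eq_map (hcard _ hlt) (hw.injective τ hτ) (fun i => (hmem i).2.1)
      fun i => (hmem i).2.2
  · by_cases hτ : c < τ.im
    · exact hπ i hτ
    · rw [hw₀ _ _ hτ, hw₀ _ _ (mt (hshift τ).1 hτ)]
  · rw [Metric.tendsto_nhds]
    intro η hη
    filter_upwards [tendsto_exp_I_mul.eventually (hsmall η hη),
      Filter.tendsto_comap.eventually (Filter.eventually_gt_atTop c)] with τ hsmall hτ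
    simpa using hsmall _ (hw.apply_mem hτ i)

theorem map_evalRingHom_zero_ne_zero {R : Type*} [CommRing R] {f : R[X][Y]}
    (hf : ¬ ((C X : R[X][Y]) ∣ f)) : f.map (evalRingHom (0 : R)) ≠ 0 := by
  intro h
  refine hf ((C_dvd_iff_dvd_coeff _ _).2 fun i => X_dvd_iff.2 ?_)
  simpa [coeff_map, coeff_zero_eq_eval_zero] using congrArg (fun p => p.coeff i) h

theorem exists_isolated_root {f : ℂ[X][Y]} (hf : f.map (evalRingHom (0 : ℂ)) ≠ 0) :
    ∃ δ₀ : ℝ, 0 < δ₀ ∧ ∀ w : ℂ, ‖w‖ ≤ δ₀ → f.evalEval 0 w = 0 → w = 0 := by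
  have h := eventually_nhdsNE_eval_ne_zero hf 0
  obtain ⟨δ₀, hδ₀, hball⟩ :=
    Metric.nhds_basis_closedBall.eventually_iff.1 (eventually_nhdsWithin_iff.1 h)
  refine ⟨δ₀, hδ₀, fun w hw hw₀ => not_not.1 fun hne => hball (by simpa using hw) hne ?_⟩
  rwa [map_evalRingHom_eval]

theorem localRoots_zero_eq_replicate {f : ℂ[X][Y]} {δ : ℝ} (hδ : 0 < δ)
    (hf : f.map (evalRingHom (0 : ℂ)) ≠ 0)
    (hroot : ∀ w : ℂ, ‖w‖ < δ → f.evalEval 0 w = 0 → w = 0) :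
    localRoots f δ 0 =
      Multiset.replicate ((f.map (evalRingHom (0 : ℂ))).rootMultiplicity 0) 0 := by
  classical
  unfold localRoots
  rw [← count_roots, ← Multiset.filter_eq']
  refine Multiset.filter_congr fun w hw => ⟨fun h => hroot w h ?_, fun h => by simpa [h] using hδ⟩
  rw [← map_evalRingHom_eval]
  exact (mem_roots hf).1 hw

theorem localRoots_mono (f : ℂ[X][Y]) {δ δ' : ℝ} (h : δ ≤ δ') (z : ℂ) :
    localRoots f δ z ≤ localRoots f δ' z :=
  Multiset.monotone_filter_right _ fun _ hw => lt_of_lt_of_le hw h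

theorem eventually_forall_mem_localRoots_norm_lt {f : ℂ[X][Y]} {δ : ℝ} {z₀ : ℂ}
    (hcard : ∀ η, 0 < η → η ≤ δ → ∀ᶠ z in nhds z₀, (localRoots f η z).card = n) {η : ℝ}
    (hδ : 0 < δ) (hη : 0 < η) : ∀ᶠ z in nhds z₀, ∀ w ∈ localRoots f δ z, ‖w‖ < η := by
  filter_upwards [hcard δ hδ le_rfl, hcard (min η δ) (lt_min hη hδ) (min_le_right _ _)]
    with z hδz hmin w hw
  rw [← Multiset.eq_of_le_of_card_le (localRoots_mono f (min_le_right η δ) z) (by omega)] at hw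
  exact (mem_localRoots.1 hw).2.2.trans_le (min_le_left _ _)

/-- A common zero of `f` and its derivative lies over a zero of `D = A * f + B * derivative f`. -/
theorem eventually_derivative_evalEval_ne_zero {f : ℂ[X][Y]} (hf : Squarefree f) (z₀ : ℂ) :
    ∀ᶠ z in nhdsWithin z₀ {z₀}ᶜ, ∀ w, f.evalEval z w = 0 → (derivative f).evalEval z w ≠ 0 := by
  obtain ⟨A, B, D, hD, hAB⟩ := by
    letI : NormalizedGCDMonoid ℂ[X] := Nonempty.some inferInstance
    exact exists_mul_add_derivative_mul_eq_C hf
  filter_upwards [eventually_nhdsNE_eval_ne_zero hD z₀] with z hz w hw hw'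
  have h := congrArg (fun p => p.evalEval z w) hAB
  simp only [evalEval_add, evalEval_mul, hw, hw', zero_mul, add_zero, evalEval_C] at h
  exact hz h.symm

theorem exists_isUniformization {f : ℂ[X][Y]} (hsq : Squarefree f) (hz : ¬ ((C X : ℂ[X][Y]) ∣ f))
    (hn : n = (f.map (evalRingHom (0 : ℂ))).rootMultiplicity 0) :
    ∃ δ₀ : ℝ, 0 < δ₀ ∧ ∀ δ : ℝ, 0 < δ → δ ≤ δ₀ →
      ∃ (c : ℝ) (w : Fin n → ℂ → ℂ) (π : Equiv.Perm (Fin n)), IsUniformization f δ c w π := by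
  have hf := map_evalRingHom_zero_ne_zero hz
  obtain ⟨δ₀, hδ₀, hroot⟩ := exists_isolated_root hf
  have hcenter (δ : ℝ) (hδ : 0 < δ) (hle : δ ≤ δ₀) : localRoots f δ 0 = Multiset.replicate n 0 :=
    hn ▸ localRoots_zero_eq_replicate hδ hf fun w hw => hroot w (hw.le.trans hle)
  have hbound (δ : ℝ) (hδ : 0 < δ) (hle : δ ≤ δ₀) (w : ℂ) (hw : ‖w‖ = δ) : f.evalEval 0 w ≠ 0 :=
    fun h => norm_pos_iff.1 (hw ▸ hδ) (hroot w (hw.trans_le hle) h)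
  have hcard (δ : ℝ) (hδ : 0 < δ) (hle : δ ≤ δ₀) : ∀ᶠ z in nhds (0 : ℂ),
      (localRoots f δ z).card = n := by
    simpa [hcenter δ hδ hle] using eventually_card_localRoots_eq f hδ (hbound δ hδ hle)
  refine ⟨δ₀, hδ₀, fun δ hδ hle => ?_⟩
  obtain ⟨r, hr, hball⟩ := Metric.eventually_nhds_iff_ball.1 <|
    (eventually_nhdsWithin_iff.1 (eventually_derivative_evalEval_ne_zero hsq 0)).and <|
      (eventually_evalEval_ne_zero_of_norm_eq f (hbound δ hδ hle)).and (hcard δ hδ hle)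
  have hball (z : ℂ) (hz : ‖z‖ < Real.exp (- -Real.log r)) :=
    hball z (by simpa [Real.exp_log hr] using hz)
  exact ⟨-Real.log r, exists_isUniformization_of_card (fun z h => (hball z h).2.2)
    (fun z w hz₀ h => (hball z h).1 hz₀ w) (fun z w h => (hball z h).2.1 w) (hcenter δ hδ hle)
    fun η hη => eventually_forall_mem_localRoots_norm_lt
      (fun η hη hle' => hcard η hη (hle'.trans hle)) hδ hη⟩

end Uniformization

/-! ### Periodic functions on a half plane -/

section Periodic

theorem differentiableOn_cuspFunction {W : ℂ → ℂ} {c h : ℝ} (hh : 0 < h)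
    (hper : Function.Periodic W h) (hd : ∀ τ : ℂ, c < τ.im → DifferentiableAt ℂ W τ)
    (hbdd : Filter.BoundedAtFilter (Filter.comap Complex.im Filter.atTop) W) :
    DifferentiableOn ℂ (Function.Periodic.cuspFunction h W)
      (Metric.ball 0 (Real.exp (-(2 * Real.pi * c) / h))) := by
  refine fun t ht => DifferentiableAt.differentiableWithinAt ?_
  rcases eq_or_ne t 0 with rfl | ht₀
  · refine Function.Periodic.differentiableAt_cuspFunction_zero hh hper ?_ hbdd
    exact (Filter.tendsto_comap.eventually (Filter.eventually_gt_atTop c)).mono hd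
  · rw [← Function.Periodic.qParam_right_inv hh.ne' ht₀]
    refine Function.Periodic.differentiableAt_cuspFunction hh.ne' hper (hd _ ?_)
    have hlog : Real.log ‖t‖ < -(2 * Real.pi * c) / h := by
      simpa [Real.log_lt_iff_lt_exp (norm_pos_iff.2 ht₀)] using ht
    rw [lt_div_iff₀ hh] at hlog
    rw [Function.Periodic.im_invQParam, div_mul_eq_mul_div, lt_div_iff₀ Real.two_pi_pos]
    linarith

theorem exists_eq_comp_exp {W : ℂ → ℂ} {c : ℝ} {M : ℕ} (hM : 0 < M)
    (hd : ∀ τ : ℂ, c < τ.im → DifferentiableAt ℂ W τ)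
    (hper : ∀ τ, W (τ + 2 * Real.pi * M) = W τ)
    (hlim : Filter.Tendsto W (Filter.comap Complex.im Filter.atTop) (nhds 0)) :
    ∃ G : ℂ → ℂ, DifferentiableOn ℂ G (Metric.ball 0 (Real.exp (-c / M))) ∧ G 0 = 0 ∧
      ∀ τ, G (Complex.exp (Complex.I * τ / M)) = W τ := by
  have : (0 : ℝ) < M := by exact_mod_cast hM
  have hπ : (Real.pi : ℂ) ≠ 0 := by exact_mod_cast Real.pi_ne_zero
  set h : ℝ := 2 * Real.pi * M with h_def
  have hh : 0 < h := by positivity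
  have hW : Function.Periodic W h := fun τ => by simpa [h] using hper τ
  have hq (τ : ℂ) : Function.Periodic.qParam h τ = Complex.exp (Complex.I * τ / M) := by
    rw [Function.Periodic.qParam, h_def]
    push_cast
    congr 1
    field_simp
  refine ⟨_, ?_, Function.Periodic.cuspFunction_zero_of_zero_at_inf hh hlim, fun τ => ?_⟩
  · have hc : -(2 * Real.pi * c) / h = -c / M := by
      rw [h_def]
      field_simp
    exact hc ▸ differentiableOn_cuspFunction hh hW hd (Filter.ZeroAtFilter.boundedAtFilter hlim)
  · rw [← hq]
    exact Function.Periodic.eq_cuspFunction hh.ne' hW τ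

theorem norm_exp_I_mul_div (τ : ℂ) (M : ℕ) :
    ‖Complex.exp (Complex.I * τ / M)‖ = Real.exp (-τ.im / M) := by
  simp [Complex.norm_exp, Complex.div_natCast_re]

theorem exists_exp_I_mul_div_eq {t : ℂ} (ht : t ≠ 0) {M : ℕ} (hM : 0 < M) :
    ∃ τ : ℂ, Complex.exp (Complex.I * τ / M) = t ∧ τ.im = -(M * Real.log ‖t‖) := by
  have hM' : (M : ℂ) ≠ 0 := by exact_mod_cast hM.ne'
  refine ⟨-Complex.I * (M * Complex.log t), ?_, by simp [Complex.log_re]⟩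
  rw [show Complex.I * (-Complex.I * (M * Complex.log t)) / M = Complex.log t by
    field_simp
    linear_combination -Complex.log t * Complex.I_sq, Complex.exp_log ht]

theorem exists_eq_pow_mul {G : ℂ → ℂ} {U : Set ℂ} {z₀ : ℂ} (hU : U ∈ nhds z₀)
    (hG : DifferentiableOn ℂ G U) (hne : ∀ z ∈ U, z ≠ z₀ → G z ≠ 0) :
    ∃ k : ℕ, analyticOrderAt G z₀ = k ∧ ∃ u : ℂ → ℂ, DifferentiableOn ℂ u U ∧
      ∀ z ∈ U, u z ≠ 0 ∧ G z = (z - z₀) ^ k * u z := by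
  have hne' : ∀ᶠ z in nhdsWithin z₀ {z₀}ᶜ, G z ≠ 0 := by
    filter_upwards [mem_nhdsWithin_of_mem_nhds hU, self_mem_nhdsWithin] using hne
  have hfin : analyticOrderAt G z₀ ≠ ⊤ := fun htop => by
    have hzero := (analyticOrderAt_eq_top.1 htop).filter_mono (nhdsWithin_le_nhds (s := {z₀}ᶜ))
    exact (hne'.and hzero).exists.elim fun z hz => hz.1 hz.2
  obtain ⟨k, hk⟩ := ENat.ne_top_iff_exists.1 hfin
  obtain ⟨g, hg, hg₀, hgG⟩ := (hG.analyticAt hU).analyticOrderAt_eq_natCast.1 hk.symm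
  let u : ℂ → ℂ := Function.update (fun z => G z / (z - z₀) ^ k) z₀ (g z₀)
  have hu (z : ℂ) (hz : z ≠ z₀) : u z = G z / (z - z₀) ^ k := Function.update_of_ne hz _ _
  have hu₀ : u z₀ = g z₀ := Function.update_self _ _ _
  have hpow (z : ℂ) (hz : z ≠ z₀) : (z - z₀) ^ k ≠ 0 := pow_ne_zero _ (sub_ne_zero.2 hz)
  have hug : u =ᶠ[nhds z₀] g := by
    filter_upwards [hgG] with z hz
    rcases eq_or_ne z z₀ with rfl | h
    · exact hu₀
    · rw [hu z h, hz, smul_eq_mul, mul_div_cancel_left₀ _ (hpow z h)]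
  refine ⟨k, hk.symm, u, fun z hz => ?_, fun z hz => ?_⟩
  · rcases eq_or_ne z z₀ with rfl | h
    · exact (hg.differentiableAt.congr_of_eventuallyEq hug).differentiableWithinAt
    · have hpow' : DifferentiableWithinAt ℂ (fun z => (z - z₀) ^ k) U z := by fun_prop
      refine ((hG z hz).div hpow' (hpow z h)).congr_of_eventuallyEq ?_ (hu z h)
      filter_upwards [mem_nhdsWithin_of_mem_nhds (isOpen_ne.mem_nhds h)] using hu
  · rcases eq_or_ne z z₀ with rfl | h
    · refine ⟨hu₀ ▸ hg₀, ?_⟩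
      rw [hu₀, hgG.self_of_nhds, smul_eq_mul]
    · rw [hu z h]
      exact ⟨div_ne_zero (hne z hz h) (hpow z h), (mul_div_cancel₀ _ (hpow z h)).symm⟩

theorem exists_eq_exp {u : ℂ → ℂ} {z₀ : ℂ} {R : ℝ} (hu : DifferentiableOn ℂ u (Metric.ball z₀ R))
    (hne : ∀ z ∈ Metric.ball z₀ R, u z ≠ 0) :
    ∃ L : ℂ → ℂ, DifferentiableOn ℂ L (Metric.ball z₀ R) ∧
      ∀ z ∈ Metric.ball z₀ R, u z = Complex.exp (L z) := by
  rcases le_or_gt R 0 with hR | hR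
  · exact ⟨u, hu, by simp [Metric.ball_eq_empty.2 hR]⟩
  have hz₀ : z₀ ∈ Metric.ball z₀ R := Metric.mem_ball_self hR
  obtain ⟨L, hL₀, hL⟩ := ((hu.deriv Metric.isOpen_ball).div hu hne).isExactOn_ball.with_val_at z₀
    (Complex.log (u z₀))
  have hderiv (z : ℂ) (hz : z ∈ Metric.ball z₀ R) :
      HasDerivAt (fun z => u z * Complex.exp (-L z)) 0 z := by
    have hu' := (hu.differentiableAt (Metric.isOpen_ball.mem_nhds hz)).hasDerivAt
    refine (hu'.mul (hL z hz).neg.cexp).congr_deriv ?_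
    have := hne z hz
    simp only [Pi.div_apply]
    field_simp
    ring
  refine ⟨L, fun z hz => (hL z hz).differentiableAt.differentiableWithinAt, fun z hz => ?_⟩
  have hconst := Metric.isOpen_ball.is_const_of_deriv_eq_zero (convex_ball z₀ R).isPreconnected
    (fun z hz => (hderiv z hz).differentiableAt.differentiableWithinAt)
    (fun z hz => (hderiv z hz).deriv) hz hz₀
  have hne₀ := hne z₀ hz₀
  simp only [hL₀, Complex.exp_neg, Complex.exp_log hne₀, mul_inv_cancel₀ hne₀] at hconst
  exact (mul_inv_eq_one₀ (Complex.exp_ne_zero _)).1 hconst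

theorem exists_eq_pow_mul_exp {G : ℂ → ℂ} {R : ℝ} (hR : 0 < R)
    (hG : DifferentiableOn ℂ G (Metric.ball 0 R)) (h₀ : G 0 = 0)
    (hne : ∀ t : ℂ, ‖t‖ < R → t ≠ 0 → G t ≠ 0) :
    ∃ k : ℕ, 0 < k ∧ analyticOrderAt G 0 = k ∧ ∃ L : ℂ → ℂ,
      DifferentiableOn ℂ L (Metric.ball 0 R) ∧
      ∀ t ∈ Metric.ball (0 : ℂ) R, G t = t ^ k * Complex.exp (L t) := by
  obtain ⟨k, hk, u, hu, hGu⟩ := exists_eq_pow_mul (Metric.ball_mem_nhds 0 hR) hG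
    fun t ht => hne t (mem_ball_zero_iff.1 ht)
  obtain ⟨L, hL, huL⟩ := exists_eq_exp hu fun t ht => (hGu t ht).1
  have hk₀ : k ≠ 0 := by
    rintro rfl
    obtain ⟨hu₀, hG₀⟩ := hGu 0 (Metric.mem_ball_self hR)
    exact hu₀ (by simpa [h₀] using hG₀.symm)
  refine ⟨k, hk₀.bot_lt, hk, L, hL, fun t ht => ?_⟩
  rw [(hGu t ht).2, huL t ht, sub_zero]

theorem exists_comp_exp_eq_pow_mul_exp {W : ℂ → ℂ} {c : ℝ} {M : ℕ} (hM : 0 < M)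
    (hd : ∀ τ : ℂ, c < τ.im → DifferentiableAt ℂ W τ)
    (hper : ∀ τ, W (τ + 2 * Real.pi * M) = W τ)
    (hlim : Filter.Tendsto W (Filter.comap Complex.im Filter.atTop) (nhds 0))
    (hne : ∀ τ : ℂ, c < τ.im → W τ ≠ 0) :
    ∃ (G L : ℂ → ℂ) (k : ℕ), G 0 = 0 ∧ (∀ τ, G (Complex.exp (Complex.I * τ / M)) = W τ) ∧
      0 < k ∧ analyticOrderAt G 0 = k ∧
      DifferentiableOn ℂ L (Metric.ball 0 (Real.exp (-c / M))) ∧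
      ∀ t ∈ Metric.ball (0 : ℂ) (Real.exp (-c / M)), G t = t ^ k * Complex.exp (L t) := by
  obtain ⟨G, hG, hG₀, hGW⟩ := exists_eq_comp_exp hM hd hper hlim
  obtain ⟨k, hk, hord, L, hL, hGL⟩ := exists_eq_pow_mul_exp (Real.exp_pos _) hG hG₀ (by
    intro t ht ht₀
    obtain ⟨τ, rfl, -⟩ := exists_exp_I_mul_div_eq ht₀ hM
    rw [norm_exp_I_mul_div, Real.exp_lt_exp,
      div_lt_div_iff_of_pos_right (by exact_mod_cast hM)] at ht
    exact hGW τ ▸ hne τ (by linarith))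
  exact ⟨G, L, k, hG₀, hGW, hk, hord, hL, hGL⟩

end Periodic

section Turning

/-- `φ` is a differentiable argument of the nonvanishing function `d` that grows at least at the
rate `m`. -/
structure IsArgOfRate (φ : ℝ → ℝ) (d : ℝ → ℂ) (m : ℝ) : Prop where
  ne_zero : ∀ θ, d θ ≠ 0
  eq : ∀ θ, d θ = ‖d θ‖ * Complex.exp (φ θ * Complex.I)
  differentiable : Differentiable ℝ φ
  le_deriv : ∀ θ, m ≤ deriv φ θ

theorem IsArgOfRate.isTurningAngle {φ : ℝ → ℝ} {d : ℝ → ℂ} {m : ℝ} (h : IsArgOfRate φ d m)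
    (hm : 0 < m) : IsTurningAngle φ d where
  continuous := h.differentiable.continuous
  strictMono := strictMono_of_deriv_pos fun θ => hm.trans_le (h.le_deriv θ)
  unbounded B := by
    obtain ⟨x, hx⟩ := exists_gt (max 0 ((B - φ 0) / m))
    obtain ⟨hx₀, hxB⟩ := max_lt_iff.1 hx
    have hle := mul_sub_le_image_sub_of_le_deriv h.differentiable h.le_deriv hx₀.le
    rw [div_lt_iff₀ hm] at hxB
    exact ⟨x, by linarith⟩
  ne_zero := h.ne_zero
  eq := h.eq

theorem isArgOfRate_of_eq_exp {d Λ Λ' : ℝ → ℂ} {m : ℝ} (hd : ∀ θ, d θ = Complex.exp (Λ θ))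
    (hΛ : ∀ θ, HasDerivAt Λ (Λ' θ) θ) (hm : ∀ θ, m ≤ (Λ' θ).im) :
    IsArgOfRate (fun θ => (Λ θ).im) d m := by
  have him (θ : ℝ) : HasDerivAt (fun θ => (Λ θ).im) (Λ' θ).im θ :=
    Complex.imCLM.hasFDerivAt.comp_hasDerivAt θ (hΛ θ)
  refine ⟨fun θ => hd θ ▸ Complex.exp_ne_zero _, fun θ => ?_, fun θ => (him θ).differentiableAt,
    fun θ => (him θ).deriv ▸ hm θ⟩
  rw [hd, Complex.norm_exp, Complex.ofReal_exp, ← Complex.exp_add, Complex.re_add_im]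

/-- With `t = exp (I τ / M)`, the function is `t ^ k * exp (L t)`, `0 < k`; on horizontal lines its
argument has the derivative `(k + re (t * L' t)) / M`, and `t` tends to `0`. -/
theorem eventually_isArgOfRate {W : ℂ → ℂ} {c : ℝ} {M : ℕ} (hM : 0 < M)
    (hd : ∀ τ : ℂ, c < τ.im → DifferentiableAt ℂ W τ)
    (hper : ∀ τ, W (τ + 2 * Real.pi * M) = W τ)
    (hlim : Filter.Tendsto W (Filter.comap Complex.im Filter.atTop) (nhds 0))
    (hne : ∀ τ : ℂ, c < τ.im → W τ ≠ 0) :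
    ∀ᶠ y : ℝ in Filter.atTop, ∃ φ : ℝ → ℝ,
      IsArgOfRate φ (fun θ => W (θ + y * Complex.I)) (1 / (2 * M)) := by
  have hM' : (0 : ℝ) < M := by exact_mod_cast hM
  obtain ⟨G, L, k, -, hGW, hk, -, hL, hGL⟩ := exists_comp_exp_eq_pow_mul_exp hM hd hper hlim hne
  have hball := Metric.ball_mem_nhds (0 : ℂ) (Real.exp_pos (-c / M))
  have hcont : ContinuousAt (fun t => ‖t * deriv L t‖) 0 :=
    (continuousAt_id.mul
      ((hL.deriv Metric.isOpen_ball).continuousOn.continuousAt hball)).norm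
  obtain ⟨ρ, hρ, hρL⟩ := Metric.eventually_nhds_iff_ball.1
    ((hcont.eventually_lt_const (u := 1 / 2) (by simp)).and hball)
  filter_upwards [Filter.eventually_gt_atTop (-(M * Real.log ρ))] with y hy
  let t : ℝ → ℂ := fun θ => Complex.exp (Complex.I * (θ + y * Complex.I) / M)
  have ht (θ : ℝ) : t θ ∈ Metric.ball (0 : ℂ) ρ := by
    rw [mem_ball_zero_iff, norm_exp_I_mul_div, ← Real.lt_log_iff_exp_lt hρ, div_lt_iff₀ hM']
    simp
    linarith
  have hΛ (θ : ℝ) : HasDerivAt (fun θ : ℝ => k * (Complex.I * (θ + y * Complex.I) / M) + L (t θ))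
      (Complex.I * ((k + t θ * deriv L (t θ)) / M)) θ := by
    have hlin : HasDerivAt (fun θ : ℝ => Complex.I * ((θ : ℂ) + y * Complex.I) / M)
        (Complex.I / M) θ := by
      simpa using! (((hasDerivAt_id θ).ofReal_comp.add_const (y * Complex.I)).const_mul
        Complex.I).div_const (M : ℂ)
    have hL' := (hL.differentiableAt (Metric.isOpen_ball.mem_nhds (hρL _ (ht θ)).2)).hasDerivAt
    exact ((hlin.const_mul (k : ℂ)).add (hL'.comp θ hlin.cexp)).congr_deriv (by ring)
  refine ⟨_, isArgOfRate_of_eq_exp (fun θ => ?_) hΛ fun θ => ?_⟩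
  · rw [← hGW, hGL _ (hρL _ (ht θ)).2, Complex.exp_add, ← Complex.exp_nat_mul]
  · have hre := (abs_le.1 ((Complex.abs_re_le_norm _).trans (hρL _ (ht θ)).1.le)).1
    have hk₁ : (1 : ℝ) ≤ k := by exact_mod_cast hk
    rw [Complex.I_mul_im, Complex.div_natCast_re, Complex.add_re, Complex.natCast_re,
      ← div_div, div_le_div_iff_of_pos_right hM']
    linarith

end Turning

/-! ### The multivalued function of the roots -/

section RootFunction

variable {n : ℕ}

theorem toMultiset_injective : Function.Injective (UnorderedTuples.toMultiset (n := n)) :=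
  Subtype.val_injective

theorem toMultiset_ofTuple (v : Fin n → ℂ) : (ofTuple v).toMultiset = Finset.univ.val.map v := rfl

theorem ofTuple_zero_toMultiset :
    (ofTuple (0 : Fin n → ℂ)).toMultiset = Multiset.replicate n 0 := by
  rw [toMultiset_ofTuple, show (0 : Fin n → ℂ) = Function.const _ 0 from rfl, Multiset.map_const]
  simp

theorem differentiable_coeff_prod {ι : Type*} [Finite ι] (s : Finset ι) (k : ℕ) :
    Differentiable ℂ fun v : ι → ℂ => (∏ i ∈ s, (X - C (v i) : ℂ[X])).coeff k := by
  classical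
  have := Fintype.ofFinite ι
  induction s using Finset.induction_on generalizing k with
  | empty => simp
  | insert a s ha ih =>
    simp only [Finset.prod_insert ha, sub_mul, coeff_sub, coeff_C_mul]
    have hX : Differentiable ℂ fun v : ι → ℂ =>
        (X * ∏ i ∈ s, (X - C (v i) : ℂ[X])).coeff k := by
      cases k with
      | zero => simp only [coeff_X_mul_zero, differentiable_const]
      | succ k => simpa only [coeff_X_mul] using ih k
    exact hX.sub ((differentiable_apply a).mul (ih k))

theorem prod_map_ofTuple (v : Fin n → ℂ) :
    ((ofTuple v).toMultiset.map fun r => (X - C r : ℂ[X])).prod = ∏ i, (X - C (v i)) := by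
  rw [toMultiset_ofTuple, Multiset.map_map]
  rfl

theorem continuous_coeff_prod (k : ℕ) : Continuous fun s : UnorderedTuples n =>
    ((s.toMultiset.map fun r => (X - C r : ℂ[X])).prod).coeff k := by
  refine continuous_coinduced_dom.2 ?_
  refine (differentiable_coeff_prod (Finset.univ : Finset (Fin n)) k).continuous.congr fun v => ?_
  rw [Function.comp_apply, prod_map_ofTuple]

theorem norm_exp_I_mul_lt {c : ℝ} {τ : ℂ} (hτ : c < τ.im) :
    ‖Complex.exp (Complex.I * τ)‖ < Real.exp (-c) := by
  rw [norm_exp_I_mul]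
  gcongr

theorem exists_exp_I_mul_eq {c : ℝ} {z : ℂ} (hz : z ≠ 0) (hzc : ‖z‖ < Real.exp (-c)) :
    ∃ τ : ℂ, c < τ.im ∧ Complex.exp (Complex.I * τ) = z := by
  obtain ⟨τ, hτz, hτ⟩ := exists_exp_I_mul_div_eq hz one_pos
  have hlog := (Real.log_lt_iff_lt_exp (norm_pos_iff.2 hz)).2 hzc
  rw [Nat.cast_one, one_mul] at hτ
  exact ⟨τ, by linarith, by simpa using hτz⟩

theorem nhdsNE_le_map_exp_I_mul : nhdsWithin (0 : ℂ) {0}ᶜ ≤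
    Filter.map (fun τ => Complex.exp (Complex.I * τ)) (Filter.comap Complex.im Filter.atTop) := by
  intro s hs
  obtain ⟨y, -, hy⟩ := (Filter.atTop_basis.comap Complex.im).mem_iff.1 (Filter.mem_map.1 hs)
  filter_upwards [self_mem_nhdsWithin,
    mem_nhdsWithin_of_mem_nhds (Metric.ball_mem_nhds 0 (Real.exp_pos (-y)))] with z hz hzy
  obtain ⟨τ, hτ, rfl⟩ := exists_exp_I_mul_eq hz (mem_ball_zero_iff.1 hzy)
  exact hy hτ.le

theorem exists_differentiableAt_exp_I_mul_eq (τ : ℂ) : ∃ σ : ℂ → ℂ,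
    DifferentiableAt ℂ σ (Complex.exp (Complex.I * τ)) ∧ σ (Complex.exp (Complex.I * τ)) = τ ∧
    ∀ z ≠ 0, Complex.exp (Complex.I * σ z) = z := by
  set z₀ := Complex.exp (Complex.I * τ) with h
  have hz₀ : z₀ ≠ 0 := Complex.exp_ne_zero _
  refine ⟨fun z => τ - Complex.I * Complex.log (z / z₀), ?_, by simp [hz₀], fun z hz => ?_⟩
  · have hlog : DifferentiableAt ℂ (fun z => Complex.log (z / z₀)) z₀ :=
      (differentiableAt_id.div_const z₀).clog (by simp [hz₀])
    fun_prop
  · rw [mul_sub, ← mul_assoc, Complex.I_mul_I, neg_one_mul, sub_neg_eq_add, Complex.exp_add, ← h,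
      Complex.exp_log (div_ne_zero hz hz₀), mul_div_cancel₀ _ hz₀]

/-- The roots near the origin as an unordered tuple. The value is a dummy when the number of the
roots is not `n`. -/
def rootFunction (f : ℂ[X][Y]) (δ : ℝ) (n : ℕ) (z : ℂ) : UnorderedTuples n :=
  open Classical in if h : (localRoots f δ z).card = n then ⟨localRoots f δ z, h⟩ else ofTuple 0

namespace IsUniformization

variable {f : ℂ[X][Y]} {δ c : ℝ} {w : Fin n → ℂ → ℂ} {π : Equiv.Perm (Fin n)}

theorem toMultiset_rootFunction (U : IsUniformization f δ c w π) {z : ℂ}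
    (hz : ‖z‖ < Real.exp (-c)) : (rootFunction f δ n z).toMultiset = localRoots f δ z := by
  have hcard : (localRoots f δ z).card = n := by
    rcases eq_or_ne z 0 with rfl | hz₀
    · rw [U.center, Multiset.card_replicate]
    · obtain ⟨τ, hτ, rfl⟩ := exists_exp_I_mul_eq hz₀ hz
      simp [U.roots τ hτ]
  simp [rootFunction, hcard, UnorderedTuples.toMultiset]

theorem rootFunction_exp (U : IsUniformization f δ c w π) {τ : ℂ} (hτ : c < τ.im) :
    rootFunction f δ n (Complex.exp (Complex.I * τ)) = ofTuple fun i => w i τ :=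
  toMultiset_injective <| by
    rw [U.toMultiset_rootFunction (norm_exp_I_mul_lt hτ), U.roots τ hτ, toMultiset_ofTuple]

theorem rootFunction_zero (U : IsUniformization f δ c w π) : rootFunction f δ n 0 = ofTuple 0 :=
  toMultiset_injective <| by
    rw [U.toMultiset_rootFunction (by simpa using Real.exp_pos _), U.center,
      ofTuple_zero_toMultiset]

theorem rootFunction_notMem_discriminantLocus (U : IsUniformization f δ c w π) {z : ℂ}
    (hz : z ≠ 0) (hzc : ‖z‖ < Real.exp (-c)) :
    rootFunction f δ n z ∉ discriminantLocus n := by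
  obtain ⟨τ, hτ, rfl⟩ := exists_exp_I_mul_eq hz hzc
  exact U.rootFunction_exp hτ ▸ ofTuple_notMem_discriminantLocus (U.injective τ hτ)

theorem exists_eventually_rootFunction_eq (U : IsUniformization f δ c w π) {z : ℂ} (hz : z ≠ 0)
    (hzc : ‖z‖ < Real.exp (-c)) : ∃ v : ℂ → Fin n → ℂ, DifferentiableAt ℂ v z ∧
      ∀ᶠ x in nhds z, rootFunction f δ n x = ofTuple (v x) := by
  obtain ⟨τ, hτ, rfl⟩ := exists_exp_I_mul_eq hz hzc
  obtain ⟨σ, hσ, hστ, hexp⟩ := exists_differentiableAt_exp_I_mul_eq τ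
  refine ⟨fun x i => w i (σ x), differentiableAt_pi.2 fun i => ?_, ?_⟩
  · exact DifferentiableAt.fun_comp' _ (hστ.symm ▸ U.differentiableAt i τ hτ) hσ
  · have him : ∀ᶠ x in nhds (Complex.exp (Complex.I * τ)), c < (σ x).im :=
      (Complex.continuous_im.continuousAt.comp hσ.continuousAt).eventually_const_lt
        (by simpa [hστ] using hτ)
    filter_upwards [him, isOpen_ne.mem_nhds hz] with x hx hx₀
    rw [← U.rootFunction_exp hx, hexp x hx₀]

theorem continuousAt_rootFunction_zero (U : IsUniformization f δ c w π) :
    ContinuousAt (rootFunction f δ n) 0 := by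
  rw [← continuousWithinAt_compl_self, ContinuousWithinAt, U.rootFunction_zero]
  refine Filter.Tendsto.mono_left (Filter.tendsto_map'_iff.2 ?_) nhdsNE_le_map_exp_I_mul
  refine (continuous_ofTuple.continuousAt.tendsto.comp
    (tendsto_pi_nhds.2 U.tendsto_zero)).congr' ?_
  filter_upwards [Filter.tendsto_comap.eventually (Filter.eventually_gt_atTop c)] with τ hτ
  exact (U.rootFunction_exp hτ).symm

theorem continuousAt_rootFunction (U : IsUniformization f δ c w π) {z : ℂ}
    (hzc : ‖z‖ < Real.exp (-c)) : ContinuousAt (rootFunction f δ n) z := by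
  rcases eq_or_ne z 0 with rfl | hz
  · exact U.continuousAt_rootFunction_zero
  · obtain ⟨v, hv, hFv⟩ := U.exists_eventually_rootFunction_eq hz hzc
    exact (continuous_ofTuple.continuousAt.comp hv.continuousAt).congr (hFv.mono fun _ => Eq.symm)

theorem differentiableAt_coeff_rootFunction (U : IsUniformization f δ c w π) {z : ℂ} (hz : z ≠ 0)
    (hzc : ‖z‖ < Real.exp (-c)) (k : ℕ) : DifferentiableAt ℂ (fun z =>
      (((rootFunction f δ n z).toMultiset.map fun r => (X - C r : ℂ[X])).prod).coeff k) z := by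
  obtain ⟨v, hv, hFv⟩ := U.exists_eventually_rootFunction_eq hz hzc
  refine ((differentiable_coeff_prod Finset.univ k).differentiableAt.comp z
    hv).congr_of_eventuallyEq ?_
  filter_upwards [hFv] with x hx
  rw [hx, prod_map_ofTuple, Function.comp_apply]

theorem isAnalyticMultivaluedOn (U : IsUniformization f δ c w π) :
    IsAnalyticMultivaluedOn (rootFunction f δ n) (Metric.ball 0 (Real.exp (-c))) := by
  intro k z hz
  refine Complex.analyticAt_of_differentiable_on_punctured_nhds_of_continuousAt ?_
    ((continuous_coeff_prod k).continuousAt.comp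
      (U.continuousAt_rootFunction (mem_ball_zero_iff.1 hz)))
  have hne : ∀ᶠ x in nhdsWithin z {z}ᶜ, x ≠ 0 := by
    rcases eq_or_ne z 0 with rfl | hz₀
    · exact self_mem_nhdsWithin
    · exact mem_nhdsWithin_of_mem_nhds (isOpen_ne.mem_nhds hz₀)
  filter_upwards [hne, mem_nhdsWithin_of_mem_nhds (Metric.isOpen_ball.mem_nhds hz)] with x hx hxc
  exact U.differentiableAt_coeff_rootFunction hx (mem_ball_zero_iff.1 hxc) k

theorem mem_localRoots_iff (U : IsUniformization f δ c w π) (hδ : 0 < δ) {z x : ℂ}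
    (hz : ‖z‖ < Real.exp (-c)) : x ∈ localRoots f δ z ↔ f.evalEval z x = 0 ∧ ‖x‖ < δ := by
  rw [mem_localRoots]
  refine and_iff_right fun h => U.boundary z δ hz (by simp [hδ.le]) ?_
  rw [← map_evalRingHom_eval, h, eval_zero]

theorem singularityLink_eq (U : IsUniformization f δ c w π) (hδ : 0 < δ) {ε : ℝ} (hε : 0 < ε)
    (hεc : ε < Real.exp (-c)) : singularityLink f ε δ =
      {x : ℂ × ℂ | ‖x.1‖ = ε ∧ x.2 ∈ (rootFunction f δ n x.1).toMultiset} := by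
  ext ⟨z, x⟩
  simp only [singularityLink, frontier_prod_eq, frontier_closedBall _ hε.ne',
    frontier_closedBall _ hδ.ne', Metric.isClosed_closedBall.closure_eq, Set.mem_inter_iff,
    Set.mem_ofPred_eq, Set.mem_union, Set.mem_prod, mem_closedBall_zero_iff,
    mem_sphere_zero_iff_norm]
  constructor
  · rintro ⟨hroot, ⟨hz, hx⟩ | ⟨hz, hx⟩⟩
    · exact absurd hroot (U.boundary z x (hz.trans_lt hεc) hx)
    · have hzc : ‖z‖ < Real.exp (-c) := hz.trans_lt hεc
      rw [U.toMultiset_rootFunction hzc, U.mem_localRoots_iff hδ hzc]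
      exact ⟨hz, hroot, hx.lt_of_ne fun h => U.boundary z x hzc h hroot⟩
  · rintro ⟨hz, hx⟩
    have hzc : ‖z‖ < Real.exp (-c) := hz.trans_lt hεc
    rw [U.toMultiset_rootFunction hzc, U.mem_localRoots_iff hδ hzc] at hx
    exact ⟨hx.1, Or.inr ⟨hz, hx.2.le⟩⟩

end IsUniformization

end RootFunction

/-! ### Monodromy and turning of the roots -/

section Monodromy

variable {n : ℕ}

theorem exp_I_mul_eq_iff {τ σ : ℂ} : Complex.exp (Complex.I * τ) = Complex.exp (Complex.I * σ) ↔
    ∃ k : ℤ, τ = σ + 2 * Real.pi * k := by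
  rw [Complex.exp_eq_exp_iff_exists_int]
  refine exists_congr fun k => ?_
  rw [show Complex.I * σ + k * (2 * Real.pi * Complex.I) = Complex.I * (σ + 2 * Real.pi * k) by
    ring, mul_right_inj' Complex.I_ne_zero]

/-- The point of the half plane over the point `r * exp (θ * I)` of the circle of radius `r`. -/
def circleLift (r θ : ℝ) : ℂ := θ + (-Real.log r : ℝ) * Complex.I

theorem im_circleLift (r θ : ℝ) : (circleLift r θ).im = -Real.log r := by simp [circleLift]

theorem circleLift_re {r : ℝ} {τ : ℂ} (hτ : τ.im = -Real.log r) : circleLift r τ.re = τ := by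
  rw [circleLift, ← hτ, Complex.re_add_im]

theorem circleLift_add (r θ s : ℝ) : circleLift r (θ + s) = circleLift r θ + s := by
  simp only [circleLift, Complex.ofReal_add]
  ring

theorem continuous_circleLift (r : ℝ) : Continuous (circleLift r) := by
  unfold circleLift
  fun_prop

theorem exp_I_mul_circleLift {r : ℝ} (hr : 0 < r) (θ : ℝ) :
    Complex.exp (Complex.I * circleLift r θ) = r * Complex.exp (θ * Complex.I) := by
  rw [show Complex.I * circleLift r θ = (Real.log r : ℝ) + θ * Complex.I by
    rw [circleLift, Complex.ofReal_neg]
    linear_combination -(Real.log r : ℂ) * Complex.I_mul_I,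
    Complex.exp_add, ← Complex.ofReal_exp, Real.exp_log hr]

theorem lt_neg_log {c r : ℝ} (hr : 0 < r) (hrc : r < Real.exp (-c)) : c < -Real.log r := by
  linarith [(Real.log_lt_iff_lt_exp hr).2 hrc]

theorem lt_im_circleLift {c r : ℝ} (hr : 0 < r) (hrc : r < Real.exp (-c)) (θ : ℝ) :
    c < (circleLift r θ).im :=
  im_circleLift r θ ▸ lt_neg_log hr hrc

theorem exists_loop {g : ℝ → UnorderedTuples n} (hg : Continuous g)
    (hΔ : ∀ t, g t ∉ discriminantLocus n) (hg₀₁ : g 0 = g 1) :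
    ∃ (p : Conf n) (l : Path p p), ∀ t : unitInterval, (l t).1 = g t :=
  ⟨⟨g 0, hΔ 0⟩,
    { toFun := fun t => ⟨g t, hΔ t⟩
      continuous_toFun := (hg.comp continuous_subtype_val).subtype_mk _
      source' := rfl
      target' := Subtype.ext hg₀₁.symm }, fun _ => rfl⟩

namespace IsUniformization

variable {f : ℂ[X][Y]} {δ c : ℝ} {w : Fin n → ℂ → ℂ} {π : Equiv.Perm (Fin n)}

theorem period_pow (U : IsUniformization f δ c w π) (k : ℕ) (i : Fin n) (τ : ℂ) :
    w i (τ + 2 * Real.pi * k) = w ((π ^ k) i) τ := by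
  induction k generalizing i with
  | zero => simp
  | succ k ih =>
    rw [show τ + 2 * Real.pi * ((k + 1 : ℕ) : ℂ) = τ + 2 * Real.pi * k + 2 * Real.pi by
      push_cast; ring, U.period, ih, pow_succ, Equiv.Perm.mul_apply]

theorem period_zpow (U : IsUniformization f δ c w π) (k : ℤ) (i : Fin n) (τ : ℂ) :
    w i (τ + 2 * Real.pi * k) = w ((π ^ k) i) τ := by
  obtain ⟨m, rfl | rfl⟩ := k.eq_nat_or_neg
  · simpa using U.period_pow m i τ
  · have h := U.period_pow m ((π ^ (-(m : ℤ))) i) (τ + 2 * Real.pi * ((-(m : ℤ) : ℤ) : ℂ))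
    rw [← zpow_natCast π m, ← Equiv.Perm.mul_apply, ← zpow_add, add_neg_cancel, zpow_zero,
      Equiv.Perm.one_apply] at h
    rw [← h]
    congr 1
    push_cast
    ring

theorem continuous_comp_circleLift (U : IsUniformization f δ c w π) {r : ℝ} (hr : 0 < r)
    (hrc : r < Real.exp (-c)) (i : Fin n) : Continuous fun θ => w i (circleLift r θ) :=
  continuous_iff_continuousAt.2 fun θ => ContinuousAt.comp (f := circleLift r) (x := θ)
    (U.differentiableAt i _ (lt_im_circleLift hr hrc θ)).continuousAt
    (continuous_circleLift r).continuousAt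

theorem rootFunction_circle (U : IsUniformization f δ c w π) {r : ℝ} (hr : 0 < r)
    (hrc : r < Real.exp (-c)) (θ : ℝ) : rootFunction f δ n (r * Complex.exp (θ * Complex.I)) =
      ofTuple fun i => w i (circleLift r θ) := by
  rw [← exp_I_mul_circleLift hr, U.rootFunction_exp (lt_im_circleLift hr hrc θ)]

theorem period_circleLift (U : IsUniformization f δ c w π) (r : ℝ) (i : Fin n) (θ : ℝ) :
    w i (circleLift r (θ + 2 * Real.pi)) = w (π i) (circleLift r θ) := by
  rw [circleLift_add, ← U.period, Complex.ofReal_mul, Complex.ofReal_ofNat]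

theorem eventually_isArgOfRate_sub (U : IsUniformization f δ c w π) {i j : Fin n} (hij : i ≠ j) :
    ∀ᶠ y : ℝ in Filter.atTop, ∃ φ, IsArgOfRate φ
      (fun θ => w i (θ + y * Complex.I) - w j (θ + y * Complex.I)) (1 / (2 * orderOf π)) := by
  have hper (k : Fin n) (τ : ℂ) : w k (τ + 2 * Real.pi * orderOf π) = w k τ := by
    rw [U.period_pow, pow_orderOf_eq_one, Equiv.Perm.one_apply]
  exact eventually_isArgOfRate (W := fun τ => w i τ - w j τ) (orderOf_pos π)
    (fun τ hτ => (U.differentiableAt i τ hτ).sub (U.differentiableAt j τ hτ))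
    (fun τ => by rw [hper, hper]) (by simpa using (U.tendsto_zero i).sub (U.tendsto_zero j))
    fun τ hτ h => hij (U.injective τ hτ (sub_eq_zero.1 h))

theorem exists_isArgOfRate_sub (U : IsUniformization f δ c w π) :
    ∃ m : ℝ, 0 < m ∧ ∃ ε₀ : ℝ, 0 < ε₀ ∧ ε₀ < Real.exp (-c) ∧
      ∀ r : ℝ, 0 < r → r ≤ ε₀ → ∀ i j, i ≠ j →
        ∃ φ, IsArgOfRate φ (fun θ => w i (circleLift r θ) - w j (circleLift r θ)) m := by
  have hlarge : ∀ᶠ y : ℝ in Filter.atTop, ∀ i j, i ≠ j → ∃ φ, IsArgOfRate φ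
      (fun θ => w i (θ + y * Complex.I) - w j (θ + y * Complex.I)) (1 / (2 * orderOf π)) :=
    Filter.eventually_all.2 fun i => Filter.eventually_all.2 fun j =>
      Filter.eventually_imp_distrib_left.2 U.eventually_isArgOfRate_sub
  obtain ⟨y₀, hy₀⟩ := Filter.eventually_atTop.1 hlarge
  have hπ : (0 : ℝ) < orderOf π := by exact_mod_cast orderOf_pos π
  refine ⟨1 / (2 * orderOf π), by positivity, Real.exp (-max y₀ (c + 1)), Real.exp_pos _,
    Real.exp_lt_exp.2 (by linarith [le_max_right y₀ (c + 1)]), fun r hr hrε => hy₀ _ ?_⟩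
  linarith [(Real.log_le_iff_le_exp hr).2 hrε, le_max_left y₀ (c + 1)]

theorem isTurning (U : IsUniformization f δ c w π) {m r : ℝ} (hm : 0 < m) (hr : 0 < r)
    (hrc : r < Real.exp (-c)) (harg : ∀ i j, i ≠ j →
      ∃ φ, IsArgOfRate φ (fun θ => w i (circleLift r θ) - w j (circleLift r θ)) m) :
    IsTurning fun i θ => w i (circleLift r θ) where
  continuous := U.continuous_comp_circleLift hr hrc
  turning i j hij := (harg i j hij).imp fun _ hφ => hφ.isTurningAngle hm

theorem exists_closedBraid (U : IsUniformization f δ c w π) {ε : ℝ} (hε : 0 < ε)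
    (hεc : ε < Real.exp (-c)) (hw : IsTurning fun i θ => w i (circleLift ε θ)) :
    ∃ (p : Conf n) (l : Path p p),
      (∀ t : unitInterval, (l t).1 =
        rootFunction f δ n (ε * Complex.exp (2 * Real.pi * (t : ℝ) * Complex.I))) ∧
      ∃ β : BraidGroup n, IsPositive β ∧ IsStrictlyPositive β ∧ IsClosureOf l β := by
  have hF (t : ℝ) := U.rootFunction_circle hε hεc (2 * Real.pi * t)
  push_cast at hF
  obtain ⟨p, l, hl⟩ := exists_loop (n := n)
    (g := fun t => rootFunction f δ n (ε * Complex.exp (2 * Real.pi * t * Complex.I))) (by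
      simp only [hF]
      exact continuous_ofTuple.comp (continuous_pi fun i => (hw.continuous i).comp (by fun_prop)))
    (fun t => hF t ▸ ofTuple_notMem_discriminantLocus (hw.injective _)) (by simp)
  exact ⟨p, l, hl, hw.exists_isStrictlyPositive Real.two_pi_pos (U.period_circleLift ε)
    fun t => (hl t).trans (hF t)⟩

end IsUniformization

theorem IsArgOfRate.exists_hasDerivAt {φ : ℝ → ℝ} {d : ℝ → ℂ} {m : ℝ} (h : IsArgOfRate φ d m)
    (hm : 0 < m) (θ : ℝ) : ∃ d' : ℝ, 0 < d' ∧ HasDerivAt φ d' θ :=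
  ⟨deriv φ θ, hm.trans_le (h.le_deriv θ), (h.differentiable θ).hasDerivAt⟩

end Monodromy

/-! ### Branches and components of the link -/

section Branches

theorem exp_I_mul_div_pow (τ : ℂ) {p : ℕ} (hp : 0 < p) :
    Complex.exp (Complex.I * τ / p) ^ p = Complex.exp (Complex.I * τ) := by
  rw [← Complex.exp_nat_mul, mul_div_cancel₀ _ (Nat.cast_ne_zero.2 hp.ne')]

theorem exp_I_mul_add_div (τ : ℂ) {p : ℕ} (hp : 0 < p) (k : ℤ) :
    Complex.exp (Complex.I * (τ + 2 * Real.pi * (p * k : ℤ)) / p) =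
      Complex.exp (Complex.I * τ / p) := by
  have hp' : (p : ℂ) ≠ 0 := Nat.cast_ne_zero.2 hp.ne'
  rw [show Complex.I * (τ + 2 * Real.pi * (p * k : ℤ)) / p =
    Complex.I * τ / p + k * (2 * Real.pi * Complex.I) by push_cast; field_simp,
    Complex.exp_add, Complex.exp_int_mul_two_pi_mul_I, mul_one]

theorem exists_exp_I_mul_div_eq_of_norm_pow_le {t : ℂ} (ht : t ≠ 0) {p : ℕ} (hp : 0 < p) {r : ℝ}
    (htr : ‖t‖ ^ p ≤ r) :
    ∃ τ : ℂ, -Real.log r ≤ τ.im ∧ Complex.exp (Complex.I * τ / p) = t := by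
  obtain ⟨τ, hτt, hτ⟩ := exists_exp_I_mul_div_eq ht hp
  refine ⟨τ, ?_, hτt⟩
  have : 0 < ‖t‖ := norm_pos_iff.2 ht
  rw [hτ, ← Real.log_pow]
  exact neg_le_neg (Real.log_le_log (by positivity) htr)

theorem norm_exp_I_mul_div_pow_le {τ : ℂ} {p : ℕ} (hp : 0 < p) {r : ℝ} (hr : 0 < r)
    (hτ : -Real.log r ≤ τ.im) : ‖Complex.exp (Complex.I * τ / p)‖ ^ p ≤ r := by
  rw [← norm_pow, exp_I_mul_div_pow τ hp, norm_exp_I_mul, ← Real.le_log_iff_exp_le hr]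
  linarith

theorem mem_ball_of_norm_pow_le {ε c : ℝ} (hεc : ε < Real.exp (-c)) {p : ℕ} (hp : 0 < p) {t : ℂ}
    (ht : ‖t‖ ^ p ≤ ε) : t ∈ Metric.ball (0 : ℂ) (Real.exp (-c / p)) := by
  refine mem_ball_zero_iff.2 (lt_of_pow_lt_pow_left₀ p (Real.exp_pos _).le ?_)
  rw [← Real.exp_nat_mul, mul_div_cancel₀ _ (Nat.cast_ne_zero.2 hp.ne')]
  exact ht.trans_lt hεc

theorem exists_zpow_apply_eq_self_iff_dvd {ι : Type*} [Finite ι] (π : Equiv.Perm ι) (i : ι) :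
    ∃ p : ℕ, 0 < p ∧ ∀ k : ℤ, (π ^ k) i = i ↔ (p : ℤ) ∣ k := by
  refine ⟨Function.minimalPeriod (π • ·) i, ?_, fun k =>
    MulAction.zpow_smul_eq_iff_minimalPeriod_dvd (a := π) (b := i) (n := k)⟩
  refine Function.IsPeriodicPt.minimalPeriod_pos (orderOf_pos π) ?_
  rw [Function.IsPeriodicPt, smul_iterate, pow_orderOf_eq_one]
  exact one_smul _ i

theorem connectedComponentIn_iUnion_eq {S ι : Type*} [TopologicalSpace S] [Finite ι]
    {K : ι → Set S} (hclosed : ∀ i, IsClosed (K i)) (hconn : ∀ i, IsPreconnected (K i))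
    (heq : ∀ i j, (K i ∩ K j).Nonempty → K i = K j) {i : ι} {x : S} (hx : x ∈ K i) :
    connectedComponentIn (⋃ j, K j) x = K i := by
  refine Set.Subset.antisymm (fun a ha => ?_)
    ((hconn i).subset_connectedComponentIn hx (Set.subset_iUnion K i))
  let others : Set S := ⋃ j ∈ {j | K j ≠ K i}, K j
  have hothers : IsClosed others := (Set.toFinite _).isClosed_biUnion fun j _ => hclosed j
  have hcover : ⋃ j, K j ⊆ K i ∪ others := Set.iUnion_subset fun j => by
    by_cases hj : K j = K i
    · exact hj ▸ Set.subset_union_left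
    · exact (Set.subset_biUnion_of_mem (u := K) hj).trans Set.subset_union_right
  refine (hcover (connectedComponentIn_subset _ _ ha)).resolve_right fun ha' => ?_
  obtain ⟨b, -, hbi, hb⟩ := isPreconnected_closed_iff.1 isPreconnected_connectedComponentIn _
    others (hclosed i) hothers ((connectedComponentIn_subset _ _).trans hcover)
    ⟨x, mem_connectedComponentIn (Set.mem_iUnion_of_mem i hx), hx⟩ ⟨a, ha, ha'⟩
  obtain ⟨j, hj, hbj⟩ := Set.mem_iUnion₂.1 hb
  exact hj (heq j i ⟨b, hbj, hbi⟩)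

/-- The knot over the circle of radius `r` traced by a function on the half plane. -/
def strandKnot (r : ℝ) (u : ℂ → ℂ) : Set (ℂ × ℂ) :=
  Set.range fun θ : ℝ => (Complex.exp (Complex.I * circleLift r θ), u (circleLift r θ))

theorem mem_strandKnot {r : ℝ} {u : ℂ → ℂ} {x : ℂ × ℂ} : x ∈ strandKnot r u ↔
    ∃ τ : ℂ, τ.im = -Real.log r ∧ (Complex.exp (Complex.I * τ), u τ) = x :=
  ⟨fun ⟨θ, hθ⟩ => ⟨_, im_circleLift r θ, hθ⟩, fun ⟨τ, hτ, hx⟩ => ⟨τ.re, by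
    simpa only [circleLift_re hτ] using hx⟩⟩

/-- The lift `u` of the branch `t ↦ (t ^ p, α t)`, `|t| ^ p ≤ ε`, to the half plane, along
`t = exp (I * τ / p)`. -/
def IsBranchLift (ε : ℝ) (p : ℕ) (α u : ℂ → ℂ) : Prop :=
  ∀ τ : ℂ, -Real.log ε ≤ τ.im → α (Complex.exp (Complex.I * τ / p)) = u τ

theorem IsBranchLift.branchKnot_eq {ε : ℝ} {p : ℕ} {α u : ℂ → ℂ} (h : IsBranchLift ε p α u)
    (hε : 0 < ε) (hp : 0 < p) : branchKnot ε p α = strandKnot ε u := by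
  ext x
  rw [mem_strandKnot]
  constructor
  · rintro ⟨t, ht : ‖t‖ ^ p = ε, rfl⟩
    have ht₀ : t ≠ 0 := by
      rintro rfl
      simp [hp.ne', hε.ne] at ht
    obtain ⟨τ, rfl, hτ⟩ := exists_exp_I_mul_div_eq ht₀ hp
    rw [← Real.log_pow, ht] at hτ
    exact ⟨τ, hτ, by simp only [exp_I_mul_div_pow τ hp, h τ hτ.ge]⟩
  · rintro ⟨τ, hτ, rfl⟩
    refine ⟨Complex.exp (Complex.I * τ / p), ?_, ?_⟩
    · rw [Set.mem_ofPred_eq, ← norm_pow, exp_I_mul_div_pow τ hp, norm_exp_I_mul, hτ, neg_neg,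
        Real.exp_log hε]
    · simp only [exp_I_mul_div_pow τ hp, h τ hτ.ge]

namespace IsUniformization

variable {f : ℂ[X][Y]} {δ c : ℝ} {n : ℕ} {w : Fin n → ℂ → ℂ} {π : Equiv.Perm (Fin n)}

theorem strandKnot_zpow_subset (U : IsUniformization f δ c w π) (r : ℝ) (i : Fin n) (k : ℤ) :
    strandKnot r (w ((π ^ k) i)) ⊆ strandKnot r (w i) := fun x hx => by
  obtain ⟨τ, hτ, rfl⟩ := mem_strandKnot.1 hx
  refine mem_strandKnot.2 ⟨τ + 2 * Real.pi * k, by simpa using hτ, ?_⟩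
  rw [exp_I_mul_eq_iff.2 ⟨k, rfl⟩, U.period_zpow]

theorem strandKnot_zpow (U : IsUniformization f δ c w π) (r : ℝ) (i : Fin n) (k : ℤ) :
    strandKnot r (w ((π ^ k) i)) = strandKnot r (w i) := by
  refine (U.strandKnot_zpow_subset r i k).antisymm ?_
  simpa [← Equiv.Perm.mul_apply, ← zpow_add] using U.strandKnot_zpow_subset r ((π ^ k) i) (-k)

theorem strandKnot_eq_of_mem (U : IsUniformization f δ c w π) {r : ℝ} (hr : 0 < r)
    (hrc : r < Real.exp (-c)) {i j : Fin n} {x : ℂ × ℂ} (hi : x ∈ strandKnot r (w i))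
    (hj : x ∈ strandKnot r (w j)) : strandKnot r (w i) = strandKnot r (w j) := by
  obtain ⟨τ, hτ, rfl⟩ := mem_strandKnot.1 hi
  obtain ⟨σ, -, hσ⟩ := mem_strandKnot.1 hj
  obtain ⟨hexp, hw⟩ := Prod.ext_iff.1 hσ
  obtain ⟨k, rfl⟩ := exp_I_mul_eq_iff.1 hexp
  rw [← U.injective τ (hτ ▸ lt_neg_log hr hrc) ((U.period_zpow k j τ).symm.trans hw),
    U.strandKnot_zpow]

theorem evalEval_exp (U : IsUniformization f δ c w π) {τ : ℂ} (hτ : c < τ.im) (i : Fin n) :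
    f.evalEval (Complex.exp (Complex.I * τ)) (w i τ) = 0 := by
  have hmem : w i τ ∈ localRoots f δ (Complex.exp (Complex.I * τ)) := by
    rw [U.roots τ hτ]
    exact Multiset.mem_map_of_mem _ (Finset.mem_univ i)
  exact (mem_localRoots.1 hmem).2.1

theorem evalEval_zero (U : IsUniformization f δ c w π) (hn : 0 < n) : f.evalEval 0 0 = 0 := by
  have hmem : (0 : ℂ) ∈ localRoots f δ 0 := by
    rw [U.center]
    exact Multiset.mem_replicate.2 ⟨hn.ne', rfl⟩
  exact (mem_localRoots.1 hmem).2.1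

theorem injOn_of_isBranchLift (U : IsUniformization f δ c w π) {ε : ℝ} (hε : 0 < ε)
    (hεc : ε < Real.exp (-c)) {p : ℕ} (hp : 0 < p) {α : ℂ → ℂ} {i : Fin n}
    (h : IsBranchLift ε p α (w i)) (hdvd : ∀ k : ℤ, (π ^ k) i = i → (p : ℤ) ∣ k) :
    Set.InjOn (fun t : ℂ => (t ^ p, α t)) {t | ‖t‖ ^ p ≤ ε} := by
  intro t ht s hs hts
  obtain ⟨hpow, hαts⟩ := Prod.ext_iff.1 hts
  simp only at hpow hαts
  by_cases ht₀ : t = 0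
  · rw [ht₀, zero_pow hp.ne', eq_comm, pow_eq_zero_iff hp.ne'] at hpow
    rw [ht₀, hpow]
  have hs₀ : s ≠ 0 := fun hs₀ => ht₀ <| by
    rwa [hs₀, zero_pow hp.ne', pow_eq_zero_iff hp.ne'] at hpow
  obtain ⟨τ, hτ, rfl⟩ := exists_exp_I_mul_div_eq_of_norm_pow_le ht₀ hp ht
  obtain ⟨σ, hσ, rfl⟩ := exists_exp_I_mul_div_eq_of_norm_pow_le hs₀ hp hs
  rw [exp_I_mul_div_pow τ hp, exp_I_mul_div_pow σ hp] at hpow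
  obtain ⟨k, rfl⟩ := exp_I_mul_eq_iff.1 hpow
  rw [h _ hτ, h σ hσ, U.period_zpow] at hαts
  obtain ⟨m, rfl⟩ := hdvd k (U.injective σ ((lt_neg_log hε hεc).trans_le hσ) hαts)
  exact exp_I_mul_add_div σ hp m

theorem exists_isBranch (U : IsUniformization f δ c w π) {ε : ℝ} (hε : 0 < ε)
    (hεc : ε < Real.exp (-c)) (i : Fin n) : ∃ (p : ℕ) (α : ℂ → ℂ), IsBranch f ε p α ∧
      branchKnot ε p α = strandKnot ε (w i) := by
  obtain ⟨p, hp, hdvd⟩ := exists_zpow_apply_eq_self_iff_dvd π i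
  have hper (τ : ℂ) : w i (τ + 2 * Real.pi * p) = w i τ := by
    simpa only [(hdvd p).2 dvd_rfl, Int.cast_natCast] using U.period_zpow p i τ
  obtain ⟨α, hα, hα₀, hαw⟩ := exists_eq_comp_exp hp (U.differentiableAt i) hper (U.tendsto_zero i)
  have hlift : IsBranchLift ε p α (w i) := fun τ _ => hαw τ
  refine ⟨p, α, ⟨hp, ?_, hα₀, U.injOn_of_isBranchLift hε hεc hp hlift fun k => (hdvd k).1,
    fun t ht => ?_⟩, hlift.branchKnot_eq hε hp⟩
  · exact (hα.analyticOnNhd Metric.isOpen_ball).mono fun t ht => mem_ball_of_norm_pow_le hεc hp ht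
  · by_cases ht₀ : t = 0
    · rw [ht₀, hα₀, zero_pow hp.ne', U.evalEval_zero i.pos]
    · obtain ⟨τ, hτ, rfl⟩ := exists_exp_I_mul_div_eq_of_norm_pow_le ht₀ hp ht
      rw [exp_I_mul_div_pow τ hp, hαw, U.evalEval_exp ((lt_neg_log hε hεc).trans_le hτ)]

theorem singularityLink_eq_iUnion (U : IsUniformization f δ c w π) (hδ : 0 < δ) {ε : ℝ}
    (hε : 0 < ε) (hεc : ε < Real.exp (-c)) :
    singularityLink f ε δ = ⋃ i, strandKnot ε (w i) := by
  have hc := lt_neg_log hε hεc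
  rw [U.singularityLink_eq hδ hε hεc]
  ext ⟨z, x⟩
  simp only [Set.mem_iUnion, mem_strandKnot, Prod.mk.injEq]
  constructor
  · rintro ⟨hz : ‖z‖ = ε, hx : x ∈ (rootFunction f δ n z).toMultiset⟩
    obtain ⟨τ, -, rfl⟩ := exists_exp_I_mul_eq (norm_pos_iff.1 (hz ▸ hε)) (hz.trans_lt hεc)
    have hτ : τ.im = -Real.log ε := by rw [← hz, norm_exp_I_mul, Real.log_exp, neg_neg]
    rw [U.rootFunction_exp (hτ ▸ hc), mem_toMultiset_ofTuple] at hx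
    obtain ⟨i, rfl⟩ := hx
    exact ⟨i, τ, hτ, rfl, rfl⟩
  · rintro ⟨i, τ, hτ, rfl, rfl⟩
    refine ⟨?_, ?_⟩
    · simp only [norm_exp_I_mul, hτ, neg_neg, Real.exp_log hε]
    · simp only [U.rootFunction_exp (hτ ▸ hc)]
      exact mem_toMultiset_ofTuple.2 ⟨i, rfl⟩

theorem continuous_strand (U : IsUniformization f δ c w π) {r : ℝ} (hr : 0 < r)
    (hrc : r < Real.exp (-c)) (i : Fin n) : Continuous fun θ : ℝ =>
      (Complex.exp (Complex.I * circleLift r θ), w i (circleLift r θ)) := by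
  have := continuous_circleLift r
  exact (by fun_prop : Continuous _).prodMk (U.continuous_comp_circleLift hr hrc i)

theorem isClosed_strandKnot (U : IsUniformization f δ c w π) {r : ℝ} (hr : 0 < r)
    (hrc : r < Real.exp (-c)) (i : Fin n) : IsClosed (strandKnot r (w i)) := by
  have hlift (θ : ℝ) : circleLift r (θ + 2 * Real.pi * orderOf π) =
      circleLift r θ + 2 * Real.pi * (orderOf π : ℤ) := by
    rw [circleLift_add]
    push_cast
    rfl
  have hper : Function.Periodic (fun θ : ℝ =>
      (Complex.exp (Complex.I * circleLift r θ), w i (circleLift r θ)))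
      (2 * Real.pi * orderOf π) := fun θ => by
    simp only [hlift, exp_I_mul_eq_iff.2 ⟨(orderOf π : ℤ), rfl⟩, U.period_zpow, zpow_natCast,
      pow_orderOf_eq_one, Equiv.Perm.one_apply]
  exact (hper.compact_of_continuous
    (mul_pos Real.two_pi_pos (by exact_mod_cast orderOf_pos π)).ne'
    (U.continuous_strand hr hrc i)).isClosed

theorem connectedComponentIn_eq (U : IsUniformization f δ c w π) (hδ : 0 < δ) {ε : ℝ}
    (hε : 0 < ε) (hεc : ε < Real.exp (-c)) {i : Fin n} {x : ℂ × ℂ} (hx : x ∈ strandKnot ε (w i)) :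
    connectedComponentIn (singularityLink f ε δ) x = strandKnot ε (w i) := by
  rw [U.singularityLink_eq_iUnion hδ hε hεc]
  exact connectedComponentIn_iUnion_eq (U.isClosed_strandKnot hε hεc)
    (fun j => isPreconnected_range (U.continuous_strand hε hεc j))
    (fun j k ⟨_, hj, hk⟩ => U.strandKnot_eq_of_mem hε hεc hj hk) hx

theorem exists_isBranch_connectedComponentIn_eq (U : IsUniformization f δ c w π) (hδ : 0 < δ)
    {ε : ℝ} (hε : 0 < ε) (hεc : ε < Real.exp (-c)) {x : ℂ × ℂ}
    (hx : x ∈ singularityLink f ε δ) : ∃ (p : ℕ) (α : ℂ → ℂ), IsBranch f ε p α ∧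
      connectedComponentIn (singularityLink f ε δ) x = branchKnot ε p α := by
  obtain ⟨i, hi⟩ := Set.mem_iUnion.1 (U.singularityLink_eq_iUnion hδ hε hεc ▸ hx)
  obtain ⟨p, α, hα, hknot⟩ := U.exists_isBranch hε hεc i
  exact ⟨p, α, hα, by rw [U.connectedComponentIn_eq hδ hε hεc hi, hknot]⟩

theorem norm_lt_of_isBranch (U : IsUniformization f δ c w π) (hδ : 0 < δ) {ε : ℝ}
    (hεc : ε < Real.exp (-c)) {p : ℕ} {α : ℂ → ℂ} (h : IsBranch f ε p α) {t : ℂ}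
    (ht : ‖t‖ ^ p ≤ ε) : ‖α t‖ < δ := by
  by_contra! hge
  have hseg : ∀ s ∈ Set.Icc (0 : ℝ) 1, ‖(s : ℂ) * t‖ ^ p ≤ ε := fun s hs => by
    refine le_trans (pow_le_pow_left₀ (norm_nonneg _) ?_ p) ht
    rw [norm_mul, Complex.norm_real, Real.norm_of_nonneg hs.1]
    exact mul_le_of_le_one_left (norm_nonneg _) hs.2
  have hcont : ContinuousOn (fun s : ℝ => ‖α (s * t)‖) (Set.Icc 0 1) :=
    (h.analytic.continuousOn.comp (by fun_prop) hseg).norm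
  obtain ⟨s, hs, hsδ⟩ := intermediate_value_Icc zero_le_one hcont
    (show δ ∈ Set.Icc _ _ by simpa [h.origin, hδ.le] using hge)
  exact U.boundary _ _ (by simpa only [norm_pow] using (hseg s hs).trans_lt hεc) hsδ
    (h.onCurve _ (hseg s hs))

theorem exists_isBranchLift (U : IsUniformization f δ c w π) (hδ : 0 < δ) {ε : ℝ} (hε : 0 < ε)
    (hεc : ε < Real.exp (-c)) {p : ℕ} {α : ℂ → ℂ} (h : IsBranch f ε p α) :
    ∃ i, IsBranchLift ε p α (w i) := by
  have hc {τ : ℂ} (hτ : -Real.log ε ≤ τ.im) : c < τ.im := (lt_neg_log hε hεc).trans_le hτ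
  have hmaps : Set.MapsTo (fun τ : ℂ => Complex.exp (Complex.I * τ / p))
      {τ | -Real.log ε ≤ τ.im} {t | ‖t‖ ^ p ≤ ε} := fun τ => norm_exp_I_mul_div_pow_le h.pos hε
  have hsections : IsSections (fun τ => Set.range fun j => w j τ) {τ | -Real.log ε ≤ τ.im} w :=
    ⟨fun j τ hτ => (U.differentiableAt j τ (hc hτ)).continuousAt.continuousWithinAt,
      fun τ hτ => U.injective τ (hc hτ), fun _ _ => rfl⟩
  refine hsections.exists_eqOn (convex_halfSpace_im_ge _).isPreconnected
    ⟨circleLift ε 0, (im_circleLift ε 0).ge⟩ subset_rfl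
    (h.analytic.continuousOn.comp (by fun_prop) hmaps) fun τ hτ => ?_
  have hroot : α (Complex.exp (Complex.I * τ / p)) ∈
      localRoots f δ (Complex.exp (Complex.I * τ)) := by
    rw [U.mem_localRoots_iff hδ (norm_exp_I_mul_lt (hc hτ)), ← exp_I_mul_div_pow τ h.pos]
    exact ⟨h.onCurve _ (hmaps hτ), U.norm_lt_of_isBranch hδ hεc h (hmaps hτ)⟩
  rw [U.roots τ (hc hτ), Multiset.mem_map] at hroot
  exact hroot.imp fun j => And.right

end IsUniformization

end Branches

/-! ### Linking numbers and intersection numbers -/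

section Linking

theorem prod_Ico_eq_prod_range_of_periodic {M : Type*} [CommMonoid M] {g : ℕ → M} {q : ℕ}
    (hg : Function.Periodic g q) (m : ℕ) :
    ∏ k ∈ Finset.Ico m (m + q), g k = ∏ k ∈ Finset.range q, g k := by
  have hmod := congrArg (fun s => (Multiset.map g s).prod) (Nat.multiset_Ico_map_mod m q)
  simp only [Multiset.map_map, Function.comp_def, hg.map_mod_nat] at hmod
  exact hmod

theorem nthRoots_exp_I_mul {q : ℕ} (hq : 0 < q) (τ : ℂ) :
    nthRoots q (Complex.exp (Complex.I * τ)) =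
      (Multiset.range q).map fun k : ℕ =>
        Complex.exp (Complex.I * (τ + 2 * Real.pi * k) / q) := by
  rw [(Complex.isPrimitiveRoot_exp q hq.ne').nthRoots_eq (exp_I_mul_div_pow τ hq)]
  refine Multiset.map_congr rfl fun k _ => ?_
  rw [← Complex.exp_nat_mul, ← Complex.exp_add]
  congr 1
  ring

theorem hasWindingNumber_of_eq_exp {g Λ : ℝ → ℂ} {m : ℤ} (hΛ : Continuous Λ)
    (hg : ∀ θ, g θ = Complex.exp (Λ θ))
    (hm : Λ (2 * Real.pi) - Λ 0 = (2 * Real.pi * m : ℝ) * Complex.I) : HasWindingNumber g m := by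
  refine ⟨fun θ => (Λ θ).im, Complex.continuous_im.comp hΛ, fun θ => ⟨?_, ?_⟩, ?_⟩
  · rw [hg]
    exact Complex.exp_ne_zero _
  · rw [hg, Complex.norm_exp, Complex.ofReal_exp, ← Complex.exp_add, Complex.re_add_im]
  · rw [← Complex.sub_im, hm, Complex.im_ofReal_mul, Complex.I_im, mul_one]

theorem hasWindingNumber_prod_exp {r : ℝ} {ℓ : ℂ → ℂ} {p : ℕ} {m : ℤ}
    (hℓ : ContinuousOn ℓ {τ | τ.im = -Real.log r})
    (hper : ∀ τ, ℓ (τ + 2 * Real.pi * p) = ℓ τ + (2 * Real.pi * m : ℝ) * Complex.I) :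
    HasWindingNumber (fun θ => ∏ k ∈ Finset.range p,
      Complex.exp (ℓ (circleLift r θ + 2 * Real.pi * k))) m := by
  have hlift := continuous_circleLift r
  refine hasWindingNumber_of_eq_exp
    (Λ := fun θ => ∑ k ∈ Finset.range p, ℓ (circleLift r θ + 2 * Real.pi * k))
    (continuous_finsetSum _ fun k _ => hℓ.comp_continuous (by fun_prop) fun θ => ?_)
    (fun θ => (Complex.exp_sum _ _).symm) ?_
  · simp [im_circleLift]
  -- one turn replaces the `k`-th factor by the next one, so the sum telescopes
  have hturn (k : ℕ) : circleLift r (2 * Real.pi) + 2 * Real.pi * k =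
      circleLift r 0 + 2 * Real.pi * (k + 1 : ℕ) := by
    rw [← zero_add (2 * Real.pi), circleLift_add]
    push_cast
    ring
  simp only [hturn]
  rw [← Finset.sum_sub_distrib,
    Finset.sum_range_sub (fun k : ℕ => ℓ (circleLift r 0 + 2 * Real.pi * k)), hper]
  simp

theorem IsBranchLift.sheets_exp {ε : ℝ} {p : ℕ} {α u : ℂ → ℂ} (h : IsBranchLift ε p α u)
    (hp : 0 < p) {τ : ℂ} (hτ : -Real.log ε ≤ τ.im) : sheets p α (Complex.exp (Complex.I * τ)) =
      (Multiset.range p).map fun k : ℕ => u (τ + 2 * Real.pi * k) := by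
  rw [sheets, nthRoots_exp_I_mul hp, Multiset.map_map]
  exact Multiset.map_congr rfl fun k _ => h _ (by simpa using hτ)

/-- The equation `∏ (w - β s)`, `s ^ q = z`, of a branch with lift `v` to the half plane, along a
branch with lift `u`. -/
def sheetProduct (q : ℕ) (u v : ℂ → ℂ) (τ : ℂ) : ℂ :=
  ∏ k ∈ Finset.range q, (u τ - v (τ + 2 * Real.pi * k))

section SheetProduct

variable {p q : ℕ} {u v : ℂ → ℂ}

theorem sheetProduct_add (hv : ∀ τ, v (τ + 2 * Real.pi * q) = v τ) (m : ℕ) (τ : ℂ) :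
    sheetProduct q u v (τ + 2 * Real.pi * m) =
      ∏ k ∈ Finset.range q, (u (τ + 2 * Real.pi * m) - v (τ + 2 * Real.pi * k)) := by
  have hper : Function.Periodic
      (fun k : ℕ => u (τ + 2 * Real.pi * m) - v (τ + 2 * Real.pi * k)) q := fun k => by
    simp only [Nat.cast_add, mul_add, ← add_assoc, hv]
  rw [← prod_Ico_eq_prod_range_of_periodic hper m, Finset.prod_Ico_eq_prod_range,
    Nat.add_sub_cancel_left, sheetProduct]
  simp only [Nat.cast_add, mul_add, add_assoc]

theorem sheetProduct_period (hu : ∀ τ, u (τ + 2 * Real.pi * p) = u τ)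
    (hv : ∀ τ, v (τ + 2 * Real.pi * q) = v τ) (τ : ℂ) :
    sheetProduct q u v (τ + 2 * Real.pi * p) = sheetProduct q u v τ := by
  rw [sheetProduct_add hv, hu, sheetProduct]

theorem intersectionNumber_eq_analyticOrderAt {f : ℂ[X][Y]} {ε : ℝ} {α β G : ℂ → ℂ} (hε : 0 < ε)
    (hα : IsBranch f ε p α) (hβ : IsBranch f ε q β) (hu : IsBranchLift ε p α u)
    (hv : IsBranchLift ε q β v) (hG₀ : G 0 = 0)
    (hG : ∀ τ, G (Complex.exp (Complex.I * τ / p)) = sheetProduct q u v τ) :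
    intersectionNumber p α q β = analyticOrderAt G 0 := by
  refine analyticOrderAt_congr ?_
  have hsmall : ∀ᶠ t in nhds (0 : ℂ), ‖t‖ ^ p < ε :=
    (show ContinuousAt (fun t : ℂ => ‖t‖ ^ p) 0 by fun_prop).eventually
      (gt_mem_nhds (by simpa [hα.pos.ne'] using hε))
  filter_upwards [hsmall] with t ht
  by_cases ht₀ : t = 0
  · rw [ht₀, hG₀, zero_pow hα.pos.ne', sheets, nthRoots_zero_right, Multiset.map_replicate,
      hβ.origin, hα.origin, Multiset.map_replicate, Multiset.prod_replicate, sub_zero,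
      zero_pow hβ.pos.ne']
  · obtain ⟨τ, hτ, rfl⟩ := exists_exp_I_mul_div_eq_of_norm_pow_le ht₀ hα.pos ht.le
    rw [exp_I_mul_div_pow τ hα.pos, hv.sheets_exp hβ.pos hτ, hu τ hτ, hG, Multiset.map_map]
    rfl

theorem prod_sheets_sub {ε : ℝ} {α β : ℂ → ℂ} (hp : 0 < p) (hq : 0 < q)
    (hu : IsBranchLift ε p α u) (hv : IsBranchLift ε q β v)
    (hvq : ∀ τ, v (τ + 2 * Real.pi * q) = v τ) {τ : ℂ} (hτ : -Real.log ε ≤ τ.im) :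
    ((sheets p α (Complex.exp (Complex.I * τ))).map fun a =>
      ((sheets q β (Complex.exp (Complex.I * τ))).map fun b => a - b).prod).prod =
      ∏ k ∈ Finset.range p, sheetProduct q u v (τ + 2 * Real.pi * k) := by
  rw [hu.sheets_exp hp hτ, hv.sheets_exp hq hτ, Multiset.map_map]
  refine congrArg Multiset.prod (Multiset.map_congr rfl fun k _ => ?_)
  rw [Function.comp_apply, sheetProduct_add hvq, Multiset.map_map]
  rfl

theorem hasLinkingNumber_sheets {ε c : ℝ} {m : ℕ} {α β L : ℂ → ℂ} (hε : 0 < ε)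
    (hεc : ε < Real.exp (-c)) (hp : 0 < p) (hq : 0 < q) (hu : IsBranchLift ε p α u)
    (hv : IsBranchLift ε q β v) (hvq : ∀ τ, v (τ + 2 * Real.pi * q) = v τ)
    (hL : ContinuousOn L (Metric.ball 0 (Real.exp (-c / p))))
    (hprod : ∀ τ : ℂ, c < τ.im → sheetProduct q u v τ =
      Complex.exp (Complex.I * τ / p) ^ m * Complex.exp (L (Complex.exp (Complex.I * τ / p)))) :
    HasLinkingNumber ε (sheets p α) (sheets q β) m := by
  let ℓ (τ : ℂ) : ℂ := m * (Complex.I * τ / p) + L (Complex.exp (Complex.I * τ / p))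
  have hmaps : Set.MapsTo (fun τ : ℂ => Complex.exp (Complex.I * τ / p))
      {τ | τ.im = -Real.log ε} (Metric.ball 0 (Real.exp (-c / p))) := fun τ hτ =>
    mem_ball_of_norm_pow_le hεc hp (norm_exp_I_mul_div_pow_le hp hε (Eq.ge hτ))
  have hℓ : ContinuousOn ℓ {τ | τ.im = -Real.log ε} :=
    (show Continuous fun τ : ℂ => (m : ℂ) * (Complex.I * τ / p) by fun_prop).continuousOn.add
      (hL.comp (by fun_prop) hmaps)
  have hper (τ : ℂ) : ℓ (τ + 2 * Real.pi * p) = ℓ τ + (2 * Real.pi * (m : ℤ) : ℝ) * Complex.I := by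
    have hp' : (p : ℂ) ≠ 0 := Nat.cast_ne_zero.2 hp.ne'
    have hexp := exp_I_mul_add_div τ hp 1
    rw [mul_one, Int.cast_natCast] at hexp
    simp only [ℓ, hexp]
    push_cast
    field_simp
    ring
  unfold HasLinkingNumber
  convert hasWindingNumber_prod_exp hℓ hper using 2 with θ
  rw [← exp_I_mul_circleLift hε, prod_sheets_sub hp hq hu hv hvq (im_circleLift ε θ).ge]
  refine Finset.prod_congr rfl fun k _ => ?_
  rw [hprod _ (by simpa using lt_im_circleLift hε hεc θ), ← Complex.exp_nat_mul,
    ← Complex.exp_add]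

end SheetProduct

namespace IsUniformization

variable {f : ℂ[X][Y]} {δ c : ℝ} {n : ℕ} {w : Fin n → ℂ → ℂ} {π : Equiv.Perm (Fin n)}

theorem period_of_isBranchLift (U : IsUniformization f δ c w π) {ε : ℝ} (hε : 0 < ε)
    (hεc : ε < Real.exp (-c)) {q : ℕ} (hq : 0 < q) {β : ℂ → ℂ} {j : Fin n}
    (h : IsBranchLift ε q β (w j)) (τ : ℂ) : w j (τ + 2 * Real.pi * q) = w j τ := by
  suffices hπ : (π ^ q) j = j by rw [U.period_pow, hπ]
  set σ := circleLift ε 0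
  have hσ : -Real.log ε ≤ σ.im := (im_circleLift ε 0).ge
  have hexp := exp_I_mul_add_div σ hq 1
  rw [mul_one, Int.cast_natCast] at hexp
  refine U.injective σ (lt_im_circleLift hε hεc 0) ?_
  simp only
  rw [← U.period_pow, ← h _ (by simpa using hσ), hexp, h σ hσ]

theorem differentiableAt_sheetProduct (U : IsUniformization f δ c w π) (q : ℕ) (i j : Fin n)
    {τ : ℂ} (hτ : c < τ.im) : DifferentiableAt ℂ (sheetProduct q (w i) (w j)) τ := by
  refine DifferentiableAt.fun_finsetProd fun k _ => (U.differentiableAt i τ hτ).sub ?_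
  simp only [U.period_pow]
  exact U.differentiableAt _ τ hτ

theorem tendsto_sheetProduct (U : IsUniformization f δ c w π) {q : ℕ} (hq : 0 < q)
    (i j : Fin n) : Filter.Tendsto (sheetProduct q (w i) (w j))
      (Filter.comap Complex.im Filter.atTop) (nhds 0) := by
  unfold sheetProduct
  simp only [U.period_pow]
  simpa [hq.ne'] using tendsto_finsetProd (Finset.range q) fun k _ =>
    (U.tendsto_zero i).sub (U.tendsto_zero ((π ^ k) j))

theorem sheetProduct_ne_zero (U : IsUniformization f δ c w π) (q : ℕ) {i j : Fin n}
    (hij : ∀ k : ℕ, i ≠ (π ^ k) j) {τ : ℂ} (hτ : c < τ.im) :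
    sheetProduct q (w i) (w j) τ ≠ 0 := by
  refine Finset.prod_ne_zero_iff.2 fun k _ => sub_ne_zero.2 fun h => hij k ?_
  exact U.injective τ hτ (h.trans (U.period_pow k j τ))

theorem exists_hasLinkingNumber (U : IsUniformization f δ c w π) (hδ : 0 < δ) {ε : ℝ} (hε : 0 < ε)
    (hεc : ε < Real.exp (-c)) {p q : ℕ} {α β : ℂ → ℂ} (hα : IsBranch f ε p α)
    (hβ : IsBranch f ε q β) (hne : branchKnot ε p α ≠ branchKnot ε q β) :
    ∃ m : ℕ, 0 < m ∧ intersectionNumber p α q β = m ∧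
      HasLinkingNumber ε (sheets p α) (sheets q β) m := by
  obtain ⟨i, hi⟩ := U.exists_isBranchLift hδ hε hεc hα
  obtain ⟨j, hj⟩ := U.exists_isBranchLift hδ hε hεc hβ
  have hij (k : ℕ) : i ≠ (π ^ k) j := fun h => hne <| by
    rw [hi.branchKnot_eq hε hα.pos, hj.branchKnot_eq hε hβ.pos, h, ← zpow_natCast,
      U.strandKnot_zpow]
  have hqj := U.period_of_isBranchLift hε hεc hβ.pos hj
  obtain ⟨G, L, m, hG₀, hG, hm, hord, hL, hGL⟩ := exists_comp_exp_eq_pow_mul_exp hα.pos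
    (fun τ => U.differentiableAt_sheetProduct q i j)
    (sheetProduct_period (U.period_of_isBranchLift hε hεc hα.pos hi) hqj)
    (U.tendsto_sheetProduct hβ.pos i j) (fun τ => U.sheetProduct_ne_zero q hij)
  refine ⟨m, hm, (intersectionNumber_eq_analyticOrderAt hε hα hβ hi hj hG₀ hG).trans hord,
    hasLinkingNumber_sheets hε hεc hα.pos hβ.pos hi hj hqj hL.continuousOn fun τ hτ => ?_⟩
  rw [← hG, hGL _ ?_]
  rw [mem_ball_zero_iff, norm_exp_I_mul_div, Real.exp_lt_exp]
  exact div_lt_div_of_pos_right (neg_lt_neg hτ) (Nat.cast_pos.2 hα.pos)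

end IsUniformization

end Linking

end BraidLink

end

theorem mainTheorem1 (f : ℂ[X][Y]) (hsq : Squarefree f) (hz : ¬ ((C X : ℂ[X][Y]) ∣ f))
    (h0 : f.evalEval 0 0 = 0)
    (n : ℕ) (hn : n = (f.map (evalRingHom (0 : ℂ))).rootMultiplicity 0) :
    0 < n ∧
    ∃ δ₀ : ℝ, 0 < δ₀ ∧ ∀ δ : ℝ, 0 < δ → δ ≤ δ₀ →
    ∃ ε₀ : ℝ, 0 < ε₀ ∧ ∀ ε : ℝ, 0 < ε → ε ≤ ε₀ →
    ∃ F : ℂ → BraidLink.UnorderedTuples n,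
      -- `F` is the `n`-valued analytic function `z ↦ {w : f(z, w) = 0}` near the origin
      (∀ z : ℂ, ‖z‖ ≤ ε → (F z).toMultiset = BraidLink.localRoots f δ z) ∧
      ContinuousOn F (Metric.closedBall 0 ε) ∧
      BraidLink.IsAnalyticMultivaluedOn F (Metric.ball 0 ε) ∧
      (F 0).toMultiset = Multiset.replicate n 0 ∧
      (∀ z : ℂ, ‖z‖ ≤ ε → z ≠ 0 → F z ∉ BraidLink.discriminantLocus n) ∧
      -- its graph over `|z| = ε` is the link of the singularity
      BraidLink.singularityLink f ε δ = {x : ℂ × ℂ | ‖x.1‖ = ε ∧ x.2 ∈ (F x.1).toMultiset} ∧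
      -- `d arg (w_i - w_j) / d arg z > 0` for `0 < |z| ≤ ε`
      (∀ r : ℝ, 0 < r → r ≤ ε → ∃ w : Fin n → ℝ → ℂ,
        (∀ i, Continuous (w i)) ∧
        (∀ θ : ℝ, F (r * Complex.exp (θ * Complex.I)) = BraidLink.ofTuple (fun i => w i θ)) ∧
        ∀ i j : Fin n, i ≠ j → ∃ φ : ℝ → ℝ, ∀ θ : ℝ,
          w i θ ≠ w j θ ∧
          w i θ - w j θ = ‖w i θ - w j θ‖ * Complex.exp (φ θ * Complex.I) ∧
          ∃ d : ℝ, 0 < d ∧ HasDerivAt φ d θ) ∧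
      -- the link is a strictly positive closed braid
      (∃ (p : BraidLink.Conf n) (l : Path p p),
        (∀ t : unitInterval,
          (l t).1 = F (ε * Complex.exp (2 * Real.pi * (t : ℝ) * Complex.I))) ∧
        ∃ β : BraidLink.BraidGroup n, BraidLink.IsPositive β ∧ BraidLink.IsStrictlyPositive β ∧
          BraidLink.IsClosureOf l β) ∧
      -- the components of the link are the knots of the branches; the linking number of two of
      -- them is the intersection number of the branches, and is positive
      (∀ x ∈ BraidLink.singularityLink f ε δ, ∃ (p : ℕ) (α : ℂ → ℂ),
        BraidLink.IsBranch f ε p α ∧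
        connectedComponentIn (BraidLink.singularityLink f ε δ) x =
          BraidLink.branchKnot ε p α) ∧
      (∀ (p q : ℕ) (α β : ℂ → ℂ), BraidLink.IsBranch f ε p α → BraidLink.IsBranch f ε q β →
        BraidLink.branchKnot ε p α ≠ BraidLink.branchKnot ε q β →
        ∃ m : ℕ, 0 < m ∧ BraidLink.intersectionNumber p α q β = m ∧
          BraidLink.HasLinkingNumber ε (BraidLink.sheets p α) (BraidLink.sheets q β) m) := by
  refine ⟨?_, ?_⟩
  · rw [hn, rootMultiplicity_pos (BraidLink.map_evalRingHom_zero_ne_zero hz), IsRoot,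
      map_evalRingHom_eval, h0]
  obtain ⟨δ₀, hδ₀, hunif⟩ := BraidLink.exists_isUniformization hsq hz hn
  refine ⟨δ₀, hδ₀, fun δ hδ hδle => ?_⟩
  obtain ⟨c, w, π, U⟩ := hunif δ hδ hδle
  obtain ⟨m, hm, ε₀, hε₀, hε₀c, harg⟩ := U.exists_isArgOfRate_sub
  refine ⟨ε₀, hε₀, fun ε hε hεle => ?_⟩
  have hεc : ε < Real.exp (-c) := hεle.trans_lt hε₀c
  exact ⟨BraidLink.rootFunction f δ n,
    fun z hz => U.toMultiset_rootFunction (hz.trans_lt hεc),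
    fun z hz => (U.continuousAt_rootFunction
      ((mem_closedBall_zero_iff.1 hz).trans_lt hεc)).continuousWithinAt,
    fun k => (U.isAnalyticMultivaluedOn k).mono (Metric.ball_subset_ball hεc.le),
    by rw [U.rootFunction_zero, BraidLink.ofTuple_zero_toMultiset],
    fun z hz hz₀ => U.rootFunction_notMem_discriminantLocus hz₀ (hz.trans_lt hεc),
    U.singularityLink_eq hδ hε hεc,
    fun r hr hrε => ⟨fun i θ => w i (BraidLink.circleLift r θ),
      U.continuous_comp_circleLift hr (hrε.trans_lt hεc),
      U.rootFunction_circle hr (hrε.trans_lt hεc),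
      fun i j hij => (harg r hr (hrε.trans hεle) i j hij).imp fun φ hφ θ =>
        ⟨sub_ne_zero.1 (hφ.ne_zero θ), hφ.eq θ, hφ.exists_hasDerivAt hm θ⟩⟩,
    U.exists_closedBraid hε hεc (U.isTurning hm hε hεc (harg ε hε hεle)),
    fun x hx => U.exists_isBranch_connectedComponentIn_eq hδ hε hεc hx,
    fun p q α β hα hβ hne => U.exists_hasLinkingNumber hδ hε hεc hα hβ hne⟩
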